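/- \textbf{Setting.} Let $\varepsilon_i$, $i\in\mathbb Z$, be i.i.d. random vectors in $\mathbb R^{\tilde d}$ and $\mathcal G_i=(\varepsilon_i,\varepsilon_{i-1},\dots)$. For $n\in\mathbb N$ and $i=1,\dots,n$ let $X_i=X_{i,n}=J_{i,n}(\mathcal G_i)$ be real-valued with measurable $J_{i,n}$; for $u\in[0,1]$ let $\tilde X_i(u)=J(\mathcal G_i,u)$ with $J(\cdot,u)$ measurable. Write $\|W\|_q=(\mathbb E|W|^q)^{1/q}$. Let $\mathcal G_i^{*(i-j)}$ be $\mathcal G_i$ with $\varepsilon_{i-j}$ replaced by an independent copy, $X_i^{*(i-j)}=J_{i,n}(\mathcal G_i^{*(i-j)})$, and $\delta^X_q(j)=\sup_{1\le i\le n}\|X_i-X_i^{*(i-j)}\|_q$. Let $M\ge 1$, $C_X>0$, $\varsigma\in(0,1]$, $\nu>2$ be such that for all $n$, $1\le i\le n$, $u_1,u_2\in[0,1]$: $\|\tilde X_0(u_1)\|_{2M}\le C_X$, $\|X_i\|_{\nu M}\le C_X$, $\|X_i\|_{2M}\le C_X$, $\|X_i-\tilde X_i(\tfrac in)\|_{2M}\le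 C_Xn^{-\varsigma}$ and $\|\tilde X_0(u_1)-\tilde X_0(u_2)\|_{2M}\le C_X|u_1-u_2|^{\varsigma}$. Let $K:\mathbb R\to\mathbb R$ be bounded and Lipschitz with $\int K=1$, $\int K^2\in(0,\infty)$ and support in $[-\tfrac12,\tfrac12]$, and put $K_h(x)=\tfrac1hK(\tfrac xh)$. Let $h=h_n>0$ with $h\to0$ and $nh\to\infty$. Let $k\ge 1$, let $\Theta\subset\mathbb R^{d_\Theta}$ be compact, $\theta_0:[0,1]\to\mathrm{int}(\Theta)$, and for $\theta\in\Theta$ let $\ell_\theta:\mathbb R^k\to\mathbb R$ be measurable, such that $\theta\mapsto\ell_\theta(z)$ is twice continuously differentiable on $\mathrm{int}(\Theta)$ for each $z$. Put $Z_i=(X_i,\dots,X_{i-k+1})$, $\tilde Z_0(v)=(\tilde X_0(v),\dots,\tilde X_{-k+1}(v))$, \[L_{n,h}(v,\theta)=\frac1n\sum_{i=k}^nK_h\big(\tfrac in-v\big)\ell_\theta(Z_i),\qquad \hat\theta_{n,h}(v)\in\arg\min_{\theta\in\Theta}L_{n,h}(v,\theta)\quad(v\in[0,1]),\] where $\hat\theta_{n,h}(v)$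 is an arbitrary choice of a minimizer. Let $\Theta_0=\Theta$ and $\Theta_1=\Theta_2=\mathrm{int}(\Theta)$, let $\nabla_\theta^j$ be the tensor of partial derivatives of order $j$ with respect to $\theta$, and $|\cdot|_\infty$ the maximum norm of its entries. Suppose that there are $L_0,\dots,L_{k-1}\ge0$ and $C_R,C_{\bar f},C_\Theta>0$ such that for $j\in\{0,1,2\}$: (A1) with $R(z)=1+|z|_1^{M-1}$, $R(0)\le C_R$, for all $\theta\in\Theta_j$ and $z,z'\in\mathbb R^k$, \[|\nabla^j_\theta\ell_\theta(z)-\nabla^j_\theta\ell_\theta(z')|_\infty\le\Big(\sum_{m=0}^{k-1}L_m|z_m-z'_m|\Big)\,(R(z)+R(z')),\qquad |\nabla_\theta^j\ell_\theta(0)|_\infty\le C_{\bar f};\] (A2) for all $z\in\mathbb R^k$ and $\theta,\theta'\in\Theta_j$, $|\nabla^j_\theta\ell_\theta(z)-\nabla^j_\theta\ell_{\theta'}(z)|_\infty\le C_\Theta(1+|z|_1^M)|\theta-\theta'|_2$; (A3) for each $v\in[0,1]$, $\theta_0(v)$ is the unique global minimizer over $\Theta$ of $\theta\mapsto\mathbb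 E\,\ell_\theta(\tilde Z_0(v))$, and $I(v):=\mathbb E\nabla_\theta^2\ell_\theta(\tilde Z_0(v))\big|_{\theta=\theta_0(v)}$ is positive definite. Suppose finally that there are $\kappa,c>0$ such that for all $n,j\ge1$ either \[\delta^X_{2M}(j)\le\kappa j^{-\alpha}\ \text{for some fixed }\alpha>1,\quad h\ge c\Big(\frac{\log n}{n^{1-2/\nu}}\Big)^{\frac{\alpha-1}{\alpha}},\] or \[\delta^X_{2M}(j)\le\kappa\rho^{j}\ \text{for some fixed }\rho\in(0,1),\quad h\ge c\,\frac{(\log n)^3}{n^{1-2/\nu}}.\] \textbf{Claim.} Let $\tau_n=\sqrt{\frac{\log n}{nh}}$ and $B_h=\sup_{v\in[0,1]}|\mathbb E\nabla_\theta L_{n,h}(v,\theta_0(v))|$. Then, as $n\to\infty$, $B_h=O(h^\varsigma)$, \[\sup_{v\in[\frac h2,1-\frac h2]}|\hat\theta_{n,h}(v)-\theta_0(v)|=O_p(\tau_n+B_h),\] and \[\sup_{v\in[\frac h2,1-\frac h2]}\big|\{\hat\theta_{n,h}(v)-\theta_0(v)\}+I(v)^{-1}\nabla_\theta L_{n,h}(v,\theta_0(v))\big|=O_p\big((\tau_n+h^\varsigma)(\tau_n+B_h)\big).\]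 -/

import Mathlib

open MeasureTheory ProbabilityTheory Filter Topology Set
open scoped ENNReal NNReal

noncomputable section

/-- The conditions on the localizing kernel `K`. -/
structure IsLocKernel (K : ℝ → ℝ) : Prop where
  bounded : ∃ C : ℝ, ∀ x, |K x| ≤ C
  lipschitz : ∃ LK : ℝ≥0, LipschitzWith LK K
  integral_eq_one : ∫ x, K x = 1
  sq_integrable : Integrable (fun x => K x ^ 2)
  sq_integral_pos : 0 < ∫ x, K x ^ 2
  support_subset : Function.support K ⊆ Icc (-(1 / 2)) (1 / 2)

/-- The rescaled kernel `K_h(x) = h⁻¹ K(x / h)`. -/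
def scaledKernel (K : ℝ → ℝ) (h x : ℝ) : ℝ := (1 / h) * K (x / h)

/-- The past `𝒢_i = (ε_i, ε_{i-1}, ε_{i-2}, …)` of the innovations at time `i`. -/
def innovPast {Ω S : Type*} (ε : ℤ → Ω → S) (i : ℤ) (ω : Ω) : ℕ → S :=
  fun m => ε (i - (m : ℤ)) ω

/-- The coupled past `𝒢_i^{*(i-k)}`: the entry `ε_{i-k}` of `𝒢_i` is replaced by an independent
copy. The copy lives on the second factor of `Ω × Ω` (equipped with `μ.prod μ`). -/
def coupledPast {Ω S : Type*} (ε : ℤ → Ω → S) (i : ℤ) (k : ℕ) (p : Ω × Ω) : ℕ → S :=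
  Function.update (innovPast ε i p.1) k (ε (i - (k : ℤ)) p.2)

/-- The uniform functional dependence measure
`δ_q^X(k) = sup_{i = 1, …, n} ‖X_i - X_i^{*(i-k)}‖_q` of the real-valued process
`X_i = J_i(𝒢_i)`, `i = 1, …, n`. -/
def depMeasure {Ω S : Type*} [MeasurableSpace Ω] (μ : Measure Ω) (ε : ℤ → Ω → S)
    (J : ℤ → (ℕ → S) → ℝ) (n : ℕ) (q : ℝ) (k : ℕ) : ℝ≥0∞ :=
  ⨆ i ∈ Icc (1 : ℤ) (n : ℤ),
    eLpNorm (fun p : Ω × Ω => J i (innovPast ε i p.1) - J i (coupledPast ε i k p))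
      (ENNReal.ofReal q) (μ.prod μ)

/-- `ε_i`, `i ∈ ℤ`, is an i.i.d. sequence of random variables. -/
structure IsIIDInnovation {Ω S : Type*} [MeasurableSpace Ω] [MeasurableSpace S]
    (μ : Measure Ω) (ε : ℤ → Ω → S) : Prop where
  meas : ∀ i, Measurable (ε i)
  indep : iIndepFun ε μ
  identDistrib : ∀ i, IdentDistrib (ε i) (ε 0) μ μ

/-- The triangular array `X_{i,n} = J_{i,n}(𝒢_i)`, `1 ≤ i ≤ n`, is locally stationary with
stationary approximations `X̃_i(u) = J̃(𝒢_i, u)`, `u ∈ [0,1]`, in `L^{2M}` and with Hölder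
exponent `ς`. -/
structure IsLocallyStationary {Ω S : Type*} [MeasurableSpace Ω] [MeasurableSpace S]
    (μ : Measure Ω) (ε : ℤ → Ω → S) (J : ℕ → ℤ → (ℕ → S) → ℝ) (Jt : (ℕ → S) → ℝ → ℝ)
    (M CX ς : ℝ) : Prop where
  CX_pos : 0 < CX
  hoelder_pos : 0 < ς
  hoelder_le_one : ς ≤ 1
  meas_J : ∀ (n : ℕ) (i : ℤ), 1 ≤ i → i ≤ n → Measurable (J n i)
  meas_Jt : ∀ u ∈ Icc (0 : ℝ) 1, Measurable (fun g => Jt g u)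
  moment_tilde : ∀ u ∈ Icc (0 : ℝ) 1,
    eLpNorm (fun ω => Jt (innovPast ε 0 ω) u) (ENNReal.ofReal (2 * M)) μ ≤ ENNReal.ofReal CX
  moment : ∀ (n : ℕ) (i : ℤ), 1 ≤ i → i ≤ n →
    eLpNorm (fun ω => J n i (innovPast ε i ω)) (ENNReal.ofReal (2 * M)) μ ≤ ENNReal.ofReal CX
  approx : ∀ (n : ℕ) (i : ℤ), 1 ≤ i → i ≤ n →
    eLpNorm (fun ω => J n i (innovPast ε i ω) - Jt (innovPast ε i ω) ((i : ℝ) / n))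
      (ENNReal.ofReal (2 * M)) μ ≤ ENNReal.ofReal (CX * (n : ℝ) ^ (-ς))
  hoelder : ∀ u₁ ∈ Icc (0 : ℝ) 1, ∀ u₂ ∈ Icc (0 : ℝ) 1,
    eLpNorm (fun ω => Jt (innovPast ε 0 ω) u₁ - Jt (innovPast ε 0 ω) u₂)
      (ENNReal.ofReal (2 * M)) μ ≤ ENNReal.ofReal (CX * |u₁ - u₂| ^ ς)

/-- A class `F` of functions of `z = (z_0, …, z_{k-1})` is an `(L, s, R, C)`-class,
`C = (CR, Cf)`: the entries of `L` are nonnegative, `s ∈ (0,1]`, and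
`|f(z) - f(z')| ≤ |z - z'|_{L,s}^s (R(z) + R(z'))` with `|z|_{L,s}^s = ∑ i, L_i |z_i|^s`;
moreover `|f(0)| ≤ Cf` and `|R(0)| ≤ CR`. Functions may take values in a space of tensors,
which will carry the maximum norm of the entries. -/
structure IsLRCClass {k : ℕ} {G : Type*} [NormedAddCommGroup G] (F : Set ((Fin k → ℝ) → G))
    (L : Fin k → ℝ) (s : ℝ) (R : (Fin k → ℝ) → ℝ) (CR Cf : ℝ) : Prop where
  L_nonneg : ∀ i, 0 ≤ L i
  s_pos : 0 < s
  s_le_one : s ≤ 1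
  R_nonneg : ∀ z, 0 ≤ R z
  CR_pos : 0 < CR
  Cf_pos : 0 < Cf
  hoelder : ∀ f ∈ F, ∀ z z' : Fin k → ℝ,
    ‖f z - f z'‖ ≤ (∑ i, L i * |z i - z' i| ^ s) * (R z + R z')
  zero_le : ∀ f ∈ F, ‖f 0‖ ≤ Cf
  R_zero_le : |R 0| ≤ CR

/-- The norm `|z|_1` on `ℝ^k`. -/
def l1norm {k : ℕ} (z : Fin k → ℝ) : ℝ := ∑ i, |z i|

/-- `∇^j f(θ)`: the tensor of all partial derivatives of order `j` of `f` at `θ ∈ ℝ^d`. As an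
element of the function space it carries the maximum norm `|·|_∞` of its entries. -/
def nablaTensor {d : ℕ} (j : ℕ) (f : EuclideanSpace ℝ (Fin d) → ℝ)
    (θ : EuclideanSpace ℝ (Fin d)) : (Fin j → Fin d) → ℝ :=
  fun a => iteratedFDeriv ℝ j f θ (fun m => EuclideanSpace.single (a m) (1 : ℝ))

/-- The parameters at which `∇^j` of a function on `Θ` is considered: all of `Θ` for the function
itself, and the interior of `Θ` for proper derivatives (those at other points are never used). -/
def nablaDomain {d : ℕ} (Θ : Set (EuclideanSpace ℝ (Fin d))) (j : ℕ) :
    Set (EuclideanSpace ℝ (Fin d)) :=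
  if j = 0 then Θ else interior Θ

/-- The Hessian matrix. -/
def hessianMatrix {d : ℕ} (f : EuclideanSpace ℝ (Fin d) → ℝ)
    (θ : EuclideanSpace ℝ (Fin d)) : Matrix (Fin d) (Fin d) ℝ :=
  Matrix.of fun a b => nablaTensor 2 f θ ![a, b]

/-- The window `Z_i = (X_i, X_{i-1}, …, X_{i-k+1})`. -/
def lagWindow {Ω : Type*} (k : ℕ) (X : ℤ → Ω → ℝ) (i : ℤ) (ω : Ω) : Fin k → ℝ :=
  fun m => X (i - ((m : ℕ) : ℤ)) ω

/-- The localized objective function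
`L_{n,h}(v, θ) = n⁻¹ ∑_{i=k}^n K_h(i/n - v) ℓ_θ(Z_i)`. -/
def locObjective {Ω : Type*} {d k : ℕ} (K : ℝ → ℝ)
    (ℓ : EuclideanSpace ℝ (Fin d) → (Fin k → ℝ) → ℝ) (X : ℤ → Ω → ℝ) (n : ℕ) (h v : ℝ)
    (ω : Ω) (θ : EuclideanSpace ℝ (Fin d)) : ℝ :=
  (1 / (n : ℝ)) * ∑ i ∈ Finset.Icc (k : ℤ) (n : ℤ),
    scaledKernel K h ((i : ℝ) / n - v) * ℓ θ (lagWindow k X i ω)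

/-- The matrix `E ∇²ℓ_θ(Z)` (expectation entry by entry). -/
def expectedHessian {Ω : Type*} [MeasurableSpace Ω] {d k : ℕ} (μ : Measure Ω)
    (ℓ : EuclideanSpace ℝ (Fin d) → (Fin k → ℝ) → ℝ) (Z : Ω → Fin k → ℝ)
    (θ : EuclideanSpace ℝ (Fin d)) : Matrix (Fin d) (Fin d) ℝ :=
  Matrix.of fun a b => ∫ ω, hessianMatrix (fun θ' => ℓ θ' (Z ω)) θ a b ∂μ

/-- `Y_n = O_p(a_n)` for nonnegative `Y_n`, `a_n`: for every `η > 0` there is `C` such that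
`P(Y_n > C a_n) ≤ η` for all large `n`. For non-measurable `Y_n` (suprema over uncountable sets)
`μ` is the outer probability. -/
def IsBigOp {Ω : Type*} [MeasurableSpace Ω] (μ : Measure Ω) (Y : ℕ → Ω → ℝ≥0∞)
    (a : ℕ → ℝ≥0∞) : Prop :=
  ∀ η : ℝ, 0 < η → ∃ C : ℝ≥0, ∀ᶠ n in atTop,
    μ {ω | (C : ℝ≥0∞) * a n < Y n ω} ≤ ENNReal.ofReal η

/-- The bias `B_h = sup_{v ∈ [0,1]} |E ∇_θ L_{n,h}(v, θ₀(v))|`. -/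
def locBias {Ω : Type*} [MeasurableSpace Ω] {d k : ℕ} (μ : Measure Ω) (K : ℝ → ℝ)
    (ℓ : EuclideanSpace ℝ (Fin d) → (Fin k → ℝ) → ℝ) (X : ℤ → Ω → ℝ)
    (θ₀ : ℝ → EuclideanSpace ℝ (Fin d)) (n : ℕ) (h : ℝ) : ℝ≥0∞ :=
  ⨆ v ∈ Icc (0 : ℝ) 1, ‖∫ ω, gradient (locObjective K ℓ X n h v ω) (θ₀ v) ∂μ‖ₑ

end

/-!
The argument is that of M-estimation around a uniform law of large numbers with rate.

**Stochastic error.** The loss, the entries of its gradient and those of its Hessian are classes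
`F_θ` of functions of polynomial growth (`IsPolyClass`, `isPolyClass_nablaTensor`). For such a class
the centered kernel sums are `O_p(√(n h log n))` uniformly in `θ` and in `v ∈ [0,1]`
(`exists_measure_kernelSum_gt_le`). The estimates are made on the sequence space `ℤ → S` with the
product law of the innovations, where conditional expectations given the coordinates at times `≥ t`
are explicit integrals (`tailMean`) and the innovation `E(g | ≥ t) - E(g | ≥ t+1)` is controlled by
replacing the coordinate at time `t`.

* Truncation of `F_θ(Z_i)` at a multiple of `n^{1/ν}` changes none of the `n` summands with high
  probability, and the truncation bias of the kernel sum is `O(√(n h))`, since `F_θ(Z_i)` is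
  dominated by an envelope with a moment of order `ν`. A grid of width `n⁻²` reduces the supremum
  to a maximum over polynomially many pairs `(v, θ)`.
* A truncated summand is decomposed into its projection onto the last `m + 1` innovations and the
  increments of lag `j > m`. The projections are `m`-dependent: among the blocks of length
  `m + 1`, those with even index are independent, and so are those with odd index. Hence Bernstein's
  inequality applies if `m √(log n) n^{1/ν} ≲ √(n h)`. For a fixed lag `j` the increments are
  martingale differences, and a maximal inequality (`lintegral_iSup_martingale_le`) bounds the
  expected maximum of their sums by `√(n log n)` times the `L²` norm of the *envelope* of an
  increment over the class; by Hölder's inequality this is of the order of the dependence measure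
  at lag `j`, shifted by at most `k - 1`. The maximal inequality is proved by expanding the
  softmax `log ∑ exp`: the first order term is orthogonal to the past, and the second order term
  is bounded by the square of the supremum norm. Together this gives
  `lintegral_iSup_sum_sub_integral_le`.
* The sum over `j > m` is of the right order if the dependence beyond `m` sums up to `O(√h)`.
  Under the assumptions on decay and bandwidth some `m` satisfies both requirements
  (`exists_blockLength`). They also force `τ_n → 0`.

**Bias.** In the window at `v` the expectation of `F_θ(Z_i)` differs from
`E F_θ(Z̃_0(v))` by `O(h^ς)`, and a Riemann sum of the kernel over a window inside of `[0,1]` differs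
from `1` by `O(1/(n h))`, which is `O(τ_n²)`. The expected score `E ∇ℓ_θ(Z̃_0(v))` vanishes at
`θ₀(v)`, since this is an interior minimizer; therefore `B_h = O(h^ς)` even for `v` close to the
boundary (`exists_locBias_le`), where the kernel does not integrate to `1`.

**The minimizer.** By compactness, `θ₀` is continuous, stays away from the boundary of `Θ`, is
identified uniformly in `v`, and `I(v)⁻¹` is bounded; hence the minimizer is uniformly consistent.
The mean value inequality for `∇L_{n,h}(v, ·)`, whose derivative is within
`O(τ_n + h^ς + ‖θ - θ₀(v)‖)` of `I(v)`, gives with `x = θ̂(v) - θ₀(v)`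
`‖x + I(v)⁻¹ ∇L_{n,h}(v, θ₀(v))‖ ≤ C (τ_n + h^ς + ‖x‖) ‖x‖`.
The first factor is small by consistency and the gradient is `O(τ_n + B_h)`, so `‖x‖` is of this
order; inserting this rate into the right-hand side gives the expansion
(`exists_minimizer_expansion`).
-/

/-! ### Resampling coordinates of an i.i.d. sequence -/

section Resampling

open scoped Classical in
/-- The sequence with the entries of `x` at times in `s` and those of `y` at the other times. -/
noncomputable def resample {S : Type*} (s : Set ℤ) (x y : ℤ → S) : ℤ → S :=
  fun l => if l ∈ s then x l else y l

/-- The law of an i.i.d. sequence indexed by `ℤ` with marginal `P`. -/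
noncomputable abbrev iidLaw {S : Type*} [MeasurableSpace S] (P : Measure S)
    [IsProbabilityMeasure P] : Measure (ℤ → S) := Measure.infinitePi fun _ : ℤ => P

variable {S : Type*}

lemma resample_of_mem {s : Set ℤ} {l : ℤ} (hl : l ∈ s) (x y : ℤ → S) : resample s x y l = x l :=
  if_pos hl

lemma resample_of_notMem {s : Set ℤ} {l : ℤ} (hl : l ∉ s) (x y : ℤ → S) :
    resample s x y l = y l :=
  if_neg hl

lemma DependsOn.resample_eq {β : Type*} {g : (ℤ → S) → β} {s : Set ℤ}
    (hg : DependsOn g s) (x y : ℤ → S) : g (resample s x y) = g x :=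
  hg fun _ hl => resample_of_mem hl x y

lemma DependsOn.resample_eq_right {β : Type*} {g : (ℤ → S) → β} {s t : Set ℤ}
    (hg : DependsOn g t) (hst : Disjoint s t) (x y : ℤ → S) : g (resample s x y) = g y :=
  hg fun _ hl => resample_of_notMem (fun h => Set.disjoint_left.1 hst h hl) x y

variable [MeasurableSpace S]

lemma measurable_resample (s : Set ℤ) :
    Measurable fun p : (ℤ → S) × (ℤ → S) => resample s p.1 p.2 := by
  refine measurable_pi_lambda _ fun l => ?_
  by_cases hl : l ∈ s
  · simp only [resample_of_mem hl]; fun_prop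
  · simp only [resample_of_notMem hl]; fun_prop

variable (P : Measure S) [IsProbabilityMeasure P]

/-- Exchanging the entries outside `s` of two independent copies preserves their joint law. -/
lemma measurePreserving_resample_pair (s : Set ℤ) :
    MeasurePreserving (fun p : (ℤ → S) × (ℤ → S) => (resample s p.1 p.2, resample s p.2 p.1))
      ((iidLaw P).prod (iidLaw P)) ((iidLaw P).prod (iidLaw P)) := by
  classical
  have hm : Measurable
      (fun p : (ℤ → S) × (ℤ → S) => (resample s p.1 p.2, resample s p.2 p.1)) :=
    (measurable_resample s).prodMk ((measurable_resample s).comp measurable_swap)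
  refine ⟨hm, ?_⟩
  set C : Set (Set (ℤ → S)) := squareCylinders fun _ : ℤ => {t : Set S | MeasurableSet t} with hC
  have hgen : MeasurableSpace.generateFrom C = MeasurableSpace.pi := generateFrom_squareCylinders
  have hpi : IsPiSystem C :=
    isPiSystem_squareCylinders (fun _ => MeasurableSpace.isPiSystem_measurableSet)
      (fun _ => MeasurableSet.univ)
  have huniv : (Set.univ : Set (ℤ → S)) ∈ C := by
    rw [hC, squareCylinders]
    exact ⟨∅, fun _ => Set.univ, fun _ _ => MeasurableSet.univ, by simp⟩
  let sp : (iidLaw P).FiniteSpanningSetsIn C :=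
    { set := fun _ => Set.univ
      set_mem := fun _ => huniv
      finite := fun _ => measure_lt_top _ _
      spanning := Set.iUnion_const _ }
  refine (Measure.prod_eq_generateFrom hgen hgen hpi hpi sp sp ?_).symm
  intro b₁ hb₁ b₂ hb₂
  obtain ⟨s₁, t₁, ht₁, rfl⟩ := hb₁
  obtain ⟨s₂, t₂, ht₂, rfl⟩ := hb₂
  replace ht₁ : ∀ l, MeasurableSet (t₁ l) := fun l => ht₁ l (Set.mem_univ l)
  replace ht₂ : ∀ l, MeasurableSet (t₂ l) := fun l => ht₂ l (Set.mem_univ l)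
  set u := s₁ ∪ s₂
  have hext : ∀ (v : Finset ℤ) (t : ℤ → Set S), v ⊆ u →
      Set.pi (v : Set ℤ) t = Set.pi (u : Set ℤ) fun l => if l ∈ v then t l else Set.univ := by
    intro v t hv
    ext x
    simp only [Set.mem_pi, Finset.mem_coe]
    constructor
    · intro h l _
      split_ifs with hl
      · exact h l hl
      · trivial
    · intro h l hl
      have := h l (hv hl)
      rwa [if_pos hl] at this
  have hmeas : ∀ (v : Finset ℤ) (t : ℤ → Set S), (∀ l, MeasurableSet (t l)) →
      ∀ l, MeasurableSet (if l ∈ v then t l else Set.univ) := by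
    intro v t ht l
    split_ifs
    · exact ht l
    · exact MeasurableSet.univ
  rw [hext s₁ t₁ Finset.subset_union_left, hext s₂ t₂ Finset.subset_union_right]
  generalize hr₁ : (fun l => if l ∈ s₁ then t₁ l else Set.univ) = r₁
  generalize hr₂ : (fun l => if l ∈ s₂ then t₂ l else Set.univ) = r₂
  have hm₁ : ∀ l, MeasurableSet (r₁ l) := by rw [← hr₁]; exact hmeas s₁ t₁ ht₁
  have hm₂ : ∀ l, MeasurableSet (r₂ l) := by rw [← hr₂]; exact hmeas s₂ t₂ ht₂
  have hpre : (fun p : (ℤ → S) × (ℤ → S) => (resample s p.1 p.2, resample s p.2 p.1)) ⁻¹'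
      (Set.pi (u : Set ℤ) r₁ ×ˢ Set.pi (u : Set ℤ) r₂) =
      Set.pi (u : Set ℤ) (fun l => if l ∈ s then r₁ l else r₂ l) ×ˢ
        Set.pi (u : Set ℤ) (fun l => if l ∈ s then r₂ l else r₁ l) := by
    ext ⟨x, y⟩
    simp only [Set.mem_preimage, Set.mem_prod, Set.mem_pi, ← forall_and]
    refine forall_congr' fun l => ?_
    by_cases hl : l ∈ s
    · simp only [resample_of_mem hl, if_pos hl]
    · simp only [resample_of_notMem hl, if_neg hl]; tauto
  rw [Measure.map_apply hm ((MeasurableSet.pi u.countable_toSet fun l _ => hm₁ l).prod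
    (MeasurableSet.pi u.countable_toSet fun l _ => hm₂ l)), hpre, Measure.prod_prod,
    Measure.infinitePi_pi, Measure.infinitePi_pi, Measure.infinitePi_pi, Measure.infinitePi_pi,
    ← Finset.prod_mul_distrib, ← Finset.prod_mul_distrib]
  · refine Finset.prod_congr rfl fun l _ => ?_
    split_ifs
    · rfl
    · exact mul_comm _ _
  · exact fun l _ => hm₂ l
  · exact fun l _ => hm₁ l
  · intro l _
    split_ifs
    · exact hm₂ l
    · exact hm₁ l
  · intro l _
    split_ifs
    · exact hm₁ l
    · exact hm₂ l

lemma measurePreserving_resample (s : Set ℤ) :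
    MeasurePreserving (fun p : (ℤ → S) × (ℤ → S) => resample s p.1 p.2)
      ((iidLaw P).prod (iidLaw P)) (iidLaw P) :=
  (measurePreserving_fst (μ := iidLaw P) (ν := iidLaw P)).comp (measurePreserving_resample_pair P s)

/-- Functions of disjoint sets of coordinates are uncorrelated. -/
lemma integral_mul_of_dependsOn {s t : Set ℤ} (hst : Disjoint s t) {φ ψ : (ℤ → S) → ℝ}
    (hφm : Measurable φ) (hψm : Measurable ψ) (hφ : DependsOn φ s) (hψ : DependsOn ψ t) :
    ∫ x, φ x * ψ x ∂(iidLaw P) = (∫ x, φ x ∂(iidLaw P)) * ∫ x, ψ x ∂(iidLaw P) := by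
  rw [← integral_prod_mul]
  conv_lhs => rw [← (measurePreserving_resample P s).map_eq]
  rw [integral_map (f := fun x => φ x * ψ x) (measurable_resample s).aemeasurable
    (hφm.mul hψm).aestronglyMeasurable]
  refine integral_congr_ae (Eventually.of_forall fun p => ?_)
  simp only [hφ.resample_eq, hψ.resample_eq_right hst]

/-- The conditional expectation of `g` given the coordinates at times `≥ t`, as a function on the
sequence space: the remaining coordinates are integrated out. -/
noncomputable def tailMean (t : ℤ) (g : (ℤ → S) → ℝ) (x : ℤ → S) : ℝ :=
  ∫ y, g (resample (Ici t) x y) ∂(iidLaw P)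

variable {P}

lemma measurable_tailMean (t : ℤ) {g : (ℤ → S) → ℝ} (hg : Measurable g) :
    Measurable (tailMean P t g) :=
  (StronglyMeasurable.integral_prod_right (ν := iidLaw P)
    (f := fun x y => g (resample (Ici t) x y))
    (hg.comp (measurable_resample (Ici t))).stronglyMeasurable).measurable

lemma abs_tailMean_le (t : ℤ) {g : (ℤ → S) → ℝ} {B : ℝ} (hB : ∀ x, |g x| ≤ B) (x : ℤ → S) :
    |tailMean P t g x| ≤ B := by
  have := norm_integral_le_of_norm_le_const (μ := iidLaw P)
    (f := fun y => g (resample (Ici t) x y)) (C := B) (Eventually.of_forall fun y => hB _)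
  simpa [tailMean] using this

lemma dependsOn_tailMean (t : ℤ) {g : (ℤ → S) → ℝ} {s : Set ℤ} (hg : DependsOn g s) :
    DependsOn (tailMean P t g) (s ∩ Ici t) := by
  intro x x' h
  refine integral_congr_ae (Eventually.of_forall fun y => hg fun l hl => ?_)
  by_cases hlt : l ∈ Ici t
  · rw [resample_of_mem hlt, resample_of_mem hlt, h l ⟨hl, hlt⟩]
  · rw [resample_of_notMem hlt, resample_of_notMem hlt]

lemma tailMean_eq_integral {t : ℤ} {g : (ℤ → S) → ℝ} (hg : DependsOn g (Iio t)) (x : ℤ → S) :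
    tailMean P t g x = ∫ y, g y ∂(iidLaw P) := by
  refine integral_congr_ae (Eventually.of_forall fun y => ?_)
  exact hg.resample_eq_right (Set.disjoint_left.2 fun l h h' =>
    absurd (mem_Iio.1 h') (not_lt.2 (mem_Ici.1 h))) x y

lemma integrable_of_abs_le {α : Type*} [MeasurableSpace α] {ρ : Measure α} [IsFiniteMeasure ρ]
    {g : α → ℝ} (hg : Measurable g) {B : ℝ} (hB : ∀ x, |g x| ≤ B) : Integrable g ρ :=
  Integrable.of_bound hg.aestronglyMeasurable B (Eventually.of_forall hB)

lemma integral_mul_tailMean {t : ℤ} {g φ : (ℤ → S) → ℝ} (hg : Measurable g) {B : ℝ}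
    (hB : ∀ x, |g x| ≤ B) (hφm : Measurable φ) {B' : ℝ} (hB' : ∀ x, |φ x| ≤ B')
    (hφ : DependsOn φ (Ici t)) :
    ∫ x, φ x * tailMean P t g x ∂(iidLaw P) = ∫ x, φ x * g x ∂(iidLaw P) := by
  have hb : ∀ x, |φ x * g x| ≤ B' * B := fun x => by
    rw [abs_mul]
    exact mul_le_mul (hB' x) (hB x) (abs_nonneg _) ((abs_nonneg _).trans (hB' x))
  conv_rhs => rw [← (measurePreserving_resample P (Ici t)).map_eq]
  rw [integral_map (f := fun x => φ x * g x) (measurable_resample _).aemeasurable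
    (hφm.mul hg).aestronglyMeasurable]
  have hint : Integrable (fun p : (ℤ → S) × (ℤ → S) => φ (resample (Ici t) p.1 p.2) *
      g (resample (Ici t) p.1 p.2)) ((iidLaw P).prod (iidLaw P)) :=
    integrable_of_abs_le ((hφm.mul hg).comp (measurable_resample _)) fun p => hb _
  rw [integral_prod _ hint]
  refine integral_congr_ae (Eventually.of_forall fun x => ?_)
  simp only [hφ.resample_eq, tailMean, integral_const_mul]

lemma integral_tailMean {t : ℤ} {g : (ℤ → S) → ℝ} (hg : Measurable g) {B : ℝ}
    (hB : ∀ x, |g x| ≤ B) :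
    ∫ x, tailMean P t g x ∂(iidLaw P) = ∫ x, g x ∂(iidLaw P) := by
  simpa using integral_mul_tailMean (P := P) (t := t) hg hB (measurable_const (a := (1 : ℝ)))
    (B' := 1) (by simp) ((dependsOn_const (1 : ℝ)).mono (Set.empty_subset _))

/-- The square of an integral over a probability space is at most the integral of the square. -/
lemma sq_lintegral_le {α : Type*} [MeasurableSpace α] (ρ : Measure α) [IsProbabilityMeasure ρ]
    {f : α → ℝ≥0∞} (hf : AEMeasurable f ρ) : (∫⁻ x, f x ∂ρ) ^ 2 ≤ ∫⁻ x, f x ^ 2 ∂ρ := by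
  have h := ENNReal.lintegral_mul_le_Lp_mul_Lq ρ (Real.HolderConjugate.two_two) hf
    (aemeasurable_const (b := (1 : ℝ≥0∞)))
  simp only [Pi.mul_apply, mul_one, ENNReal.one_rpow, lintegral_const, measure_univ] at h
  calc (∫⁻ x, f x ∂ρ) ^ 2 ≤ ((∫⁻ x, f x ^ (2 : ℝ) ∂ρ) ^ (1 / 2 : ℝ)) ^ 2 := by gcongr
    _ = ∫⁻ x, f x ^ 2 ∂ρ := by
      rw [← ENNReal.rpow_natCast, ← ENNReal.rpow_mul]
      norm_num

/-- The innovation `E(g | coordinates ≥ t) - E(g | coordinates ≥ t+1)` is dominated, uniformly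
over a class of functions, by the effect of replacing the coordinate at time `t`. -/
lemma lintegral_iSup_tailMean_sub_le {A : Type*} [Fintype A] (t : ℤ) {g : A → (ℤ → S) → ℝ}
    (hg : ∀ a, Measurable (g a)) {B : ℝ} (hB : ∀ a x, |g a x| ≤ B) :
    ∫⁻ x, (⨆ a, ‖tailMean P t (g a) x - tailMean P (t + 1) (g a) x‖ₑ) ^ 2 ∂(iidLaw P) ≤
      ∫⁻ p, (⨆ a, ‖g a p.1 - g a (resample {t}ᶜ p.1 p.2)‖ₑ) ^ 2
        ∂((iidLaw P).prod (iidLaw P)) := by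
  have hH : Measurable fun p : (ℤ → S) × (ℤ → S) =>
      ⨆ a, ‖g a p.1 - g a (resample {t}ᶜ p.1 p.2)‖ₑ :=
    Measurable.iSup fun a => (((hg a).comp measurable_fst).sub
      ((hg a).comp (measurable_resample _))).enorm
  have hG : Measurable fun p : (ℤ → S) × (ℤ → S) =>
      ⨆ a, ‖g a (resample (Ici t) p.1 p.2) - g a (resample (Ici (t + 1)) p.1 p.2)‖ₑ :=
    Measurable.iSup fun a => (((hg a).comp (measurable_resample _)).sub
      ((hg a).comp (measurable_resample _))).enorm
  have hpt : ∀ x, (⨆ a, ‖tailMean P t (g a) x - tailMean P (t + 1) (g a) x‖ₑ) ≤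
      ∫⁻ y, ⨆ a, ‖g a (resample (Ici t) x y) - g a (resample (Ici (t + 1)) x y)‖ₑ
        ∂(iidLaw P) := by
    intro x
    refine iSup_le fun a => ?_
    have hi : ∀ t' : ℤ, Integrable (fun y => g a (resample (Ici t') x y)) (iidLaw P) := fun t' =>
      integrable_of_abs_le ((hg a).comp ((measurable_resample _).comp measurable_prodMk_left))
        fun y => hB a _
    rw [tailMean, tailMean, ← integral_sub (hi _) (hi _)]
    refine (enorm_integral_le_lintegral_enorm _).trans (lintegral_mono fun y => ?_)
    exact le_iSup (fun a => ‖g a (resample (Ici t) x y) -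
      g a (resample (Ici (t + 1)) x y)‖ₑ) a
  calc _ ≤ ∫⁻ x, ∫⁻ y, (⨆ a, ‖g a (resample (Ici t) x y) -
          g a (resample (Ici (t + 1)) x y)‖ₑ) ^ 2 ∂(iidLaw P) ∂(iidLaw P) := by
        refine lintegral_mono fun x => ?_
        exact (pow_le_pow_left' (hpt x) 2).trans
          (sq_lintegral_le _ (hG.comp measurable_prodMk_left).aemeasurable)
    _ = ∫⁻ p, (⨆ a, ‖g a (resample (Ici t) p.1 p.2) -
          g a (resample (Ici (t + 1)) p.1 p.2)‖ₑ) ^ 2 ∂((iidLaw P).prod (iidLaw P)) :=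
        (lintegral_prod _ (hG.pow_const 2).aemeasurable).symm
    _ = _ := by
        conv_rhs => rw [← (measurePreserving_resample_pair P (Ici t)).map_eq]
        rw [lintegral_map (hH.pow_const 2)
          (measurePreserving_resample_pair P (Ici t)).measurable]
        refine lintegral_congr fun p => ?_
        have : resample {t}ᶜ (resample (Ici t) p.1 p.2) (resample (Ici t) p.2 p.1) =
            resample (Ici (t + 1)) p.1 p.2 := by
          funext l
          rcases lt_trichotomy l t with h | h | h
          · rw [resample_of_mem (by simpa using h.ne), resample_of_notMem (by simpa using h),
              resample_of_notMem (by simp; omega)]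
          · subst h
            rw [resample_of_notMem (by simp), resample_of_mem (by simp),
              resample_of_notMem (by simp)]
          · rw [resample_of_mem (by simpa using h.ne'), resample_of_mem (by simpa using h.le),
              resample_of_mem (by simp; omega)]
        simp only [this]

/-- Lévy's theorem: conditioning on the coordinates at times `≥ t` recovers `g` as `t → -∞`. -/
lemma tendsto_lintegral_sub_tailMean {g : (ℤ → S) → ℝ} (hg : Measurable g) {B : ℝ}
    (hB : ∀ x, |g x| ≤ B) (i : ℤ) :
    Tendsto (fun N : ℕ => ∫⁻ x, ‖g x - tailMean P (i - N) g x‖ₑ ∂(iidLaw P)) atTop (𝓝 0) := by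
  classical
  let F : Filtration ℕ (MeasurableSpace.pi : MeasurableSpace (ℤ → S)) :=
    { seq := fun N => ⨆ l : Ici (i - (N : ℤ)), MeasurableSpace.comap (fun x : ℤ → S => x l)
        inferInstance
      mono' := by
        intro N N' h
        refine iSup_le fun l => le_iSup_of_le ⟨l.1, ?_⟩ le_rfl
        have := l.2
        simp only [mem_Ici] at this ⊢
        have : (N : ℤ) ≤ N' := by exact_mod_cast h
        omega
      le' := fun N => iSup_le fun l => (measurable_pi_apply _).comap_le }
  have hsup : (⨆ N, F N) = (MeasurableSpace.pi : MeasurableSpace (ℤ → S)) := by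
    refine le_antisymm (iSup_le F.le) ?_
    refine iSup_le fun l => ?_
    refine le_iSup_of_le (i - l).toNat ?_
    exact le_iSup_of_le (f := fun l : Ici (i - ((i - l).toNat : ℤ)) =>
      MeasurableSpace.comap (fun x : ℤ → S => x l) inferInstance) ⟨l, by simp; omega⟩ le_rfl
  have hint : Integrable g (iidLaw P) := integrable_of_abs_le hg hB
  have hcond : ∀ N, tailMean P (i - (N : ℕ)) g =ᵐ[iidLaw P] (iidLaw P)[g|F N] := by
    intro N
    obtain ⟨y₀⟩ : Nonempty (ℤ → S) := (inferInstance : NeZero (iidLaw P)).1 |> fun h => by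
      by_contra hne
      rw [not_nonempty_iff] at hne
      exact h (Measure.eq_zero_of_isEmpty _)
    have hFm : ∀ l ∈ Ici (i - (N : ℤ)), Measurable[F N] fun x : ℤ → S => x l := fun l hl =>
      Measurable.mono (comap_measurable _) (le_iSup (fun l : Ici (i - (N : ℤ)) =>
        MeasurableSpace.comap (fun x : ℤ → S => x l) inferInstance) ⟨l, hl⟩) le_rfl
    have hr : Measurable[F N] fun x => resample (Ici (i - (N : ℤ))) x y₀ := by
      refine @measurable_pi_lambda _ _ _ (F N) _ _ fun l => ?_
      by_cases hl : l ∈ Ici (i - (N : ℤ))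
      · simp only [resample_of_mem hl]; exact hFm l hl
      · simp only [resample_of_notMem hl]; exact measurable_const
    have hdep : DependsOn (tailMean P (i - (N : ℤ)) g) (Ici (i - (N : ℤ))) :=
      (dependsOn_tailMean _ (dependsOn_univ g)).mono Set.inter_subset_right
    have hmeas : Measurable[F N] (tailMean P (i - (N : ℤ)) g) := by
      have := (measurable_tailMean (P := P) (i - (N : ℤ)) hg).comp hr
      have he : tailMean P (i - (N : ℤ)) g ∘ (fun x => resample (Ici (i - (N : ℤ))) x y₀) =
          tailMean P (i - (N : ℤ)) g := funext fun x => hdep.resample_eq x y₀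
      rwa [he] at this
    refine ae_eq_condExp_of_forall_setIntegral_eq (F.le N) hint
      (fun s _ _ => (integrable_of_abs_le (measurable_tailMean _ hg)
        (abs_tailMean_le _ hB)).integrableOn) (fun s hs _ => ?_)
      (hmeas.stronglyMeasurable.aestronglyMeasurable)
    have hs' : MeasurableSet s := F.le N s hs
    have hφ : DependsOn (s.indicator fun _ => (1 : ℝ)) (Ici (i - (N : ℤ))) := by
      have hφm : Measurable[F N] (s.indicator fun _ => (1 : ℝ)) := measurable_const.indicator hs
      have hall : ∀ s : Set (ℤ → S), MeasurableSet[F N] s →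
          DependsOn (fun x => x ∈ s) (Ici (i - (N : ℤ))) := by
        intro s hs
        have hle : F N ≤ MeasurableSpace.comap
            (fun x => (fun l : Ici (i - (N : ℤ)) => x l)) MeasurableSpace.pi := by
          refine iSup_le fun l => ?_
          rw [← measurable_iff_comap_le]
          exact (measurable_pi_apply l).comp (comap_measurable (fun x : ℤ → S => fun l : Ici (i - (N : ℤ)) => x l))
        obtain ⟨u, -, rfl⟩ := hle s hs
        intro x y hxy
        have : (fun l : Ici (i - (N : ℤ)) => x l) = fun l : Ici (i - (N : ℤ)) => y l :=
          funext fun l => hxy l l.2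
        simp only [Set.mem_preimage, this]
      intro x y hxy
      have := hall s hs hxy
      simp only [Set.indicator, this]
    have h := integral_mul_tailMean (P := P) hg hB (measurable_const.indicator hs')
      (B' := 1) (fun x => by
        simp only [Set.indicator]
        split_ifs <;> simp) hφ
    simpa only [Set.indicator_mul_left, ← integral_indicator hs', Set.indicator, ite_mul, one_mul,
      zero_mul] using h
  have h := hint.tendsto_eLpNorm_condExp (ℱ := F)
    (by rw [hsup]; exact hg.stronglyMeasurable)
  refine h.congr fun N => ?_
  rw [eLpNorm_one_eq_lintegral_enorm]
  refine lintegral_congr_ae ?_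
  filter_upwards [hcond N] with x hx
  rw [Pi.sub_apply, ← hx, ← enorm_neg, neg_sub]

end Resampling

/-! ### Maximal inequality for martingale differences indexed by a finite set -/

section Softmax

/-- The chord of `exp` over `[-β, β]` lies above the graph. -/
lemma exp_le_cosh_add {x β : ℝ} (hβ : 0 < β) (hx : |x| ≤ β) :
    Real.exp x ≤ Real.cosh β + x * (Real.sinh β / β) := by
  obtain ⟨h1, h2⟩ := abs_le.1 hx
  have h : Real.exp (((β + x) / (2 * β)) • β + ((β - x) / (2 * β)) • (-β)) ≤
      ((β + x) / (2 * β)) • Real.exp β + ((β - x) / (2 * β)) • Real.exp (-β) :=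
    convexOn_exp.2 (Set.mem_univ β) (Set.mem_univ (-β))
      (div_nonneg (by linarith) (by linarith)) (div_nonneg (by linarith) (by linarith))
      (by field_simp; ring)
  simp only [smul_eq_mul] at h
  have he : (β + x) / (2 * β) * β + (β - x) / (2 * β) * -β = x := by field_simp; ring
  rw [he] at h
  refine h.trans (le_of_eq ?_)
  rw [Real.cosh_eq, Real.sinh_eq]
  field_simp
  ring

/-- Second order expansion of the softmax function, in the supremum norm: Hoeffding's lemma for
the law that gives `a` a mass proportional to `exp (y a)`. -/
lemma log_sum_exp_add_le {ι : Type*} [Fintype ι] [Nonempty ι] (y u : ι → ℝ) {b : ℝ}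
    (hu : ∀ a, |u a| ≤ b) :
    Real.log (∑ a, Real.exp (y a + u a)) ≤ Real.log (∑ a, Real.exp (y a)) +
      ∑ a, Real.exp (y a) / (∑ a', Real.exp (y a')) * u a + 2 * b ^ 2 := by
  set Z := ∑ a, Real.exp (y a) with hZ
  have hZpos : 0 < Z := Finset.sum_pos (fun a _ => Real.exp_pos _) Finset.univ_nonempty
  set w : ι → ℝ := fun a => Real.exp (y a) / Z with hw
  have hw0 : ∀ a, 0 ≤ w a := fun a => by positivity
  have hw1 : ∑ a, w a = 1 := by rw [hw, ← Finset.sum_div, div_self hZpos.ne']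
  obtain ⟨a₀⟩ := ‹Nonempty ι›
  have hb0 : 0 ≤ b := (abs_nonneg _).trans (hu a₀)
  set c := ∑ a, w a * u a with hc
  have hcb : |c| ≤ b := by
    calc |c| ≤ ∑ a, |w a * u a| := Finset.abs_sum_le_sum_abs _ _
      _ ≤ ∑ a, w a * b := Finset.sum_le_sum fun a _ => by
          rw [abs_mul, abs_of_nonneg (hw0 a)]
          exact mul_le_mul_of_nonneg_left (hu a) (hw0 a)
      _ = b := by rw [← Finset.sum_mul, hw1, one_mul]
  have hkey : ∑ a, w a * Real.exp (u a - c) ≤ Real.exp (2 * b ^ 2) := by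
    rcases hb0.eq_or_lt with h0 | hpos
    · have hu0 : ∀ a, u a = 0 := fun a => abs_nonpos_iff.1 ((hu a).trans h0.symm.le)
      have hc0 : c = 0 := abs_nonpos_iff.1 (hcb.trans h0.symm.le)
      simp [hu0, hc0, hw1, ← h0]
    · calc ∑ a, w a * Real.exp (u a - c)
          ≤ ∑ a, w a * (Real.cosh (2 * b) + (u a - c) * (Real.sinh (2 * b) / (2 * b))) := by
            refine Finset.sum_le_sum fun a _ => mul_le_mul_of_nonneg_left ?_ (hw0 a)
            refine exp_le_cosh_add (by linarith) ((abs_sub _ _).trans ?_)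
            linarith [hu a]
        _ = (∑ a, w a) * Real.cosh (2 * b) +
            (∑ a, w a * u a - (∑ a, w a) * c) * (Real.sinh (2 * b) / (2 * b)) := by
            rw [Finset.sum_mul, Finset.sum_mul, ← Finset.sum_sub_distrib, Finset.sum_mul,
              ← Finset.sum_add_distrib]
            exact Finset.sum_congr rfl fun a _ => by ring
        _ = Real.cosh (2 * b) := by rw [hw1, ← hc]; ring
        _ ≤ Real.exp ((2 * b) ^ 2 / 2) := Real.cosh_le_exp_half_sq _
        _ = Real.exp (2 * b ^ 2) := by ring_nf
  have hsum : ∑ a, Real.exp (y a + u a) = Z * Real.exp c * ∑ a, w a * Real.exp (u a - c) := by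
    rw [Finset.mul_sum]
    refine Finset.sum_congr rfl fun a _ => ?_
    simp only [hw]
    rw [Real.exp_add, Real.exp_sub]
    field_simp
  have hpos' : 0 < ∑ a, Real.exp (y a + u a) :=
    Finset.sum_pos (fun a _ => Real.exp_pos _) ⟨a₀, Finset.mem_univ _⟩
  calc Real.log (∑ a, Real.exp (y a + u a))
      ≤ Real.log (Z * Real.exp c * Real.exp (2 * b ^ 2)) := by
        refine Real.log_le_log hpos' ?_
        rw [hsum]
        exact mul_le_mul_of_nonneg_left hkey (by positivity)
    _ = Real.log Z + c + 2 * b ^ 2 := by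
        rw [Real.log_mul (by positivity) (by positivity), Real.log_mul (by positivity)
          (by positivity), Real.log_exp, Real.log_exp]

lemma abs_log_sum_exp_le {ι : Type*} [Fintype ι] [Nonempty ι] {y : ι → ℝ} {b : ℝ}
    (hy : ∀ a, |y a| ≤ b) :
    |Real.log (∑ a, Real.exp (y a))| ≤ b + Real.log (Fintype.card ι) := by
  have hcard : (1 : ℝ) ≤ Fintype.card ι := by exact_mod_cast Fintype.card_pos
  have hlog := Real.log_nonneg hcard
  obtain ⟨a₀⟩ := ‹Nonempty ι›
  have hpos : 0 < ∑ a, Real.exp (y a) :=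
    Finset.sum_pos (fun a _ => Real.exp_pos _) ⟨a₀, Finset.mem_univ _⟩
  rw [abs_le]
  constructor
  · have h1 : Real.exp (y a₀) ≤ ∑ a, Real.exp (y a) :=
      Finset.single_le_sum (f := fun a => Real.exp (y a)) (fun a _ => (Real.exp_pos _).le)
        (Finset.mem_univ a₀)
    have h2 := Real.log_le_log (Real.exp_pos _) h1
    rw [Real.log_exp] at h2
    linarith [(abs_le.1 (hy a₀)).1]
  · have h1 : ∑ a, Real.exp (y a) ≤ Fintype.card ι * Real.exp b := by
      rw [← nsmul_eq_mul, ← Finset.card_univ]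
      exact Finset.sum_le_card_nsmul _ _ _ fun a _ => Real.exp_le_exp.2 ((abs_le.1 (hy a)).2)
    have h2 := Real.log_le_log hpos h1
    rw [Real.log_mul (by positivity) (by positivity), Real.log_exp] at h2
    linarith

/-- For martingale differences `U t`, the expected softmax of the sum exceeds its initial value by
at most the sum of the second moments of the *maxima* of the differences: the first order terms of
the expansion are orthogonal to the past. -/
lemma integral_log_sum_exp_le {Ω ι : Type*} [MeasurableSpace Ω] (ρ : Measure Ω)
    [IsProbabilityMeasure ρ] [Fintype ι] [Nonempty ι] (U : ℕ → ι → Ω → ℝ)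
    (hU : ∀ t a, Measurable (U t a)) (b : ℕ → Ω → ℝ) (hb : ∀ t, Measurable (b t)) {β : ℝ}
    (hUb : ∀ t a x, |U t a x| ≤ b t x) (hbβ : ∀ t x, b t x ≤ β)
    (horth : ∀ t (ψ : (ι → ℝ) → ℝ), Measurable ψ → (∀ y, |ψ y| ≤ 1) → ∀ a,
      ∫ x, ψ (fun a' => ∑ s ∈ Finset.range t, U s a' x) * U t a x ∂ρ = 0)
    {c : ℝ} (N : ℕ) :
    ∫ x, Real.log (∑ a, Real.exp (c * ∑ t ∈ Finset.range N, U t a x)) ∂ρ ≤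
      Real.log (Fintype.card ι) + 2 * c ^ 2 * ∑ t ∈ Finset.range N, ∫ x, b t x ^ 2 ∂ρ := by
  obtain ⟨a₀⟩ := id ‹Nonempty ι›
  have hb0 : ∀ t x, 0 ≤ b t x := fun t x => (abs_nonneg _).trans (hUb t a₀ x)
  have hSm : ∀ N a, Measurable fun x => c * ∑ t ∈ Finset.range N, U t a x := fun N a =>
    (Finset.measurable_sum _ fun t _ => hU t a).const_mul c
  have hSb : ∀ N a x, |c * ∑ t ∈ Finset.range N, U t a x| ≤ |c| * (N * β) := fun N a x => by
    rw [abs_mul]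
    refine mul_le_mul_of_nonneg_left ((Finset.abs_sum_le_sum_abs _ _).trans ?_) (abs_nonneg _)
    refine (Finset.sum_le_card_nsmul _ _ β fun t _ => (hUb t a x).trans (hbβ t x)).trans ?_
    simp
  have hint : ∀ N, Integrable
      (fun x => Real.log (∑ a, Real.exp (c * ∑ t ∈ Finset.range N, U t a x))) ρ := fun N =>
    integrable_of_abs_le (Real.measurable_log.comp (Finset.measurable_sum _ fun a _ =>
      Real.measurable_exp.comp (hSm N a))) fun x => abs_log_sum_exp_le (hSb N · x)
  induction N with
  | zero => simp
  | succ N ih =>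
    obtain ⟨w, hw⟩ : ∃ w : ι → (ι → ℝ) → ℝ,
        w = fun a y => Real.exp (c * y a) / ∑ a', Real.exp (c * y a') := ⟨_, rfl⟩
    have hwm : ∀ a, Measurable (w a) := fun a => by
      rw [hw]
      fun_prop
    have hw1 : ∀ a y, |w a y| ≤ 1 := fun a y => by
      rw [hw]
      have hpos : 0 < ∑ a', Real.exp (c * y a') :=
        Finset.sum_pos (fun a _ => Real.exp_pos _) Finset.univ_nonempty
      rw [abs_of_nonneg (by positivity), div_le_one hpos]
      exact Finset.single_le_sum (f := fun a => Real.exp (c * y a))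
        (fun a _ => (Real.exp_pos _).le) (Finset.mem_univ a)
    have hwint : ∀ a, Integrable (fun x =>
        w a (fun a' => ∑ s ∈ Finset.range N, U s a' x) * U N a x) ρ := fun a => by
      have h1 : Measurable fun x => w a (fun a' => ∑ s ∈ Finset.range N, U s a' x) :=
        (hwm a).comp (measurable_pi_lambda _ fun a' => Finset.measurable_sum _ fun s _ => hU s a')
      refine integrable_of_abs_le (B := β) (h1.mul (hU N a)) fun x => ?_
      rw [abs_mul]
      calc _ ≤ 1 * b N x := mul_le_mul (hw1 _ _) (hUb N a x) (abs_nonneg _) zero_le_one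
        _ ≤ β := by rw [one_mul]; exact hbβ N x
    have hbint : Integrable (fun x => b N x ^ 2) ρ :=
      integrable_of_abs_le (B := β ^ 2) ((hb N).pow_const 2) fun x => by
        rw [abs_of_nonneg (by positivity)]
        exact pow_le_pow_left₀ (hb0 N x) (hbβ N x) 2
    have hstep : ∀ x, Real.log (∑ a, Real.exp (c * ∑ t ∈ Finset.range (N + 1), U t a x)) ≤
        Real.log (∑ a, Real.exp (c * ∑ t ∈ Finset.range N, U t a x)) +
        c * (∑ a, w a (fun a' => ∑ s ∈ Finset.range N, U s a' x) * U N a x) +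
        2 * c ^ 2 * b N x ^ 2 := fun x => by
      have h := log_sum_exp_add_le (fun a => c * ∑ t ∈ Finset.range N, U t a x)
        (fun a => c * U N a x) (b := |c| * b N x) fun a => by
          rw [abs_mul]
          exact mul_le_mul_of_nonneg_left (hUb N a x) (abs_nonneg _)
      simp only [Finset.sum_range_succ, mul_add]
      refine h.trans (le_of_eq ?_)
      rw [mul_pow, sq_abs, Finset.mul_sum]
      congr 1
      · congr 1
        exact Finset.sum_congr rfl fun a _ => by simp only [hw]; ring
      · ring
    have hsumint : Integrable (fun x =>
        ∑ a, w a (fun a' => ∑ s ∈ Finset.range N, U s a' x) * U N a x) ρ :=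
      integrable_finsetSum _ fun a _ => hwint a
    have hfirst : Integrable (fun x =>
        Real.log (∑ a, Real.exp (c * ∑ t ∈ Finset.range N, U t a x)) +
        c * (∑ a, w a (fun a' => ∑ s ∈ Finset.range N, U s a' x) * U N a x)) ρ :=
      (hint N).add (hsumint.const_mul c)
    have h := integral_mono (hint (N + 1)) (hfirst.add (hbint.const_mul (2 * c ^ 2))) hstep
    rw [integral_add' hfirst (hbint.const_mul (2 * c ^ 2)),
      integral_add (hint N) (hsumint.const_mul c), integral_const_mul, integral_const_mul,
      integral_finsetSum _ fun a _ => hwint a,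
      Finset.sum_eq_zero fun a _ => horth N (w a) (hwm a) (hw1 a) a] at h
    rw [Finset.sum_range_succ, mul_add]
    linarith

/-- The maximum of finitely many numbers is at most their softmax. -/
lemma abs_le_log_sum_exp {A : Type*} [Fintype A] {c : ℝ} (hc : 0 < c) (y : A → ℝ) (a : A) :
    |y a| ≤ c⁻¹ * Real.log (∑ p : A × Bool, Real.exp (c * if p.2 then y p.1 else -y p.1)) := by
  rw [inv_mul_eq_div, le_div_iff₀ hc]
  have h : ∀ s : Bool, c * (if s then y a else -y a) ≤
      Real.log (∑ p : A × Bool, Real.exp (c * if p.2 then y p.1 else -y p.1)) := fun s => by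
    have h1 := Finset.single_le_sum
      (f := fun p : A × Bool => Real.exp (c * if p.2 then y p.1 else -y p.1))
      (fun a _ => (Real.exp_pos _).le) (Finset.mem_univ (a, s))
    have h2 := Real.log_le_log (Real.exp_pos _) h1
    rwa [Real.log_exp] at h2
  rcases abs_cases (y a) with ⟨h', -⟩ | ⟨h', -⟩
  · rw [h']; have := h true; simp only [if_true] at this; linarith
  · rw [h']; have := h false; simp only [Bool.false_eq_true, if_false] at this; linarith

/-- **Maximal inequality.** The maximum over `A` of the sums of martingale differences is of the
order `√(V log |A|)`, where `V` is the sum of the second moments of the maxima over `A` of the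
single differences. -/
lemma lintegral_iSup_martingale_le {Ω A : Type*} [MeasurableSpace Ω] (ρ : Measure Ω)
    [IsProbabilityMeasure ρ] [Fintype A] [Nonempty A] (U : ℕ → A → Ω → ℝ)
    (hU : ∀ t a, Measurable (U t a)) {β : ℝ} (hUβ : ∀ t a x, |U t a x| ≤ β)
    (horth : ∀ t (ψ : (A → ℝ) → ℝ), Measurable ψ → (∀ y, |ψ y| ≤ 1) → ∀ a,
      ∫ x, ψ (fun a' => ∑ s ∈ Finset.range t, U s a' x) * U t a x ∂ρ = 0)
    (N : ℕ) {V : ℝ} (hV : 0 < V)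
    (hUV : ∑ t ∈ Finset.range N, ∫⁻ x, (⨆ a, ‖U t a x‖ₑ) ^ 2 ∂ρ ≤ ENNReal.ofReal V) :
    ∫⁻ x, ⨆ a, ‖∑ t ∈ Finset.range N, U t a x‖ₑ ∂ρ ≤
      ENNReal.ofReal (3 * Real.sqrt (V * Real.log (2 * Fintype.card A))) := by
  obtain ⟨a₀⟩ := id ‹Nonempty A›
  have hcard : (1 : ℝ) ≤ Fintype.card A := by exact_mod_cast Fintype.card_pos
  set G := Real.log (2 * Fintype.card A) with hG
  have hGpos : 0 < G := Real.log_pos (by linarith)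
  set c := Real.sqrt (G / V) with hc
  have hcpos : 0 < c := Real.sqrt_pos.2 (div_pos hGpos hV)
  have hfin : ∀ t x, (⨆ a, ‖U t a x‖ₑ) ≤ ENNReal.ofReal β := fun t x => iSup_le fun a => by
    rw [Real.enorm_eq_ofReal_abs]
    exact ENNReal.ofReal_le_ofReal (hUβ t a x)
  set b : ℕ → Ω → ℝ := fun t x => (⨆ a, ‖U t a x‖ₑ).toReal with hb
  have hbsm : ∀ t, Measurable fun x => ⨆ a, ‖U t a x‖ₑ := fun t =>
    Measurable.iSup fun a => (hU t a).enorm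
  have hbm : ∀ t, Measurable (b t) := fun t => (hbsm t).ennreal_toReal
  have hβ : 0 ≤ β := by
    have : Nonempty Ω := ρ.nonempty_of_neZero
    exact (abs_nonneg _).trans (hUβ 0 a₀ (Classical.arbitrary Ω))
  have hbβ : ∀ t x, b t x ≤ β := fun t x => ENNReal.toReal_le_of_le_ofReal hβ (hfin t x)
  have hUb : ∀ t a x, |U t a x| ≤ b t x := fun t a x => by
    have h := ENNReal.toReal_mono ((hfin t x).trans_lt ENNReal.ofReal_lt_top).ne
      (le_iSup (fun a => ‖U t a x‖ₑ) a)
    simpa using h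
  have hbV : ∑ t ∈ Finset.range N, ∫ x, b t x ^ 2 ∂ρ ≤ V := by
    have h : ENNReal.ofReal (∑ t ∈ Finset.range N, ∫ x, b t x ^ 2 ∂ρ) ≤ ENNReal.ofReal V := by
      rw [ENNReal.ofReal_sum_of_nonneg fun t _ => integral_nonneg fun x => sq_nonneg _]
      refine le_trans (Finset.sum_le_sum fun t _ => le_of_eq ?_) hUV
      rw [ofReal_integral_eq_lintegral_ofReal]
      · refine lintegral_congr fun x => ?_
        rw [hb, ENNReal.ofReal_pow ENNReal.toReal_nonneg,
          ENNReal.ofReal_toReal ((hfin t x).trans_lt ENNReal.ofReal_lt_top).ne]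
      · refine integrable_of_abs_le (B := β ^ 2) ((hbm t).pow_const 2) fun x => ?_
        rw [abs_of_nonneg (by positivity)]
        exact pow_le_pow_left₀ ENNReal.toReal_nonneg (hbβ t x) 2
      · exact Eventually.of_forall fun x => sq_nonneg _
    exact (ENNReal.ofReal_le_ofReal_iff hV.le).1 h
  set W : ℕ → A × Bool → Ω → ℝ := fun t p x => if p.2 then U t p.1 x else -U t p.1 x with hW
  have hWsum : ∀ (n : ℕ) (p : A × Bool) x, ∑ t ∈ Finset.range n, W t p x =
      if p.2 then ∑ t ∈ Finset.range n, U t p.1 x else -∑ t ∈ Finset.range n, U t p.1 x := by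
    rintro n ⟨a, _ | _⟩ x <;> simp [hW]
  have hWm : ∀ t p, Measurable (W t p) := by
    rintro t ⟨a, _ | _⟩
    · exact (hU t a).neg
    · simpa [hW] using hU t a
  have hWb : ∀ t p x, |W t p x| ≤ b t x := by
    rintro t ⟨a, _ | _⟩ x
    · simpa [hW] using hUb t a x
    · simpa [hW] using hUb t a x
  have hWorth : ∀ t (ψ : (A × Bool → ℝ) → ℝ), Measurable ψ → (∀ y, |ψ y| ≤ 1) → ∀ p,
      ∫ x, ψ (fun p' => ∑ s ∈ Finset.range t, W s p' x) * W t p x ∂ρ = 0 := by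
    intro t ψ hψ hψ1 p
    have h := horth t (fun y => ψ fun p' => if p'.2 then y p'.1 else -y p'.1)
      (hψ.comp (measurable_pi_lambda _ fun p' => by
        rcases p' with ⟨a, _ | _⟩
        · exact (measurable_pi_apply a).neg
        · simpa using measurable_pi_apply a)) (fun y => hψ1 _) p.1
    simp only [hWsum]
    rcases p with ⟨a, _ | _⟩
    · simp only [hW, Bool.false_eq_true, if_false, mul_neg, integral_neg, neg_eq_zero]
      exact h
    · simp only [hW, if_true]
      exact h
  have hmain := integral_log_sum_exp_le ρ W hWm b hbm hWb hbβ hWorth (c := c) N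
  have hcardW : (Fintype.card (A × Bool) : ℝ) = 2 * Fintype.card A := by
    rw [Fintype.card_prod, Fintype.card_bool]; push_cast; ring
  rw [hcardW, ← hG] at hmain
  set L : Ω → ℝ := fun x =>
    Real.log (∑ p, Real.exp (c * ∑ t ∈ Finset.range N, W t p x)) with hL
  have hLm : Measurable L := Real.measurable_log.comp (Finset.measurable_sum _ fun p _ =>
    Real.measurable_exp.comp ((Finset.measurable_sum _ fun t _ => hWm t p).const_mul c))
  have hLb : ∀ x a, |∑ t ∈ Finset.range N, U t a x| ≤ c⁻¹ * L x := fun x a => by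
    have := abs_le_log_sum_exp hcpos (fun a => ∑ t ∈ Finset.range N, U t a x) a
    simpa only [hL, hWsum] using this
  have hL0 : ∀ x, 0 ≤ c⁻¹ * L x := fun x => (abs_nonneg _).trans (hLb x a₀)
  have hLint : Integrable L ρ := by
    refine integrable_of_abs_le hLm fun x => abs_log_sum_exp_le (b := c * (N * β)) fun p => ?_
    rw [abs_mul, abs_of_pos hcpos]
    refine mul_le_mul_of_nonneg_left ((Finset.abs_sum_le_sum_abs _ _).trans ?_) hcpos.le
    refine (Finset.sum_le_card_nsmul _ _ β fun t _ => (hWb t p x).trans (hbβ t x)).trans ?_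
    simp
  calc ∫⁻ x, ⨆ a, ‖∑ t ∈ Finset.range N, U t a x‖ₑ ∂ρ
      ≤ ∫⁻ x, ENNReal.ofReal (c⁻¹ * L x) ∂ρ := by
        refine lintegral_mono fun x => iSup_le fun a => ?_
        rw [Real.enorm_eq_ofReal_abs]
        exact ENNReal.ofReal_le_ofReal (hLb x a)
    _ = ENNReal.ofReal (∫ x, c⁻¹ * L x ∂ρ) :=
        (ofReal_integral_eq_lintegral_ofReal (hLint.const_mul _)
          (Eventually.of_forall hL0)).symm
    _ ≤ ENNReal.ofReal (3 * Real.sqrt (V * G)) := by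
        refine ENNReal.ofReal_le_ofReal ?_
        rw [integral_const_mul]
        have h1 : ∫ x, L x ∂ρ ≤ G + 2 * c ^ 2 * V :=
          hmain.trans (by gcongr)
        have hcsq : c ^ 2 = G / V := Real.sq_sqrt (by positivity)
        rw [hcsq] at h1
        have h2 : G + 2 * (G / V) * V = 3 * G := by field_simp; ring
        rw [h2] at h1
        have h3 : c⁻¹ * (3 * G) = 3 * Real.sqrt (V * G) := by
          have h4 : Real.sqrt (V * G) * c = G := by
            rw [hc, ← Real.sqrt_mul (by positivity)]
            have : V * G * (G / V) = G ^ 2 := by field_simp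
            rw [this, Real.sqrt_sq hGpos.le]
          rw [inv_mul_eq_div, div_eq_iff hcpos.ne']
          linarith
        rw [← h3]
        exact mul_le_mul_of_nonneg_left h1 (by positivity)

end Softmax

/-! ### Concentration of weighted sums of functions of the past -/

section Concentration

lemma dependsOn_finset_sum {S ι : Type*} {s : Set ℤ} (T : Finset ι) {f : ι → (ℤ → S) → ℝ}
    (hf : ∀ t ∈ T, DependsOn (f t) s) : DependsOn (fun x => ∑ t ∈ T, f t x) s := by
  intro x y h
  exact Finset.sum_congr rfl fun t ht => hf t ht h

variable {S : Type*} [MeasurableSpace S] (P : Measure S) [IsProbabilityMeasure P]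

/-- For a function `g` of the coordinates at times `≤ i`, the part of `g` that is due to the
coordinate at time `i - j`. -/
noncomputable def innov (i : ℤ) (j : ℕ) (g : (ℤ → S) → ℝ) (x : ℤ → S) : ℝ :=
  tailMean P (i - j) g x - tailMean P (i - j + 1) g x

/-- For a function `g` of the coordinates at times `≤ i`, the centered projection of `g` onto the
functions of the coordinates at times `i - m, …, i`. -/
noncomputable def shortPart (i : ℤ) (m : ℕ) (g : (ℤ → S) → ℝ) (x : ℤ → S) : ℝ :=
  tailMean P (i - m) g x - ∫ y, g y ∂(iidLaw P)

variable {P}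

lemma measurable_innov (i : ℤ) (j : ℕ) {g : (ℤ → S) → ℝ} (hg : Measurable g) :
    Measurable (innov P i j g) :=
  (measurable_tailMean _ hg).sub (measurable_tailMean _ hg)

lemma abs_innov_le (i : ℤ) (j : ℕ) {g : (ℤ → S) → ℝ} {B : ℝ} (hB : ∀ x, |g x| ≤ B)
    (x : ℤ → S) : |innov P i j g x| ≤ 2 * B := by
  refine (abs_sub _ _).trans ?_
  linarith [abs_tailMean_le (P := P) (i - j) hB x, abs_tailMean_le (P := P) (i - j + 1) hB x]

lemma dependsOn_innov (i : ℤ) (j : ℕ) (g : (ℤ → S) → ℝ) :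
    DependsOn (innov P i j g) (Ici (i - j)) := by
  intro x y h
  have h1 := (dependsOn_tailMean (P := P) (i - j) (dependsOn_univ g)).mono
    Set.inter_subset_right h
  have h2 := ((dependsOn_tailMean (P := P) (i - j + 1) (dependsOn_univ g)).mono
    Set.inter_subset_right).mono (Ici_subset_Ici.2 (by omega)) h
  rw [innov, innov, h1, h2]

/-- The innovation at time `i - j` is orthogonal to all functions of later coordinates. -/
lemma integral_mul_innov_eq_zero (i : ℤ) (j : ℕ) {g φ : (ℤ → S) → ℝ} (hg : Measurable g) {B : ℝ}
    (hB : ∀ x, |g x| ≤ B) (hφm : Measurable φ) {B' : ℝ} (hB' : ∀ x, |φ x| ≤ B')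
    (hφ : DependsOn φ (Ici (i - j + 1))) :
    ∫ x, φ x * innov P i j g x ∂(iidLaw P) = 0 := by
  have hint : ∀ t, Integrable (fun x => φ x * tailMean P t g x) (iidLaw P) := fun t =>
    integrable_of_abs_le (B := B' * B) (hφm.mul (measurable_tailMean t hg)) fun x => by
      rw [abs_mul]
      exact mul_le_mul (hB' x) (abs_tailMean_le t hB x) (abs_nonneg _)
        ((abs_nonneg _).trans (hB' x))
  simp only [innov, mul_sub]
  rw [integral_sub (hint _) (hint _), integral_mul_tailMean hg hB hφm hB' hφ,
    integral_mul_tailMean hg hB hφm hB' (hφ.mono (Ici_subset_Ici.2 (by omega))), sub_self]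

lemma sum_innov (i : ℤ) (r : ℕ) (g : (ℤ → S) → ℝ) (x : ℤ → S) (m : ℕ) :
    ∑ j ∈ Finset.range r, innov P i (m + j) g x =
      tailMean P (i - ((m + r : ℕ) : ℤ) + 1) g x - tailMean P (i - m + 1) g x := by
  induction r with
  | zero => simp
  | succ r ih =>
    rw [Finset.sum_range_succ, ih, innov]
    have : i - ((m + (r + 1) : ℕ) : ℤ) + 1 = i - ((m + r : ℕ) : ℤ) := by push_cast; ring
    rw [this]
    ring

lemma shortPart_eq_sum_innov (i : ℤ) (m : ℕ) {g : (ℤ → S) → ℝ} (hg : DependsOn g (Iic i))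
    (x : ℤ → S) : shortPart P i m g x = ∑ j ∈ Finset.range (m + 1), innov P i j g x := by
  have h := sum_innov (P := P) i (m + 1) g x 0
  simp only [zero_add, Nat.cast_zero, sub_zero] at h
  have hi : i - ((m + 1 : ℕ) : ℤ) + 1 = i - m := by push_cast; ring
  rw [h, hi, tailMean_eq_integral (hg.mono fun l hl => Int.lt_add_one_of_le hl), shortPart]

lemma measurable_shortPart (i : ℤ) (m : ℕ) {g : (ℤ → S) → ℝ} (hg : Measurable g) :
    Measurable (shortPart P i m g) :=
  (measurable_tailMean _ hg).sub_const _

lemma abs_shortPart_le (i : ℤ) (m : ℕ) {g : (ℤ → S) → ℝ} {B : ℝ} (hB : ∀ x, |g x| ≤ B)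
    (x : ℤ → S) : |shortPart P i m g x| ≤ 2 * B := by
  have h : |∫ y, g y ∂(iidLaw P)| ≤ B := by
    have := norm_integral_le_of_norm_le_const (μ := iidLaw P) (f := g) (C := B)
      (Eventually.of_forall hB)
    simpa using this
  refine (abs_sub _ _).trans ?_
  linarith [abs_tailMean_le (P := P) (i - m) hB x]

lemma dependsOn_shortPart (i : ℤ) (m : ℕ) {g : (ℤ → S) → ℝ} (hg : DependsOn g (Iic i)) :
    DependsOn (shortPart P i m g) (Icc (i - m) i) := by
  intro x y h
  have hsub : Iic i ∩ Ici (i - (m : ℤ)) ⊆ Icc (i - m) i := fun l hl => ⟨hl.2, hl.1⟩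
  rw [shortPart, shortPart, (dependsOn_tailMean (P := P) (i - m) hg).mono hsub h]

lemma integral_shortPart (i : ℤ) (m : ℕ) {g : (ℤ → S) → ℝ} (hg : Measurable g) {B : ℝ}
    (hB : ∀ x, |g x| ≤ B) : ∫ x, shortPart P i m g x ∂(iidLaw P) = 0 := by
  simp only [shortPart]
  rw [integral_sub (integrable_of_abs_le (measurable_tailMean _ hg) (abs_tailMean_le _ hB))
    (integrable_const _), integral_tailMean hg hB]
  simp

section Array

variable {A : Type*} [Fintype A] (c : ℤ) (g : ℕ → A → (ℤ → S) → ℝ) (w : ℕ → A → ℝ)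
  {B κ : ℝ} {δ : ℕ → ℝ}

/-- The innovations of equal lag of an array form a martingale difference sequence, which gives a
bound for the maximum of their weighted sums. -/
lemma lintegral_iSup_sum_innov_le [Nonempty A] (hgm : ∀ t a, Measurable (g t a))
    (hgB : ∀ t a x, |g t a x| ≤ B) (hw : ∀ t a, |w t a| ≤ κ) (hκ : 0 < κ) (hδ : ∀ j, 0 < δ j)
    (hdep : ∀ t j : ℕ, ∫⁻ p, (⨆ a, ‖g t a p.1 - g t a (resample {c - t - (j : ℤ)}ᶜ p.1 p.2)‖ₑ) ^ 2
      ∂((iidLaw P).prod (iidLaw P)) ≤ ENNReal.ofReal (δ j ^ 2))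
    (j : ℕ) {N : ℕ} (hN : 0 < N) :
    ∫⁻ x, ⨆ a, ‖∑ t ∈ Finset.range N, w t a * innov P (c - t) j (g t a) x‖ₑ ∂(iidLaw P) ≤
      ENNReal.ofReal (3 * κ * Real.sqrt (N * Real.log (2 * Fintype.card A)) * δ j) := by
  obtain ⟨a₀⟩ := id ‹Nonempty A›
  have hcard : (1 : ℝ) ≤ Fintype.card A := by exact_mod_cast Fintype.card_pos
  have hVpos : (0 : ℝ) < N * (κ * δ j) ^ 2 := by
    have := hδ j
    positivity
  have h := lintegral_iSup_martingale_le (iidLaw P)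
    (fun t a x => w t a * innov P (c - t) j (g t a) x)
    (fun t a => (measurable_innov _ _ (hgm t a)).const_mul _) (β := κ * (2 * B))
    (fun t a x => by
      rw [abs_mul]
      exact mul_le_mul (hw t a) (abs_innov_le _ _ (hgB t a) x) (abs_nonneg _) hκ.le)
    (fun t ψ hψ hψ1 a => by
      have hm : ∀ a', Measurable fun x : ℤ → S =>
          ∑ s ∈ Finset.range t, w s a' * innov P (c - s) j (g s a') x := fun a' =>
        Finset.measurable_sum _ fun s _ => (measurable_innov _ _ (hgm s a')).const_mul _
      have hd : DependsOn (fun x : ℤ → S => ψ fun a' =>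
          ∑ s ∈ Finset.range t, w s a' * innov P (c - s) j (g s a') x)
          (Ici (c - t - j + 1)) := by
        intro x y hxy
        have : ∀ a', ∑ s ∈ Finset.range t, w s a' * innov P (c - s) j (g s a') x =
            ∑ s ∈ Finset.range t, w s a' * innov P (c - s) j (g s a') y := fun a' => by
          refine Finset.sum_congr rfl fun s hs => ?_
          have hst := Finset.mem_range.1 hs
          rw [(dependsOn_innov (P := P) (c - s) j (g s a')).mono
            (Ici_subset_Ici.2 (by omega)) hxy]
        simp only [this]
      have h0 := integral_mul_innov_eq_zero (P := P) (c - t) j (hgm t a) (hgB t a)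
        (hψ.comp (measurable_pi_lambda _ hm)) (fun x => hψ1 _) hd
      calc _ = ∫ x, w t a * ((ψ fun a' =>
            ∑ s ∈ Finset.range t, w s a' * innov P (c - s) j (g s a') x) *
            innov P (c - t) j (g t a) x) ∂(iidLaw P) := by
              refine integral_congr_ae (Eventually.of_forall fun x => ?_)
              simp only
              ring
        _ = 0 := by
          rw [integral_const_mul]
          exact mul_eq_zero_of_right _ h0)
    N hVpos (by
      calc _ ≤ ∑ t ∈ Finset.range N, ENNReal.ofReal ((κ * δ j) ^ 2) := by
            refine Finset.sum_le_sum fun t _ => ?_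
            calc _ ≤ ∫⁻ x, ENNReal.ofReal (κ ^ 2) *
                  (⨆ a, ‖tailMean P (c - t - j) (g t a) x -
                    tailMean P (c - t - j + 1) (g t a) x‖ₑ) ^ 2 ∂(iidLaw P) := by
                  refine lintegral_mono fun x => ?_
                  rw [ENNReal.ofReal_pow hκ.le, ← mul_pow]
                  refine pow_le_pow_left' (iSup_le fun a => ?_) 2
                  rw [enorm_mul, Real.enorm_eq_ofReal_abs (w t a)]
                  exact mul_le_mul' (ENNReal.ofReal_le_ofReal (hw t a))
                    (le_iSup (fun a => ‖tailMean P (c - t - j) (g t a) x -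
                    tailMean P (c - t - j + 1) (g t a) x‖ₑ) a)
              _ = ENNReal.ofReal (κ ^ 2) * ∫⁻ x, (⨆ a, ‖tailMean P (c - t - j) (g t a) x -
                    tailMean P (c - t - j + 1) (g t a) x‖ₑ) ^ 2 ∂(iidLaw P) :=
                  lintegral_const_mul' _ _ ENNReal.ofReal_ne_top
              _ ≤ ENNReal.ofReal (κ ^ 2) * ENNReal.ofReal (δ j ^ 2) := by
                  gcongr
                  exact (lintegral_iSup_tailMean_sub_le _ (hgm t) (hgB t)).trans (hdep t j)
              _ = ENNReal.ofReal ((κ * δ j) ^ 2) := by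
                  rw [← ENNReal.ofReal_mul (by positivity), mul_pow]
        _ = ENNReal.ofReal (N * (κ * δ j) ^ 2) := by
            rw [Finset.sum_const, Finset.card_range, nsmul_eq_mul,
              ENNReal.ofReal_mul (by positivity), ENNReal.ofReal_natCast])
  refine h.trans (ENNReal.ofReal_le_ofReal (le_of_eq ?_))
  have hκδ : 0 ≤ κ * δ j := mul_nonneg hκ.le (hδ j).le
  have : (N : ℝ) * (κ * δ j) ^ 2 * Real.log (2 * Fintype.card A) =
      (κ * δ j) ^ 2 * (N * Real.log (2 * Fintype.card A)) := by ring
  rw [this, Real.sqrt_mul (sq_nonneg _), Real.sqrt_sq hκδ]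
  ring

end Array

section Single

variable (c : ℤ) (g : ℕ → (ℤ → S) → ℝ) (w : ℕ → ℝ) {B κ : ℝ} {δ : ℕ → ℝ}

lemma integral_sq_sum_innov_le (hgm : ∀ t, Measurable (g t)) (hgB : ∀ t x, |g t x| ≤ B)
    (j : ℕ) (hQ : ∀ t : ℕ, ∫ x, innov P (c - t) j (g t) x ^ 2 ∂(iidLaw P) ≤ δ j ^ 2)
    (b : Finset ℕ) :
    ∫ x, (∑ t ∈ b, w t * innov P (c - t) j (g t) x) ^ 2 ∂(iidLaw P) ≤
      δ j ^ 2 * ∑ t ∈ b, w t ^ 2 := by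
  have hint : ∀ s t : ℕ, Integrable
      (fun x => innov P (c - s) j (g s) x * innov P (c - t) j (g t) x) (iidLaw P) := fun s t =>
    integrable_of_abs_le (B := 2 * B * (2 * B))
      ((measurable_innov _ _ (hgm s)).mul (measurable_innov _ _ (hgm t))) fun x => by
        rw [abs_mul]
        exact mul_le_mul (abs_innov_le _ _ (hgB s) x) (abs_innov_le _ _ (hgB t) x)
          (abs_nonneg _) ((abs_nonneg _).trans (abs_innov_le (P := P) (c - s) j (hgB s) x))
  have horth : ∀ s t : ℕ, s < t →
      ∫ x, innov P (c - s) j (g s) x * innov P (c - t) j (g t) x ∂(iidLaw P) = 0 := fun s t hst =>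
    integral_mul_innov_eq_zero _ j (hgm t) (hgB t) (measurable_innov _ _ (hgm s))
      (abs_innov_le _ _ (hgB s)) ((dependsOn_innov _ _ _).mono (Ici_subset_Ici.2 (by omega)))
  have hne : ∀ s t : ℕ, s ≠ t →
      ∫ x, innov P (c - s) j (g s) x * innov P (c - t) j (g t) x ∂(iidLaw P) = 0 := by
    intro s t hst
    rcases lt_or_gt_of_ne hst with h | h
    · exact horth s t h
    · rw [← horth t s h]
      exact integral_congr_ae (Eventually.of_forall fun x => mul_comm _ _)
  calc _ = ∫ x, ∑ s ∈ b, ∑ t ∈ b, w s * w t *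
        (innov P (c - s) j (g s) x * innov P (c - t) j (g t) x) ∂(iidLaw P) := by
        refine integral_congr_ae (Eventually.of_forall fun x => ?_)
        simp only
        rw [sq, Finset.sum_mul_sum]
        exact Finset.sum_congr rfl fun s _ => Finset.sum_congr rfl fun t _ => by ring
    _ = ∑ s ∈ b, ∑ t ∈ b, w s * w t *
        ∫ x, innov P (c - s) j (g s) x * innov P (c - t) j (g t) x ∂(iidLaw P) := by
        rw [integral_finsetSum _ fun s _ => integrable_finsetSum _ fun t _ =>
          (hint s t).const_mul _]
        refine Finset.sum_congr rfl fun s _ => ?_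
        rw [integral_finsetSum _ fun t _ => (hint s t).const_mul _]
        exact Finset.sum_congr rfl fun t _ => integral_const_mul _ _
    _ = ∑ s ∈ b, w s * w s *
        ∫ x, innov P (c - s) j (g s) x * innov P (c - s) j (g s) x ∂(iidLaw P) := by
        refine Finset.sum_congr rfl fun s hs => ?_
        refine Finset.sum_eq_single s (fun t _ hts => ?_) (fun h => absurd hs h)
        rw [hne s t hts.symm, mul_zero]
    _ ≤ ∑ s ∈ b, w s * w s * δ j ^ 2 := by
        refine Finset.sum_le_sum fun s _ => mul_le_mul_of_nonneg_left ?_ (mul_self_nonneg _)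
        simpa only [sq] using hQ s
    _ = _ := by
        rw [Finset.mul_sum]
        exact Finset.sum_congr rfl fun s _ => by ring

/-- Variance bound under summable dependence. -/
lemma integral_sq_sum_shortPart_le (hgm : ∀ t, Measurable (g t)) (hgB : ∀ t x, |g t x| ≤ B)
    (hgd : ∀ t, DependsOn (g t) (Iic (c - t))) (hδ : ∀ j, 0 < δ j)
    (hQ : ∀ t j : ℕ, ∫ x, innov P (c - t) j (g t) x ^ 2 ∂(iidLaw P) ≤ δ j ^ 2)
    (m : ℕ) {D : ℝ} (hD : ∑ j ∈ Finset.range (m + 1), δ j ≤ D) (b : Finset ℕ) :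
    ∫ x, (∑ t ∈ b, w t * shortPart P (c - t) m (g t) x) ^ 2 ∂(iidLaw P) ≤
      D ^ 2 * ∑ t ∈ b, w t ^ 2 := by
  set y : ℕ → (ℤ → S) → ℝ := fun j x => ∑ t ∈ b, w t * innov P (c - t) j (g t) x with hy
  have hD0 : 0 ≤ ∑ j ∈ Finset.range (m + 1), δ j := Finset.sum_nonneg fun j _ => (hδ j).le
  have hym : ∀ j, Measurable (y j) := fun j =>
    Finset.measurable_sum _ fun t _ => (measurable_innov _ _ (hgm t)).const_mul _
  have hyb : ∀ j x, |y j x| ≤ ∑ t ∈ b, |w t| * (2 * B) := fun j x =>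
    (Finset.abs_sum_le_sum_abs _ _).trans (Finset.sum_le_sum fun t _ => by
      rw [abs_mul]
      exact mul_le_mul_of_nonneg_left (abs_innov_le _ _ (hgB t) x) (abs_nonneg _))
  have hyint : ∀ j, Integrable (fun x => y j x ^ 2) (iidLaw P) := fun j =>
    integrable_of_abs_le ((hym j).pow_const 2) (B := (∑ t ∈ b, |w t| * (2 * B)) ^ 2) fun x => by
      rw [abs_pow]
      exact pow_le_pow_left₀ (abs_nonneg _) (hyb j x) 2
  have hsum : ∀ x, ∑ t ∈ b, w t * shortPart P (c - t) m (g t) x =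
      ∑ j ∈ Finset.range (m + 1), y j x := fun x => by
    simp only [hy]
    rw [Finset.sum_comm]
    refine Finset.sum_congr rfl fun t _ => ?_
    rw [shortPart_eq_sum_innov _ _ (hgd t), Finset.mul_sum]
  calc _ ≤ ∫ x, (∑ j ∈ Finset.range (m + 1), δ j) *
        ∑ j ∈ Finset.range (m + 1), (δ j)⁻¹ * y j x ^ 2 ∂(iidLaw P) := by
        refine integral_mono ?_ ?_ fun x => ?_
        · refine integrable_of_abs_le (B := (∑ j ∈ Finset.range (m + 1),
            ∑ t ∈ b, |w t| * (2 * B)) ^ 2) (Measurable.pow_const (Finset.measurable_sum _ fun t _ =>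
            (measurable_shortPart _ _ (hgm t)).const_mul _) 2) fun x => ?_
          rw [abs_pow, hsum]
          exact pow_le_pow_left₀ (abs_nonneg _) ((Finset.abs_sum_le_sum_abs _ _).trans
            (Finset.sum_le_sum fun j _ => hyb j x)) 2
        · exact (integrable_finsetSum _ fun j _ => (hyint j).const_mul _).const_mul _
        · simp only [hsum]
          refine Finset.sum_sq_le_sum_mul_sum_of_sq_le_mul _ (fun j _ => (hδ j).le)
            (fun j _ => mul_nonneg (inv_nonneg.2 (hδ j).le) (sq_nonneg _)) fun j _ => ?_
          rw [mul_inv_cancel_left₀ (hδ j).ne']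
    _ = (∑ j ∈ Finset.range (m + 1), δ j) *
        ∑ j ∈ Finset.range (m + 1), (δ j)⁻¹ * ∫ x, y j x ^ 2 ∂(iidLaw P) := by
        rw [integral_const_mul, integral_finsetSum _ fun j _ => (hyint j).const_mul _]
        congr 1
        exact Finset.sum_congr rfl fun j _ => integral_const_mul _ _
    _ ≤ (∑ j ∈ Finset.range (m + 1), δ j) *
        ∑ j ∈ Finset.range (m + 1), (δ j)⁻¹ * (δ j ^ 2 * ∑ t ∈ b, w t ^ 2) := by
        refine mul_le_mul_of_nonneg_left (Finset.sum_le_sum fun j _ => ?_) hD0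
        exact mul_le_mul_of_nonneg_left
          (integral_sq_sum_innov_le c g w hgm hgB j (fun t => hQ t j) b) (inv_nonneg.2 (hδ j).le)
    _ = (∑ j ∈ Finset.range (m + 1), δ j) ^ 2 * ∑ t ∈ b, w t ^ 2 := by
        rw [sq, mul_assoc, Finset.sum_mul (s := Finset.range (m + 1)) (f := δ)
          (∑ t ∈ b, w t ^ 2)]
        congr 1
        refine Finset.sum_congr rfl fun j _ => ?_
        have := (hδ j).ne'
        field_simp
    _ ≤ _ := mul_le_mul_of_nonneg_right (pow_le_pow_left₀ hD0 hD 2)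
        (Finset.sum_nonneg fun t _ => sq_nonneg _)

/-- Exponential moment of a bounded centered variable. -/
lemma integral_exp_le_of_abs_le_one {Ω : Type*} [MeasurableSpace Ω] (ρ : Measure Ω)
    [IsProbabilityMeasure ρ] {V : Ω → ℝ} (hV : Measurable V) (h1 : ∀ x, |V x| ≤ 1)
    (h0 : ∫ x, V x ∂ρ = 0) : ∫ x, Real.exp (V x) ∂ρ ≤ Real.exp (∫ x, V x ^ 2 ∂ρ) := by
  have hi : Integrable V ρ := integrable_of_abs_le hV h1
  have hi2 : Integrable (fun x => V x ^ 2) ρ :=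
    integrable_of_abs_le (hV.pow_const 2) (B := 1) fun x => by
      rw [abs_pow]; exact pow_le_one₀ (abs_nonneg _) (h1 x)
  have hle : ∀ x, Real.exp (V x) ≤ 1 + V x + V x ^ 2 := fun x => by
    linarith [(abs_le.1 (Real.abs_exp_sub_one_sub_id_le (h1 x))).2]
  have hexp : Integrable (fun x => Real.exp (V x)) ρ :=
    integrable_of_abs_le (Real.measurable_exp.comp hV) (B := Real.exp 1) fun x => by
      rw [abs_of_pos (Real.exp_pos _)]
      exact Real.exp_le_exp.2 ((le_abs_self _).trans (h1 x))
  have hone : Integrable (fun x => 1 + V x) ρ := (integrable_const 1).add hi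
  have h := integral_mono hexp (hone.add hi2) hle
  rw [integral_add' hone hi2, integral_add (integrable_const 1) hi, h0] at h
  simp only [integral_const, probReal_univ, smul_eq_mul, mul_one, add_zero] at h
  have := Real.add_one_le_exp (∫ x, V x ^ 2 ∂ρ)
  linarith

/-- Exponential moments of sums over well separated blocks of length `m + 1`, which are
independent. -/
lemma integral_exp_blocks_le (hgm : ∀ t, Measurable (g t)) (hgB : ∀ t x, |g t x| ≤ B)
    (hgd : ∀ t, DependsOn (g t) (Iic (c - t))) (hw : ∀ t, |w t| ≤ κ) (hδ : ∀ j, 0 < δ j)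
    (hQ : ∀ t j : ℕ, ∫ x, innov P (c - t) j (g t) x ^ 2 ∂(iidLaw P) ≤ δ j ^ 2)
    (m : ℕ) {D : ℝ} (hD : ∑ j ∈ Finset.range (m + 1), δ j ≤ D) (o : ℕ) {s : ℝ}
    (hs : |s| * ((m + 1) * (κ * (2 * B))) ≤ 1) (K : ℕ) :
    ∫ x, Real.exp (s * ∑ q ∈ Finset.range K, ∑ r ∈ Finset.range (m + 1),
      w (o + q * (2 * (m + 1)) + r) * shortPart P (c - (o + q * (2 * (m + 1)) + r : ℕ)) m
        (g (o + q * (2 * (m + 1)) + r)) x) ∂(iidLaw P) ≤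
      Real.exp (s ^ 2 * D ^ 2 * ∑ q ∈ Finset.range K, ∑ r ∈ Finset.range (m + 1),
        w (o + q * (2 * (m + 1)) + r) ^ 2) := by
  set V : ℕ → (ℤ → S) → ℝ := fun q x => ∑ r ∈ Finset.range (m + 1),
      w (o + q * (2 * (m + 1)) + r) * shortPart P (c - (o + q * (2 * (m + 1)) + r : ℕ)) m
        (g (o + q * (2 * (m + 1)) + r)) x with hVdef
  have hVm : ∀ q, Measurable (V q) := fun q =>
    Finset.measurable_sum _ fun r _ => (measurable_shortPart _ _ (hgm _)).const_mul _
  have hVb : ∀ q x, |V q x| ≤ (m + 1) * (κ * (2 * B)) := fun q x => by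
    refine (Finset.abs_sum_le_sum_abs _ _).trans ?_
    refine (Finset.sum_le_card_nsmul _ _ (κ * (2 * B)) fun r _ => ?_).trans (by simp)
    rw [abs_mul]
    exact mul_le_mul (hw _) (abs_shortPart_le _ _ (hgB _) x) (abs_nonneg _)
      ((abs_nonneg _).trans (hw 0))
  have hV0 : ∀ q, ∫ x, V q x ∂(iidLaw P) = 0 := fun q => by
    simp only [hVdef]
    rw [integral_finsetSum _ fun r _ => (integrable_of_abs_le (measurable_shortPart _ _ (hgm _))
      (abs_shortPart_le _ _ (hgB _))).const_mul _]
    refine Finset.sum_eq_zero fun r _ => ?_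
    rw [integral_const_mul, integral_shortPart _ _ (hgm _) (hgB _), mul_zero]
  have hVd : ∀ q, DependsOn (V q) (Icc (c - (o + (q + 1) * (2 * (m + 1)) : ℕ) + 1)
      (c - (o + q * (2 * (m + 1)) : ℕ))) := fun q => by
    refine dependsOn_finset_sum _ fun r hr x y hxy => ?_
    have hr' := Finset.mem_range.1 hr
    rw [(dependsOn_shortPart (P := P) (c - (o + q * (2 * (m + 1)) + r : ℕ)) m (hgd _)).mono
      (Icc_subset_Icc (by push_cast; linarith) (by push_cast; linarith)) hxy]
  have hVv : ∀ q, ∫ x, V q x ^ 2 ∂(iidLaw P) ≤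
      D ^ 2 * ∑ r ∈ Finset.range (m + 1), w (o + q * (2 * (m + 1)) + r) ^ 2 := fun q => by
    have h := integral_sq_sum_shortPart_le c g w hgm hgB hgd hδ hQ m hD
      ((Finset.range (m + 1)).map (addLeftEmbedding (o + q * (2 * (m + 1)))))
    simpa only [Finset.sum_map, addLeftEmbedding_apply] using h
  have hsV : ∀ q x, |s * V q x| ≤ 1 := fun q x => by
    rw [abs_mul]
    exact (mul_le_mul_of_nonneg_left (hVb q x) (abs_nonneg _)).trans hs
  induction K with
  | zero => simp
  | succ K ih =>
    have hprod : ∫ x, Real.exp (s * ∑ q ∈ Finset.range (K + 1), V q x) ∂(iidLaw P) =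
        (∫ x, Real.exp (s * ∑ q ∈ Finset.range K, V q x) ∂(iidLaw P)) *
          ∫ x, Real.exp (s * V K x) ∂(iidLaw P) := by
      rw [← integral_mul_of_dependsOn P (s := Ioi (c - (o + K * (2 * (m + 1)) : ℕ)))
        (t := Iic (c - (o + K * (2 * (m + 1)) : ℕ)))]
      · refine integral_congr_ae (Eventually.of_forall fun x => ?_)
        simp only [Finset.sum_range_succ, mul_add, Real.exp_add]
      · exact Set.disjoint_left.2 fun l h h' => absurd (mem_Iic.1 h') (not_le.2 h)
      · exact Real.measurable_exp.comp
          ((Finset.measurable_sum _ fun q _ => hVm q).const_mul _)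
      · exact Real.measurable_exp.comp ((hVm K).const_mul _)
      · have hd : DependsOn (fun x => ∑ q ∈ Finset.range K, V q x)
            (Ioi (c - (o + K * (2 * (m + 1)) : ℕ))) := by
          refine dependsOn_finset_sum _ fun q hq => (hVd q).mono fun l hl => ?_
          have hq' : (q + 1) * (2 * (m + 1)) ≤ K * (2 * (m + 1)) :=
            Nat.mul_le_mul_right _ (Finset.mem_range.1 hq)
          have hq'' : ((o + (q + 1) * (2 * (m + 1)) : ℕ) : ℤ) ≤
              (o + K * (2 * (m + 1)) : ℕ) := by exact_mod_cast Nat.add_le_add_left hq' o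
          have := hl.1
          simp only [mem_Ioi]
          linarith
        intro x y hxy
        simp only [hd hxy]
      · intro x y hxy
        simp only [(hVd K).mono Icc_subset_Iic_self hxy]
    have hlast : ∫ x, Real.exp (s * V K x) ∂(iidLaw P) ≤
        Real.exp (s ^ 2 * D ^ 2 *
          ∑ r ∈ Finset.range (m + 1), w (o + K * (2 * (m + 1)) + r) ^ 2) := by
      refine (integral_exp_le_of_abs_le_one (iidLaw P) ((hVm K).const_mul s) (hsV K)
        (by rw [integral_const_mul, hV0, mul_zero])).trans (Real.exp_le_exp.2 ?_)
      simp only [mul_pow]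
      rw [integral_const_mul, mul_assoc]
      exact mul_le_mul_of_nonneg_left (hVv K) (sq_nonneg _)
    rw [hprod, Finset.sum_range_succ, mul_add, Real.exp_add]
    exact mul_le_mul ih hlast (integral_nonneg fun x => (Real.exp_pos _).le) (Real.exp_pos _).le

lemma sum_range_mul_two_mul (f : ℕ → ℝ) (l K : ℕ) :
    ∑ t ∈ Finset.range (K * (2 * l)), f t =
      (∑ q ∈ Finset.range K, ∑ r ∈ Finset.range l, f (0 + q * (2 * l) + r)) +
        ∑ q ∈ Finset.range K, ∑ r ∈ Finset.range l, f (l + q * (2 * l) + r) := by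
  induction K with
  | zero => simp
  | succ K ih =>
    have : (K + 1) * (2 * l) = K * (2 * l) + l + l := by ring
    rw [this, Finset.sum_range_add, Finset.sum_range_add, ih, Finset.sum_range_succ,
      Finset.sum_range_succ (fun q => ∑ r ∈ Finset.range l, f (l + q * (2 * l) + r))]
    have h1 : ∀ r, 0 + K * (2 * l) + r = K * (2 * l) + r := fun r => by ring
    have h2 : ∀ r, l + K * (2 * l) + r = K * (2 * l) + l + r := fun r => by ring
    simp only [h1, h2]
    ring

/-- Bernstein's exponential moment bound for the centered projections onto `m + 1` coordinates. -/
lemma integral_exp_sum_shortPart_le (hgm : ∀ t, Measurable (g t)) (hgB : ∀ t x, |g t x| ≤ B)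
    (hgd : ∀ t, DependsOn (g t) (Iic (c - t))) (hw : ∀ t, |w t| ≤ κ) (hδ : ∀ j, 0 < δ j)
    (hQ : ∀ t j : ℕ, ∫ x, innov P (c - t) j (g t) x ^ 2 ∂(iidLaw P) ≤ δ j ^ 2)
    (m : ℕ) {D : ℝ} (hD : ∑ j ∈ Finset.range (m + 1), δ j ≤ D) {N : ℕ}
    (hwN : ∀ t, N ≤ t → w t = 0) {W : ℝ} (hW : ∑ t ∈ Finset.range N, w t ^ 2 ≤ W) {s : ℝ}
    (hs : |2 * s| * ((m + 1) * (κ * (2 * B))) ≤ 1) :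
    ∫ x, Real.exp (s * ∑ t ∈ Finset.range N, w t * shortPart P (c - t) m (g t) x) ∂(iidLaw P) ≤
      Real.exp (4 * s ^ 2 * D ^ 2 * W) := by
  have hext : ∀ f : ℕ → ℝ, (∀ t, N ≤ t → f t = 0) →
      ∑ t ∈ Finset.range N, f t = ∑ t ∈ Finset.range (N * (2 * (m + 1))), f t := fun f hf => by
    refine Finset.sum_subset (Finset.range_mono (Nat.le_mul_of_pos_right _ (by omega)))
      fun t _ ht => hf t (by simpa using ht)
  set T : ℕ → (ℤ → S) → ℝ := fun o x => ∑ q ∈ Finset.range N, ∑ r ∈ Finset.range (m + 1),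
      w (o + q * (2 * (m + 1)) + r) * shortPart P (c - (o + q * (2 * (m + 1)) + r : ℕ)) m
        (g (o + q * (2 * (m + 1)) + r)) x with hT
  have hTm : ∀ o, Measurable (T o) := fun o => Finset.measurable_sum _ fun q _ =>
    Finset.measurable_sum _ fun r _ => (measurable_shortPart _ _ (hgm _)).const_mul _
  have hTb : ∀ o, ∃ b, ∀ x, |T o x| ≤ b := fun o =>
    ⟨∑ q ∈ Finset.range N, ∑ r ∈ Finset.range (m + 1), κ * (2 * B), fun x =>
      (Finset.abs_sum_le_sum_abs _ _).trans (Finset.sum_le_sum fun q _ =>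
        (Finset.abs_sum_le_sum_abs _ _).trans (Finset.sum_le_sum fun r _ => by
          rw [abs_mul]
          exact mul_le_mul (hw _) (abs_shortPart_le _ _ (hgB _) x) (abs_nonneg _)
            ((abs_nonneg _).trans (hw 0))))⟩
  have hexp : ∀ o (b : ℝ), Integrable (fun x => Real.exp (b * T o x)) (iidLaw P) := fun o b => by
    obtain ⟨β, hβ⟩ := hTb o
    refine integrable_of_abs_le (Real.measurable_exp.comp ((hTm o).const_mul b))
      (B := Real.exp (|b| * β)) fun x => ?_
    rw [abs_of_pos (Real.exp_pos _)]
    refine Real.exp_le_exp.2 ((le_abs_self _).trans ?_)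
    rw [abs_mul]
    exact mul_le_mul_of_nonneg_left (hβ x) (abs_nonneg _)
  have hdecomp : ∀ x, ∑ t ∈ Finset.range N, w t * shortPart P (c - t) m (g t) x =
      T 0 x + T (m + 1) x := fun x => by
    rw [hext (fun t => w t * shortPart P (c - t) m (g t) x)
      (fun t ht => by rw [hwN t ht, zero_mul]), sum_range_mul_two_mul]
  have hsq := hext (fun t => w t ^ 2) (fun t ht => by rw [hwN t ht]; norm_num)
  rw [sum_range_mul_two_mul] at hsq
  have hblock : ∀ o, o = 0 ∨ o = m + 1 →
      ∫ x, Real.exp (2 * s * T o x) ∂(iidLaw P) ≤ Real.exp (4 * s ^ 2 * D ^ 2 * W) := by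
    intro o ho
    refine (integral_exp_blocks_le c g w hgm hgB hgd hw hδ hQ m hD o hs N).trans
      (Real.exp_le_exp.2 ?_)
    have hle : ∑ q ∈ Finset.range N, ∑ r ∈ Finset.range (m + 1),
        w (o + q * (2 * (m + 1)) + r) ^ 2 ≤ W := by
      have hnn : ∀ o, 0 ≤ ∑ q ∈ Finset.range N, ∑ r ∈ Finset.range (m + 1),
        w (o + q * (2 * (m + 1)) + r) ^ 2 := fun o =>
        Finset.sum_nonneg fun q _ => Finset.sum_nonneg fun r _ => sq_nonneg _
      rcases ho with rfl | rfl
      · linarith [hnn (m + 1)]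
      · linarith [hnn 0]
    have : (2 * s) ^ 2 * D ^ 2 = 4 * s ^ 2 * D ^ 2 := by ring
    rw [this]
    exact mul_le_mul_of_nonneg_left hle (by positivity)
  calc _ ≤ ∫ x, (2⁻¹ * Real.exp (2 * s * T 0 x) + 2⁻¹ * Real.exp (2 * s * T (m + 1) x))
        ∂(iidLaw P) := by
        refine integral_mono_of_nonneg (Eventually.of_forall fun x => (Real.exp_pos _).le)
          (((hexp 0 _).const_mul _).add ((hexp (m + 1) _).const_mul _))
          (Eventually.of_forall fun x => ?_)
        simp only [hdecomp]
        have h1 : Real.exp (s * (T 0 x + T (m + 1) x)) =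
            Real.exp (s * T 0 x) * Real.exp (s * T (m + 1) x) := by
          rw [mul_add, Real.exp_add]
        have h2 : ∀ o, Real.exp (2 * s * T o x) = Real.exp (s * T o x) ^ 2 := fun o => by
          rw [← Real.exp_nat_mul]
          push_cast
          ring_nf
        rw [h1, h2, h2]
        nlinarith [sq_nonneg (Real.exp (s * T 0 x) - Real.exp (s * T (m + 1) x))]
    _ ≤ Real.exp (4 * s ^ 2 * D ^ 2 * W) := by
        rw [integral_add ((hexp 0 _).const_mul _) ((hexp (m + 1) _).const_mul _),
          integral_const_mul, integral_const_mul]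
        linarith [hblock 0 (Or.inl rfl), hblock (m + 1) (Or.inr rfl)]

end Single

section Main

variable {A : Type*} [Fintype A] [Nonempty A] (c : ℤ) (g : ℕ → A → (ℤ → S) → ℝ) (w : ℕ → A → ℝ)
  {B κ : ℝ} {δ : ℕ → ℝ}

/-- From exponential moments to the expected maximum. -/
lemma lintegral_iSup_le_of_exp_moment {Ω : Type*} [MeasurableSpace Ω] (ρ : Measure Ω)
    [IsProbabilityMeasure ρ] (T : A → Ω → ℝ) (hTm : ∀ a, Measurable (T a)) {β : ℝ}
    (hTb : ∀ a x, |T a x| ≤ β) {s : ℝ} (hs : 0 < s) {E : ℝ}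
    (hE : ∀ a, ∫ x, Real.exp (s * T a x) ∂ρ ≤ Real.exp E)
    (hE' : ∀ a, ∫ x, Real.exp (-s * T a x) ∂ρ ≤ Real.exp E) :
    ∫⁻ x, ⨆ a, ‖T a x‖ₑ ∂ρ ≤
      ENNReal.ofReal (s⁻¹ * (Real.log (2 * Fintype.card A) + E)) := by
  obtain ⟨a₀⟩ := id ‹Nonempty A›
  have hcard : (1 : ℝ) ≤ Fintype.card A := by exact_mod_cast Fintype.card_pos
  set Y : Ω → ℝ := fun x =>
    ∑ p : A × Bool, Real.exp (s * if p.2 then T p.1 x else -T p.1 x) with hY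
  have hexp : ∀ p : A × Bool, Integrable
      (fun x => Real.exp (s * if p.2 then T p.1 x else -T p.1 x)) ρ := by
    intro p
    have hm : Measurable fun x => s * if p.2 then T p.1 x else -T p.1 x := by
      rcases p with ⟨a, _ | _⟩
      · exact (hTm a).neg.const_mul s
      · simpa using (hTm a).const_mul s
    refine integrable_of_abs_le (Real.measurable_exp.comp hm) (B := Real.exp (s * β)) fun x => ?_
    rw [abs_of_pos (Real.exp_pos _)]
    refine Real.exp_le_exp.2 (mul_le_mul_of_nonneg_left ?_ hs.le)
    have := abs_le.1 (hTb p.1 x)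
    split_ifs <;> linarith
  have hYint : Integrable Y ρ := integrable_finsetSum _ fun p _ => hexp p
  have hYpos : ∀ x, 0 < Y x := fun x =>
    Finset.sum_pos (fun p _ => Real.exp_pos _) ⟨(a₀, true), Finset.mem_univ _⟩
  set C := 2 * (Fintype.card A : ℝ) * Real.exp E with hC
  have hCpos : 0 < C := by positivity
  have hYC : ∫ x, Y x ∂ρ ≤ C := by
    simp only [hY]
    rw [integral_finsetSum _ fun p _ => hexp p]
    have : ∀ p : A × Bool,
        ∫ x, Real.exp (s * if p.2 then T p.1 x else -T p.1 x) ∂ρ ≤ Real.exp E := by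
      rintro ⟨a, _ | _⟩
      · simpa using hE' a
      · simpa using hE a
    refine (Finset.sum_le_card_nsmul _ _ _ fun p _ => this p).trans (le_of_eq ?_)
    rw [Finset.card_univ, Fintype.card_prod, Fintype.card_bool, nsmul_eq_mul, hC]
    push_cast
    ring
  -- the tangent of the logarithm at `C`
  have hlog : ∀ x, Real.log (Y x) ≤ Real.log C + Y x / C - 1 := fun x => by
    have h := Real.log_le_sub_one_of_pos (div_pos (hYpos x) hCpos)
    rw [Real.log_div (hYpos x).ne' hCpos.ne'] at h
    linarith
  have hb : ∀ x a, |T a x| ≤ s⁻¹ * (Real.log C + Y x / C - 1) := fun x a =>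
    (abs_le_log_sum_exp hs (fun a => T a x) a).trans
      (mul_le_mul_of_nonneg_left (hlog x) (inv_nonneg.2 hs.le))
  have hint : Integrable (fun x => s⁻¹ * (Real.log C + Y x / C - 1)) ρ :=
    (((integrable_const _).add (hYint.div_const C)).sub (integrable_const _)).const_mul _
  calc ∫⁻ x, ⨆ a, ‖T a x‖ₑ ∂ρ
      ≤ ∫⁻ x, ENNReal.ofReal (s⁻¹ * (Real.log C + Y x / C - 1)) ∂ρ := by
        refine lintegral_mono fun x => iSup_le fun a => ?_
        rw [Real.enorm_eq_ofReal_abs]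
        exact ENNReal.ofReal_le_ofReal (hb x a)
    _ = ENNReal.ofReal (∫ x, s⁻¹ * (Real.log C + Y x / C - 1) ∂ρ) :=
        (ofReal_integral_eq_lintegral_ofReal hint
          (Eventually.of_forall fun x => (abs_nonneg _).trans (hb x a₀))).symm
    _ ≤ _ := by
        refine ENNReal.ofReal_le_ofReal ?_
        have hint1 : Integrable (fun x => Real.log C + Y x / C) ρ :=
          (integrable_const _).add (hYint.div_const C)
        rw [integral_const_mul, integral_sub hint1 (integrable_const _),
          integral_add (integrable_const _) (hYint.div_const C), integral_div]
        refine mul_le_mul_of_nonneg_left ?_ (inv_nonneg.2 hs.le)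
        have h1 : (∫ x, Y x ∂ρ) / C ≤ 1 := (div_le_one hCpos).2 hYC
        have h2 : Real.log C = Real.log (2 * Fintype.card A) + E := by
          rw [hC, Real.log_mul (by positivity) (by positivity), Real.log_exp]
        simp only [integral_const, probReal_univ, smul_eq_mul, one_mul]
        linarith

/-- **Concentration.** Bernstein's bound applied to the projections of the array onto `m + 1`
coordinates, plus the maximal inequality applied to the innovations of each lag `> m`. The weights
enter the second part only through their maximum, and the array only through the dependence
measure of its envelope over `A`. -/
theorem lintegral_iSup_sum_sub_integral_le (hgm : ∀ t a, Measurable (g t a))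
    (hgB : ∀ t a x, |g t a x| ≤ B) (hgd : ∀ t a, DependsOn (g t a) (Iic (c - t)))
    (hw : ∀ t a, |w t a| ≤ κ) (hκ : 0 < κ) (hδ : ∀ j, 0 < δ j)
    (hdep : ∀ t j : ℕ, ∫⁻ p, (⨆ a, ‖g t a p.1 - g t a (resample {c - t - (j : ℤ)}ᶜ p.1 p.2)‖ₑ) ^ 2
      ∂((iidLaw P).prod (iidLaw P)) ≤ ENNReal.ofReal (δ j ^ 2))
    {N : ℕ} (hN : 0 < N) (hwN : ∀ t a, N ≤ t → w t a = 0) {W : ℝ}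
    (hW : ∀ a, ∑ t ∈ Finset.range N, w t a ^ 2 ≤ W)
    (m : ℕ) {D : ℝ} (hD : ∑ j ∈ Finset.range (m + 1), δ j ≤ D)
    {D' : ℝ} (hD' : ∀ r, ∑ j ∈ Finset.range r, δ (m + 1 + j) ≤ D')
    {s : ℝ} (hs0 : 0 < s) (hs : 2 * s * ((m + 1) * (κ * (2 * B))) ≤ 1) :
    ∫⁻ x, ⨆ a, ‖∑ t ∈ Finset.range N, w t a * (g t a x - ∫ y, g t a y ∂(iidLaw P))‖ₑ
        ∂(iidLaw P) ≤
      ENNReal.ofReal (s⁻¹ * (Real.log (2 * Fintype.card A) + 4 * s ^ 2 * D ^ 2 * W)) +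
      ENNReal.ofReal (3 * κ * Real.sqrt (N * Real.log (2 * Fintype.card A)) * D') := by
  obtain ⟨a₀⟩ := id ‹Nonempty A›
  have hQ : ∀ a, ∀ t j : ℕ, ∫ x, innov P (c - t) j (g t a) x ^ 2 ∂(iidLaw P) ≤ δ j ^ 2 := by
    intro a t j
    have hi : Integrable (fun x => innov P (c - t) j (g t a) x ^ 2) (iidLaw P) :=
      integrable_of_abs_le ((measurable_innov _ _ (hgm t a)).pow_const 2)
        (B := (2 * B) ^ 2) fun x => by
          rw [abs_pow]
          exact pow_le_pow_left₀ (abs_nonneg _) (abs_innov_le _ _ (hgB t a) x) 2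
    rw [← ENNReal.ofReal_le_ofReal_iff (sq_nonneg _),
      ofReal_integral_eq_lintegral_ofReal hi (Eventually.of_forall fun x => sq_nonneg _)]
    refine le_trans (lintegral_mono fun x => ?_)
      ((lintegral_iSup_tailMean_sub_le _ (hgm t) (hgB t)).trans (hdep t j))
    rw [← sq_abs, ENNReal.ofReal_pow (abs_nonneg _), ← Real.enorm_eq_ofReal_abs]
    exact pow_le_pow_left' (le_iSup (fun a => ‖tailMean P (c - t - j) (g t a) x -
                    tailMean P (c - t - j + 1) (g t a) x‖ₑ) a) 2
  have hmain : ∫⁻ x, ⨆ a, ‖∑ t ∈ Finset.range N, w t a * shortPart P (c - t) m (g t a) x‖ₑ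
      ∂(iidLaw P) ≤
      ENNReal.ofReal (s⁻¹ * (Real.log (2 * Fintype.card A) + 4 * s ^ 2 * D ^ 2 * W)) := by
    refine lintegral_iSup_le_of_exp_moment (iidLaw P) _ (fun a =>
      Finset.measurable_sum _ fun t _ => (measurable_shortPart _ _ (hgm t a)).const_mul _)
      (β := ∑ t ∈ Finset.range N, κ * (2 * B)) (fun a x =>
        (Finset.abs_sum_le_sum_abs _ _).trans (Finset.sum_le_sum fun t _ => by
          rw [abs_mul]
          exact mul_le_mul (hw _ _) (abs_shortPart_le _ _ (hgB _ _) x) (abs_nonneg _) hκ.le))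
      hs0 (fun a => ?_) fun a => ?_
    · refine integral_exp_sum_shortPart_le c (fun t => g t a) (fun t => w t a) (fun t => hgm t a)
        (fun t => hgB t a) (fun t => hgd t a) (fun t => hw t a) hδ (hQ a) m hD
        (fun t => hwN t a) (hW a) ?_
      rwa [abs_of_pos (by positivity)]
    · have h := integral_exp_sum_shortPart_le c (fun t => g t a) (fun t => w t a)
        (fun t => hgm t a) (fun t => hgB t a) (fun t => hgd t a) (fun t => hw t a) hδ (hQ a) m hD
        (fun t => hwN t a) (hW a) (s := -s) (by
          rw [mul_neg, abs_neg, abs_of_pos (by positivity)]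
          exact hs)
      rwa [neg_sq] at h
  have hrem : ∀ r : ℕ, ∑ j ∈ Finset.range r,
      ∫⁻ x, ⨆ a, ‖∑ t ∈ Finset.range N, w t a * innov P (c - t) (m + 1 + j) (g t a) x‖ₑ
        ∂(iidLaw P) ≤
      ENNReal.ofReal (3 * κ * Real.sqrt (N * Real.log (2 * Fintype.card A)) * D') := fun r => by
    calc _ ≤ ∑ j ∈ Finset.range r, ENNReal.ofReal
          (3 * κ * Real.sqrt (N * Real.log (2 * Fintype.card A)) * δ (m + 1 + j)) :=
          Finset.sum_le_sum fun j _ =>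
            lintegral_iSup_sum_innov_le c g w hgm hgB hw hκ hδ hdep (m + 1 + j) hN
      _ = ENNReal.ofReal (3 * κ * Real.sqrt (N * Real.log (2 * Fintype.card A)) *
          ∑ j ∈ Finset.range r, δ (m + 1 + j)) := by
          rw [Finset.mul_sum, ENNReal.ofReal_sum_of_nonneg fun j _ =>
            mul_nonneg (by positivity) (hδ _).le]
      _ ≤ _ := ENNReal.ofReal_le_ofReal (mul_le_mul_of_nonneg_left (hD' r) (by positivity))
  set tl : ℕ → ℝ≥0∞ := fun r => ∑ a, ∑ t ∈ Finset.range N, ENNReal.ofReal κ *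
    ∫⁻ x, ‖g t a x - tailMean P (c - t - ((m + r : ℕ) : ℤ)) (g t a) x‖ₑ ∂(iidLaw P) with htl
  have htl0 : Tendsto tl atTop (𝓝 0) := by
    have h : Tendsto tl atTop (𝓝 (∑ a : A, ∑ t ∈ Finset.range N, ENNReal.ofReal κ * 0)) := by
      refine tendsto_finsetSum _ fun a _ => tendsto_finsetSum _ fun t _ => ?_
      refine ENNReal.Tendsto.const_mul ?_ (Or.inr ENNReal.ofReal_ne_top)
      exact (tendsto_lintegral_sub_tailMean (P := P) (hgm t a) (hgB t a) (c - t)).comp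
        (tendsto_add_atTop_nat m |>.congr fun r => add_comm r m)
    simpa using h
  have hbound : ∀ r : ℕ,
      ∫⁻ x, ⨆ a, ‖∑ t ∈ Finset.range N, w t a * (g t a x - ∫ y, g t a y ∂(iidLaw P))‖ₑ
        ∂(iidLaw P) ≤
      (ENNReal.ofReal (s⁻¹ * (Real.log (2 * Fintype.card A) + 4 * s ^ 2 * D ^ 2 * W)) +
      ENNReal.ofReal (3 * κ * Real.sqrt (N * Real.log (2 * Fintype.card A)) * D')) + tl r := by
    intro r
    set G₁ : A → (ℤ → S) → ℝ := fun a x =>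
      ∑ t ∈ Finset.range N, w t a * shortPart P (c - t) m (g t a) x with hG₁
    set G₂ : ℕ → A → (ℤ → S) → ℝ := fun j a x =>
      ∑ t ∈ Finset.range N, w t a * innov P (c - t) (m + 1 + j) (g t a) x with hG₂
    set G₃ : A → ℕ → (ℤ → S) → ℝ := fun a t x =>
      g t a x - tailMean P (c - t - ((m + r : ℕ) : ℤ)) (g t a) x with hG₃
    have hG₁m : Measurable fun x => ⨆ a, ‖G₁ a x‖ₑ := Measurable.iSup fun a =>
      (Finset.measurable_sum _ fun t _ => (measurable_shortPart _ _ (hgm t a)).const_mul _).enorm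
    have hG₂m : ∀ j, Measurable fun x => ⨆ a, ‖G₂ j a x‖ₑ := fun j => Measurable.iSup fun a =>
      (Finset.measurable_sum _ fun t _ => (measurable_innov _ _ (hgm t a)).const_mul _).enorm
    have hG₃m : ∀ a t, Measurable fun x => ‖G₃ a t x‖ₑ := fun a t =>
      ((hgm t a).sub (measurable_tailMean _ (hgm t a))).enorm
    have hpt : ∀ x, (⨆ a, ‖∑ t ∈ Finset.range N,
        w t a * (g t a x - ∫ y, g t a y ∂(iidLaw P))‖ₑ) ≤
        (⨆ a, ‖G₁ a x‖ₑ) + (∑ j ∈ Finset.range r, ⨆ a, ‖G₂ j a x‖ₑ) +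
          ∑ a, ∑ t ∈ Finset.range N, ENNReal.ofReal κ * ‖G₃ a t x‖ₑ := by
      intro x
      refine iSup_le fun a => ?_
      have hdec : ∑ t ∈ Finset.range N, w t a * (g t a x - ∫ y, g t a y ∂(iidLaw P)) =
          G₁ a x + (∑ j ∈ Finset.range r, G₂ j a x) +
            ∑ t ∈ Finset.range N, w t a * G₃ a t x := by
        simp only [hG₁, hG₂, hG₃]
        rw [Finset.sum_comm, ← Finset.sum_add_distrib, ← Finset.sum_add_distrib]
        refine Finset.sum_congr rfl fun t _ => ?_
        rw [← Finset.mul_sum, sum_innov, shortPart]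
        have h1 : c - (t : ℤ) - ((m + 1 + r : ℕ) : ℤ) + 1 = c - t - ((m + r : ℕ) : ℤ) := by
          push_cast; ring
        have h2 : c - (t : ℤ) - ((m + 1 : ℕ) : ℤ) + 1 = c - t - m := by push_cast; ring
        rw [h1, h2]
        ring
      rw [hdec]
      refine (enorm_add_le _ _).trans (add_le_add ((enorm_add_le _ _).trans (add_le_add
        (le_iSup (fun a => ‖G₁ a x‖ₑ) a) ((enorm_sum_le _ _).trans
        (Finset.sum_le_sum fun j _ => le_iSup (fun a => ‖G₂ j a x‖ₑ) a)))) ?_)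
      refine ((enorm_sum_le _ _).trans (Finset.sum_le_sum fun t _ => ?_)).trans
        (Finset.single_le_sum (f := fun a => ∑ t ∈ Finset.range N,
          ENNReal.ofReal κ * ‖G₃ a t x‖ₑ) (fun _ _ => zero_le) (Finset.mem_univ a))
      rw [enorm_mul, Real.enorm_eq_ofReal_abs (w t a)]
      exact mul_le_mul' (ENNReal.ofReal_le_ofReal (hw t a)) le_rfl
    refine (lintegral_mono hpt).trans ?_
    have hsum2 : Measurable fun x => ∑ j ∈ Finset.range r, ⨆ a, ‖G₂ j a x‖ₑ :=
      Finset.measurable_sum _ fun j _ => hG₂m j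
    have h12 : Measurable fun x => (⨆ a, ‖G₁ a x‖ₑ) + ∑ j ∈ Finset.range r, ⨆ a, ‖G₂ j a x‖ₑ :=
      hG₁m.add hsum2
    rw [lintegral_add_left h12, lintegral_add_left hG₁m,
      lintegral_finsetSum _ fun j _ => hG₂m j,
      lintegral_finsetSum _ fun a _ => Finset.measurable_sum _ fun t _ =>
        (hG₃m a t).const_mul _]
    refine add_le_add (add_le_add hmain (hrem r)) (Finset.sum_le_sum fun a _ => ?_)
    rw [lintegral_finsetSum _ fun t _ => (hG₃m a t).const_mul _]
    exact Finset.sum_le_sum fun t _ => (lintegral_const_mul' _ _ ENNReal.ofReal_ne_top).le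
  have hlim := tendsto_const_nhds.add htl0 (a := ENNReal.ofReal (s⁻¹ *
    (Real.log (2 * Fintype.card A) + 4 * s ^ 2 * D ^ 2 * W)) +
      ENNReal.ofReal (3 * κ * Real.sqrt (N * Real.log (2 * Fintype.card A)) * D'))
  rw [add_zero] at hlim
  exact ge_of_tendsto' hlim hbound

end Main

end Concentration

/-! ### Classes of functions of polynomial growth -/

section PolyGrowth

lemma l1norm_nonneg {k : ℕ} (z : Fin k → ℝ) : 0 ≤ l1norm z :=
  Finset.sum_nonneg fun _ _ => abs_nonneg _

lemma continuous_l1norm {k : ℕ} : Continuous (l1norm : (Fin k → ℝ) → ℝ) := by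
  unfold l1norm
  fun_prop

lemma measurable_l1norm {k : ℕ} : Measurable (l1norm : (Fin k → ℝ) → ℝ) :=
  continuous_l1norm.measurable

/-- A class of functions `F θ`, `θ ∈ T`, of polynomial growth of order `M`, with polynomially
growing Lipschitz constants in the argument and in the parameter. -/
structure IsPolyClass {k d : ℕ} (T : Set (EuclideanSpace ℝ (Fin d)))
    (F : EuclideanSpace ℝ (Fin d) → (Fin k → ℝ) → ℝ) (M C : ℝ) : Prop where
  one_le : 1 ≤ M
  pos : 0 < C
  lip : ∀ θ ∈ T, ∀ z z', |F θ z - F θ z'| ≤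
    C * (l1norm (z - z') * ((1 + l1norm z ^ (M - 1)) + (1 + l1norm z' ^ (M - 1))))
  zero : ∀ θ ∈ T, |F θ 0| ≤ C
  param : ∀ θ ∈ T, ∀ θ' ∈ T, ∀ z, |F θ z - F θ' z| ≤ C * (1 + l1norm z ^ M) * ‖θ - θ'‖

variable {k d : ℕ} {T : Set (EuclideanSpace ℝ (Fin d))}
  {F : EuclideanSpace ℝ (Fin d) → (Fin k → ℝ) → ℝ} {M C : ℝ}

lemma le_one_add_rpow {x M : ℝ} (hx : 0 ≤ x) (hM : 1 ≤ M) : x ≤ 1 + x ^ M := by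
  rcases le_total x 1 with h | h
  · linarith [Real.rpow_nonneg hx M]
  · have := Real.rpow_le_rpow_of_exponent_le h hM
    rw [Real.rpow_one] at this
    linarith

lemma IsPolyClass.growth (hF : IsPolyClass T F M C) {θ : EuclideanSpace ℝ (Fin d)} (hθ : θ ∈ T)
    (z : Fin k → ℝ) : |F θ z| ≤ 5 * C * (1 + l1norm z ^ M) := by
  have h1 := hF.lip θ hθ z 0
  have h2 := hF.zero θ hθ
  have hl0 : l1norm (0 : Fin k → ℝ) = 0 := by simp [l1norm]
  rw [sub_zero, hl0] at h1
  have hz := l1norm_nonneg z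
  have hM := hF.one_le
  have h0 : (0 : ℝ) ^ (M - 1) ≤ 1 := Real.zero_rpow_le_one _
  have hmul : l1norm z * l1norm z ^ (M - 1) ≤ l1norm z ^ M := by
    rcases hz.eq_or_lt with h | h
    · rw [← h, zero_mul]; exact Real.rpow_nonneg le_rfl _
    · rw [← Real.rpow_one_add' h.le (by linarith)]
      exact le_of_eq (by ring_nf)
  have h3 := le_one_add_rpow hz hM
  have h4 : l1norm z * ((1 + l1norm z ^ (M - 1)) + (1 + 0 ^ (M - 1))) ≤
      3 + 4 * l1norm z ^ M := by
    nlinarith [mul_le_mul_of_nonneg_left h0 hz]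
  have h5 := abs_sub_abs_le_abs_sub (F θ z) (F θ 0)
  have hC := hF.pos
  have h6 := mul_le_mul_of_nonneg_left h4 hC.le
  have h7 := mul_nonneg hC.le (Real.rpow_nonneg hz M)
  nlinarith

lemma IsPolyClass.continuous (hF : IsPolyClass T F M C) {θ : EuclideanSpace ℝ (Fin d)}
    (hθ : θ ∈ T) : Continuous (F θ) := by
  rw [continuous_iff_continuousAt]
  intro z
  have hM : 0 ≤ M - 1 := by linarith [hF.one_le]
  have hc : Continuous fun z' : Fin k → ℝ =>
      C * (l1norm (z' - z) * ((1 + l1norm z' ^ (M - 1)) + (1 + l1norm z ^ (M - 1)))) := by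
    have h1 : Continuous fun z' : Fin k → ℝ => l1norm (z' - z) :=
      continuous_l1norm.comp (continuous_id.sub continuous_const)
    have h2 : Continuous fun z' : Fin k → ℝ => l1norm z' ^ (M - 1) :=
      continuous_l1norm.rpow_const fun _ => Or.inr hM
    fun_prop
  have hlim := hc.tendsto z
  have h0 : l1norm (z - z) = 0 := by simp [l1norm]
  rw [h0, zero_mul, mul_zero] at hlim
  rw [ContinuousAt, tendsto_iff_norm_sub_tendsto_zero]
  exact squeeze_zero (fun _ => norm_nonneg _) (fun z' => hF.lip θ hθ z' z) hlim

lemma IsPolyClass.measurable (hF : IsPolyClass T F M C) {θ : EuclideanSpace ℝ (Fin d)}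
    (hθ : θ ∈ T) : Measurable (F θ) :=
  (hF.continuous hθ).measurable

variable {Ω : Type*} [MeasurableSpace Ω] (μ : Measure Ω)

lemma eLpNorm_l1norm_le {Z : Ω → Fin k → ℝ} (hZ : Measurable Z) {p : ℝ≥0∞} (hp : 1 ≤ p) :
    eLpNorm (fun ω => l1norm (Z ω)) p μ ≤ ∑ i, eLpNorm (fun ω => Z ω i) p μ := by
  have h := eLpNorm_sum_le (μ := μ) (p := p) (s := Finset.univ)
    (f := fun (i : Fin k) ω => ‖Z ω i‖)
    (fun i _ => (((measurable_pi_apply i).comp hZ).norm).aestronglyMeasurable) hp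
  simp only [eLpNorm_norm] at h
  refine le_trans (le_of_eq ?_) h
  congr 1
  funext ω
  simp [l1norm]

lemma eLpNorm_l1norm_le_mul {Z : Ω → Fin k → ℝ} (hZ : Measurable Z) {p : ℝ≥0∞} (hp : 1 ≤ p)
    {c : ℝ} (hZp : ∀ i, eLpNorm (fun ω => Z ω i) p μ ≤ ENNReal.ofReal c) :
    eLpNorm (fun ω => l1norm (Z ω)) p μ ≤ ENNReal.ofReal (k * c) := by
  refine (eLpNorm_l1norm_le μ hZ hp).trans ((Finset.sum_le_sum fun i _ => hZp i).trans ?_)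
  rw [Finset.sum_const, Finset.card_univ, Fintype.card_fin, nsmul_eq_mul,
    ENNReal.ofReal_mul (by positivity), ENNReal.ofReal_natCast]

variable [IsProbabilityMeasure μ]

/-- Hölder's inequality for the increments of functions of polynomial growth. -/
lemma eLpNorm_increment_le {Z Z' : Ω → Fin k → ℝ} (hZ : Measurable Z) (hZ' : Measurable Z')
    (hM : 1 ≤ M) {c : ℝ} (hc : 0 ≤ c)
    (hZp : ∀ i, eLpNorm (fun ω => Z ω i) (ENNReal.ofReal (2 * M)) μ ≤ ENNReal.ofReal c)
    (hZp' : ∀ i, eLpNorm (fun ω => Z' ω i) (ENNReal.ofReal (2 * M)) μ ≤ ENNReal.ofReal c) :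
    eLpNorm (fun ω => l1norm (Z ω - Z' ω) *
      ((1 + l1norm (Z ω) ^ (M - 1)) + (1 + l1norm (Z' ω) ^ (M - 1)))) 2 μ ≤
    ENNReal.ofReal (4 * (1 + 2 * k * c) ^ (M - 1)) *
      ∑ i, eLpNorm (fun ω => Z ω i - Z' ω i) (ENNReal.ofReal (2 * M)) μ := by
  have hM0 : 0 < M := by linarith
  have hp1 : 1 ≤ ENNReal.ofReal (2 * M) := by
    rw [← ENNReal.ofReal_one]
    exact ENNReal.ofReal_le_ofReal (by linarith)
  have hp0 : ENNReal.ofReal (2 * M) ≠ 0 := (zero_lt_one.trans_le hp1).ne'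
  have hpr : (ENNReal.ofReal (2 * M)).toReal = 2 * M := ENNReal.toReal_ofReal (by linarith)
  set D : Ω → ℝ := fun ω => l1norm (Z ω - Z' ω) with hD
  set Y : Ω → ℝ := fun ω => 1 + (l1norm (Z ω) + l1norm (Z' ω)) with hY
  have hDm : Measurable D := measurable_l1norm.comp (hZ.sub hZ')
  have hlm : Measurable fun ω => l1norm (Z ω) := measurable_l1norm.comp hZ
  have hlm' : Measurable fun ω => l1norm (Z' ω) := measurable_l1norm.comp hZ'
  have hYm : Measurable Y := (hlm.add hlm').const_add 1
  have hD0 : ∀ ω, 0 ≤ D ω := fun ω => l1norm_nonneg _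
  have hY1 : ∀ ω, 1 ≤ Y ω := fun ω => by
    have := l1norm_nonneg (Z ω)
    have := l1norm_nonneg (Z' ω)
    simp only [hY]; linarith
  have hpt : ∀ ω, ‖l1norm (Z ω - Z' ω) *
      ((1 + l1norm (Z ω) ^ (M - 1)) + (1 + l1norm (Z' ω) ^ (M - 1)))‖ₑ ^ (2 : ℝ) ≤
      16 * ((‖D ω‖ₑ ^ (2 * M)) ^ (1 / M) * (‖Y ω‖ₑ ^ (2 * M)) ^ ((M - 1) / M)) := by
    intro ω
    have h1 : ∀ x, 0 ≤ x → x ≤ Y ω → 1 + x ^ (M - 1) ≤ 2 * Y ω ^ (M - 1) := fun x hx hxY => by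
      have h := Real.rpow_le_rpow hx hxY (by linarith : (0 : ℝ) ≤ M - 1)
      have h' := Real.one_le_rpow (hY1 ω) (by linarith : (0 : ℝ) ≤ M - 1)
      linarith
    have h2 := h1 (l1norm (Z ω)) (l1norm_nonneg _) (by
      have := l1norm_nonneg (Z' ω); simp only [hY]; linarith)
    have h3 := h1 (l1norm (Z' ω)) (l1norm_nonneg _) (by
      have := l1norm_nonneg (Z ω); simp only [hY]; linarith)
    have hr0 : 0 ≤ l1norm (Z ω) ^ (M - 1) := Real.rpow_nonneg (l1norm_nonneg _) _
    have hr0' : 0 ≤ l1norm (Z' ω) ^ (M - 1) := Real.rpow_nonneg (l1norm_nonneg _) _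
    have h4 : ‖D ω * ((1 + l1norm (Z ω) ^ (M - 1)) + (1 + l1norm (Z' ω) ^ (M - 1)))‖ₑ ≤
        4 * (‖D ω‖ₑ * ‖Y ω‖ₑ ^ (M - 1)) := by
      have hY0 : 0 < Y ω := zero_lt_one.trans_le (hY1 ω)
      rw [Real.enorm_eq_ofReal (hD0 ω), Real.enorm_eq_ofReal hY0.le,
        Real.enorm_eq_ofReal (mul_nonneg (hD0 ω) (by linarith)),
        ENNReal.ofReal_rpow_of_pos hY0, ← ENNReal.ofReal_mul (hD0 ω),
        show (4 : ℝ≥0∞) = ENNReal.ofReal 4 by norm_num, ← ENNReal.ofReal_mul (by norm_num)]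
      refine ENNReal.ofReal_le_ofReal ?_
      nlinarith [mul_le_mul_of_nonneg_left (add_le_add h2 h3) (hD0 ω)]
    calc _ ≤ (4 * (‖D ω‖ₑ * ‖Y ω‖ₑ ^ (M - 1))) ^ (2 : ℝ) := by gcongr
      _ = _ := by
        rw [ENNReal.mul_rpow_of_nonneg _ _ (by norm_num),
          ENNReal.mul_rpow_of_nonneg _ _ (by norm_num), ← ENNReal.rpow_mul, ← ENNReal.rpow_mul,
          ← ENNReal.rpow_mul]
        congr 2
        · norm_num
        · congr 1; field_simp
        · congr 1; field_simp
  have hint : ∫⁻ ω, ‖l1norm (Z ω - Z' ω) *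
      ((1 + l1norm (Z ω) ^ (M - 1)) + (1 + l1norm (Z' ω) ^ (M - 1)))‖ₑ ^ (2 : ℝ) ∂μ ≤
      16 * ((∫⁻ ω, ‖D ω‖ₑ ^ (2 * M) ∂μ) ^ (1 / M) *
        (∫⁻ ω, ‖Y ω‖ₑ ^ (2 * M) ∂μ) ^ ((M - 1) / M)) := by
    refine (lintegral_mono hpt).trans ?_
    rw [lintegral_const_mul' _ _ (by norm_num)]
    refine mul_le_mul' le_rfl ?_
    exact ENNReal.lintegral_mul_norm_pow_le (hDm.enorm.pow_const _).aemeasurable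
      (hYm.enorm.pow_const _).aemeasurable (by positivity)
      (div_nonneg (by linarith) hM0.le) (by field_simp; ring)
  have hYn : eLpNorm Y (ENNReal.ofReal (2 * M)) μ ≤ ENNReal.ofReal (1 + 2 * k * c) := by
    have h1 : eLpNorm (fun ω => l1norm (Z ω) + l1norm (Z' ω)) (ENNReal.ofReal (2 * M)) μ ≤
        ENNReal.ofReal (k * c) + ENNReal.ofReal (k * c) :=
      (eLpNorm_add_le hlm.aestronglyMeasurable hlm'.aestronglyMeasurable hp1).trans
        (add_le_add (eLpNorm_l1norm_le_mul μ hZ hp1 hZp) (eLpNorm_l1norm_le_mul μ hZ' hp1 hZp'))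
    have h2 : eLpNorm Y (ENNReal.ofReal (2 * M)) μ ≤
        eLpNorm (fun _ : Ω => (1 : ℝ)) (ENNReal.ofReal (2 * M)) μ +
        eLpNorm (fun ω => l1norm (Z ω) + l1norm (Z' ω)) (ENNReal.ofReal (2 * M)) μ :=
      eLpNorm_add_le aestronglyMeasurable_const (hlm.add hlm').aestronglyMeasurable hp1
    refine h2.trans ((add_le_add le_rfl h1).trans (le_of_eq ?_))
    rw [eLpNorm_const _ hp0 (IsProbabilityMeasure.ne_zero μ), measure_univ, ENNReal.one_rpow,
      mul_one, enorm_one, ← ENNReal.ofReal_one, ← ENNReal.ofReal_add (by positivity) (by positivity),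
      ← ENNReal.ofReal_add (by positivity) (by positivity)]
    congr 1
    ring
  have hDn : eLpNorm D (ENNReal.ofReal (2 * M)) μ ≤
      ∑ i, eLpNorm (fun ω => Z ω i - Z' ω i) (ENNReal.ofReal (2 * M)) μ :=
    eLpNorm_l1norm_le μ (hZ.sub hZ') hp1
  have hsq : eLpNorm (fun ω => l1norm (Z ω - Z' ω) *
      ((1 + l1norm (Z ω) ^ (M - 1)) + (1 + l1norm (Z' ω) ^ (M - 1)))) 2 μ ≤
      4 * (eLpNorm D (ENNReal.ofReal (2 * M)) μ *
        eLpNorm Y (ENNReal.ofReal (2 * M)) μ ^ (M - 1)) := by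
    rw [eLpNorm_eq_lintegral_rpow_enorm_toReal (by norm_num) (by norm_num),
      eLpNorm_eq_lintegral_rpow_enorm_toReal hp0 ENNReal.ofReal_ne_top,
      eLpNorm_eq_lintegral_rpow_enorm_toReal hp0 ENNReal.ofReal_ne_top, hpr, ENNReal.toReal_ofNat]
    calc _ ≤ (16 * ((∫⁻ ω, ‖D ω‖ₑ ^ (2 * M) ∂μ) ^ (1 / M) *
        (∫⁻ ω, ‖Y ω‖ₑ ^ (2 * M) ∂μ) ^ ((M - 1) / M))) ^ (1 / 2 : ℝ) := by gcongr
      _ = _ := by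
        rw [ENNReal.mul_rpow_of_nonneg _ _ (by norm_num),
          ENNReal.mul_rpow_of_nonneg _ _ (by norm_num), ← ENNReal.rpow_mul, ← ENNReal.rpow_mul,
          ← ENNReal.rpow_mul]
        congr 2
        · rw [show (16 : ℝ≥0∞) = 4 ^ (2 : ℝ) by norm_num, ← ENNReal.rpow_mul]
          norm_num
        · congr 1; field_simp
        · congr 1; field_simp
  refine hsq.trans ?_
  have h1 : (0 : ℝ) < 1 + 2 * k * c := by positivity
  calc _ ≤ 4 * ((∑ i, eLpNorm (fun ω => Z ω i - Z' ω i) (ENNReal.ofReal (2 * M)) μ) *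
        ENNReal.ofReal (1 + 2 * k * c) ^ (M - 1)) := by
        gcongr
    _ = _ := by
        rw [ENNReal.ofReal_rpow_of_pos h1,
          ENNReal.ofReal_mul (p := 4) (q := (1 + 2 * k * c) ^ (M - 1)) (by norm_num),
          show ENNReal.ofReal 4 = (4 : ℝ≥0∞) by norm_num]
        ring

/-- Moments of the envelope of a class of polynomial growth. -/
lemma eLpNorm_one_add_l1norm_rpow_le {Z : Ω → Fin k → ℝ} (hZ : Measurable Z) (hM : 1 ≤ M)
    {q c : ℝ} (hq : 1 ≤ q) (hc : 0 ≤ c)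
    (hZp : ∀ i, eLpNorm (fun ω => Z ω i) (ENNReal.ofReal (q * M)) μ ≤ ENNReal.ofReal c) :
    eLpNorm (fun ω => 1 + l1norm (Z ω) ^ M) (ENNReal.ofReal q) μ ≤
      ENNReal.ofReal (1 + (k * c) ^ M) := by
  have hq1 : 1 ≤ ENNReal.ofReal q := by
    rw [← ENNReal.ofReal_one]
    exact ENNReal.ofReal_le_ofReal hq
  have hlm : Measurable fun ω => l1norm (Z ω) := measurable_l1norm.comp hZ
  have hqM : 1 ≤ ENNReal.ofReal (q * M) := by
    rw [← ENNReal.ofReal_one]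
    exact ENNReal.ofReal_le_ofReal (by nlinarith)
  have h1 : eLpNorm (fun ω => 1 + l1norm (Z ω) ^ M) (ENNReal.ofReal q) μ ≤
      eLpNorm (fun _ : Ω => (1 : ℝ)) (ENNReal.ofReal q) μ +
        eLpNorm (fun ω => l1norm (Z ω) ^ M) (ENNReal.ofReal q) μ :=
    eLpNorm_add_le aestronglyMeasurable_const (hlm.pow_const M).aestronglyMeasurable hq1
  have h2 : eLpNorm (fun ω => l1norm (Z ω) ^ M) (ENNReal.ofReal q) μ =
      eLpNorm (fun ω => l1norm (Z ω)) (ENNReal.ofReal (q * M)) μ ^ M := by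
    rw [ENNReal.ofReal_mul (by linarith), ← eLpNorm_norm_rpow _ (by linarith)]
    congr 1
    funext ω
    rw [Real.norm_of_nonneg (l1norm_nonneg _)]
  refine h1.trans ?_
  rw [eLpNorm_const _ (zero_lt_one.trans_le hq1).ne' (IsProbabilityMeasure.ne_zero μ),
    measure_univ, ENNReal.one_rpow, mul_one, enorm_one, h2,
    ENNReal.ofReal_add zero_le_one (by positivity), ENNReal.ofReal_one]
  refine add_le_add le_rfl ?_
  calc _ ≤ ENNReal.ofReal (k * c) ^ M :=
        ENNReal.rpow_le_rpow (eLpNorm_l1norm_le_mul μ hZ hqM hZp) (by linarith)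
    _ = _ := ENNReal.ofReal_rpow_of_nonneg (by positivity) (by linarith)

end PolyGrowth

/-! ### The array as a function of the innovations -/

section ArrayBound

/-- Truncation of a real number at the levels `±B`. -/
def truncate (B y : ℝ) : ℝ := max (-B) (min y B)

lemma abs_truncate_le {B : ℝ} (hB : 0 ≤ B) (y : ℝ) : |truncate B y| ≤ B :=
  abs_le.2 ⟨le_max_left _ _, max_le (by linarith) (min_le_right _ _)⟩

lemma abs_truncate_sub_le (B y y' : ℝ) : |truncate B y - truncate B y'| ≤ |y - y'| := by
  unfold truncate
  rw [max_comm (-B), max_comm (-B)]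
  refine (abs_max_sub_max_le_abs _ _ _).trans ((abs_min_sub_min_le_max _ _ _ _).trans ?_)
  simp

lemma truncate_eq_self {B y : ℝ} (h : |y| ≤ B) : truncate B y = y := by
  obtain ⟨h1, h2⟩ := abs_le.1 h
  rw [truncate, min_eq_left h2, max_eq_right h1]

lemma measurable_truncate (B : ℝ) : Measurable (truncate B) :=
  measurable_const.max (measurable_id.min measurable_const)

variable {Ω S : Type*} [MeasurableSpace Ω] [MeasurableSpace S] {μ : Measure Ω}
  {ε : ℤ → Ω → S}

lemma measurable_innovPast (hε : ∀ i, Measurable (ε i)) (i : ℤ) : Measurable (innovPast ε i) :=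
  measurable_pi_lambda _ fun _ => hε _

lemma isProbabilityMeasure_innov [IsProbabilityMeasure μ] (hε : IsIIDInnovation μ ε) :
    IsProbabilityMeasure (μ.map (ε 0)) :=
  Measure.isProbabilityMeasure_map (hε.meas 0).aemeasurable

lemma measurePreserving_innov (hε : IsIIDInnovation μ ε) [IsProbabilityMeasure (μ.map (ε 0))] :
    MeasurePreserving (fun ω l => ε l ω) μ (iidLaw (μ.map (ε 0))) := by
  refine ⟨measurable_pi_lambda _ hε.meas, ?_⟩
  rw [hε.indep.map_fun_eq_infinitePi_map hε.meas]
  congr 1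
  funext i
  exact (hε.identDistrib i).map_eq

/-- The process `J_i(𝒢_i)` as a function of the sequence of innovations. -/
def coordProcess (J : ℤ → (ℕ → S) → ℝ) (i : ℤ) (x : ℤ → S) : ℝ :=
  J i (innovPast (fun l (x : ℤ → S) => x l) i x)

variable {J : ℤ → (ℕ → S) → ℝ} {n : ℕ}

lemma measurable_coordProcess {i : ℤ} (hJ : Measurable (J i)) : Measurable (coordProcess J i) :=
  hJ.comp (measurable_innovPast (fun l => measurable_pi_apply l) i)

omit [MeasurableSpace S] in
lemma dependsOn_coordProcess (i : ℤ) : DependsOn (coordProcess J i) (Iic i) := by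
  intro x y h
  have : innovPast (fun l (x : ℤ → S) => x l) i x = innovPast (fun l (x : ℤ → S) => x l) i y :=
    funext fun r => h _ (by simp)
  rw [coordProcess, coordProcess, this]

variable {k : ℕ} [IsProbabilityMeasure μ]

lemma measurable_lagWindow_coordProcess (hJ : ∀ i : ℤ, 1 ≤ i → i ≤ n → Measurable (J i)) {i : ℤ}
    (hki : k ≤ i) (hin : i ≤ n) : Measurable (lagWindow k (coordProcess J) i) :=
  measurable_pi_lambda _ fun m => measurable_coordProcess (hJ _ (by omega) (by omega))

/-- Resampling the innovation at time `i - j` changes the lag `m` of the window by the dependence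
measure at lag `j - m`, and leaves it unchanged for `m > j`. -/
lemma eLpNorm_lagWindow_resample_le (hε : IsIIDInnovation μ ε) [IsProbabilityMeasure (μ.map (ε 0))]
    (hJ : ∀ i : ℤ, 1 ≤ i → i ≤ n → Measurable (J i)) {q : ℝ} {Δ : ℕ → ℝ}
    (hΔ : ∀ j, depMeasure μ ε J n q j ≤ ENNReal.ofReal (Δ j)) {i : ℤ} (hki : k ≤ i) (hin : i ≤ n)
    (j : ℕ) (m : Fin k) :
    eLpNorm (fun p : (ℤ → S) × (ℤ → S) => lagWindow k (coordProcess J) i p.1 m -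
        lagWindow k (coordProcess J) i (resample {i - (j : ℤ)}ᶜ p.1 p.2) m) (ENNReal.ofReal q)
      ((iidLaw (μ.map (ε 0))).prod (iidLaw (μ.map (ε 0)))) ≤
    ENNReal.ofReal (if (m : ℕ) ≤ j then Δ (j - m) else 0) := by
  have hmp := measurePreserving_innov hε
  have hWm := measurable_lagWindow_coordProcess (k := k) hJ hki hin
  have hm : Measurable fun p : (ℤ → S) × (ℤ → S) => lagWindow k (coordProcess J) i p.1 m -
      lagWindow k (coordProcess J) i (resample {i - (j : ℤ)}ᶜ p.1 p.2) m :=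
    ((measurable_pi_apply m).comp (hWm.comp measurable_fst)).sub
      ((measurable_pi_apply m).comp (hWm.comp (measurable_resample _)))
  rw [← eLpNorm_comp_measurePreserving hm.aestronglyMeasurable (hmp.prod hmp)]
  split_ifs with hmj
  · refine le_trans ?_ (hΔ (j - m))
    refine le_trans (le_of_eq ?_) (le_iSup₂_of_le (i - (m : ℕ)) ⟨by omega, by omega⟩ le_rfl)
    congr 1
    funext p
    change J (i - (m : ℕ)) _ - J (i - (m : ℕ)) _ = J (i - (m : ℕ)) _ - J (i - (m : ℕ)) _
    congr 2
    funext r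
    have hpast : innovPast (fun l (x : ℤ → S) => x l) (i - (m : ℕ)) (resample {i - (j : ℤ)}ᶜ
        (fun l => ε l p.1) fun l => ε l p.2) r = coupledPast ε (i - (m : ℕ)) (j - m) p r := by
      rw [coupledPast]
      by_cases hr : r = j - m
      · have hnot : i - (m : ℕ) - (r : ℤ) ∉ ({i - (j : ℤ)}ᶜ : Set ℤ) := by
          rw [mem_compl_iff, mem_singleton_iff]
          omega
        subst hr
        rw [Function.update_self, innovPast, resample_of_notMem hnot]
      · have hmem : i - (m : ℕ) - (r : ℤ) ∈ ({i - (j : ℤ)}ᶜ : Set ℤ) := by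
          rw [mem_compl_iff, mem_singleton_iff]
          omega
        rw [Function.update_of_ne hr, innovPast, resample_of_mem hmem, innovPast]
    exact hpast
  · refine le_of_eq ?_
    rw [ENNReal.ofReal_zero]
    convert eLpNorm_zero using 2
    funext p
    simp only [Function.comp, Prod.map, lagWindow, Pi.zero_apply, sub_eq_zero]
    refine (dependsOn_coordProcess (J := J) (i - (m : ℕ))) fun l hl => ?_
    rw [resample_of_mem]
    simp only [mem_compl_iff, mem_singleton_iff]
    simp only [mem_Iic] at hl
    omega

/-- The dependence coefficients of functions of polynomial growth of a window of length `k`. -/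
noncomputable def windowDep (k : ℕ) (M c : ℝ) (C : ℝ) (Δ : ℕ → ℝ) (j : ℕ) : ℝ :=
  C * (4 * (1 + 2 * k * c) ^ (M - 1)) * ∑ m : Fin k, if (m : ℕ) ≤ j then Δ (j - m) else 0

lemma windowDep_pos (hk : 1 ≤ k) {M c C : ℝ} (hc : 0 ≤ c) (hC : 0 < C) {Δ : ℕ → ℝ}
    (hΔ : ∀ j, 0 < Δ j) (j : ℕ) : 0 < windowDep k M c C Δ j := by
  have h1 : 0 < (1 + 2 * k * c) ^ (M - 1) := Real.rpow_pos_of_pos (by positivity) _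
  have h2 : ∀ m : Fin k, 0 ≤ if (m : ℕ) ≤ j then Δ (j - m) else 0 := fun m => by
    split_ifs
    · exact (hΔ _).le
    · exact le_rfl
  have h3 : 0 < ∑ m : Fin k, if (m : ℕ) ≤ j then Δ (j - m) else 0 :=
    Finset.sum_pos' (fun m _ => h2 m) ⟨⟨0, hk⟩, Finset.mem_univ _, by simpa using hΔ j⟩
  unfold windowDep
  positivity

variable {d : ℕ} {T : Set (EuclideanSpace ℝ (Fin d))}
  {F : EuclideanSpace ℝ (Fin d) → (Fin k → ℝ) → ℝ} {M C c : ℝ}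

/-- Uniform dependence bound for the truncated functions of the window. -/
lemma lintegral_iSup_truncate_resample_le (hε : IsIIDInnovation μ ε)
    [IsProbabilityMeasure (μ.map (ε 0))]
    (hJ : ∀ i : ℤ, 1 ≤ i → i ≤ n → Measurable (J i)) (hc : 0 ≤ c)
    (hmom : ∀ i : ℤ, 1 ≤ i → i ≤ n → eLpNorm (fun ω => J i (innovPast ε i ω))
      (ENNReal.ofReal (2 * M)) μ ≤ ENNReal.ofReal c)
    (hF : IsPolyClass T F M C) {Δ : ℕ → ℝ} (hΔ0 : ∀ j, 0 < Δ j)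
    (hΔ : ∀ j, depMeasure μ ε J n (2 * M) j ≤ ENNReal.ofReal (Δ j))
    {A : Type*} [Fintype A] (θ : A → EuclideanSpace ℝ (Fin d)) (hθ : ∀ a, θ a ∈ T) (B : ℝ)
    (hk : 1 ≤ k) {i : ℤ} (hki : k ≤ i) (hin : i ≤ n) (j : ℕ) :
    ∫⁻ p, (⨆ a, ‖truncate B (F (θ a) (lagWindow k (coordProcess J) i p.1)) -
        truncate B (F (θ a) (lagWindow k (coordProcess J) i
          (resample {i - (j : ℤ)}ᶜ p.1 p.2)))‖ₑ) ^ 2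
      ∂((iidLaw (μ.map (ε 0))).prod (iidLaw (μ.map (ε 0)))) ≤
    ENNReal.ofReal (windowDep k M c C Δ j ^ 2) := by
  set ρ := (iidLaw (μ.map (ε 0))).prod (iidLaw (μ.map (ε 0))) with hρ
  have hmp := measurePreserving_innov hε
  have hWm := measurable_lagWindow_coordProcess (k := k) hJ hki hin
  set Z : (ℤ → S) × (ℤ → S) → Fin k → ℝ := fun p => lagWindow k (coordProcess J) i p.1 with hZ
  set Z' : (ℤ → S) × (ℤ → S) → Fin k → ℝ := fun p => lagWindow k (coordProcess J) i
          (resample {i - (j : ℤ)}ᶜ p.1 p.2) with hZ'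
  have hZm : Measurable Z := hWm.comp measurable_fst
  have hZm' : Measurable Z' := hWm.comp (measurable_resample _)
  have hmom0 : ∀ m : Fin k, eLpNorm (fun x => lagWindow k (coordProcess J) i x m)
      (ENNReal.ofReal (2 * M)) (iidLaw (μ.map (ε 0))) ≤ ENNReal.ofReal c := fun m => by
    have := eLpNorm_comp_measurePreserving (p := ENNReal.ofReal (2 * M))
        ((measurable_pi_apply m).comp hWm).aestronglyMeasurable hmp
    refine this.symm.le.trans ?_
    exact hmom (i - (m : ℕ)) (by omega) (by omega)
  have hmom1 : ∀ m, eLpNorm (fun p => Z p m) (ENNReal.ofReal (2 * M)) ρ ≤ ENNReal.ofReal c :=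
    fun m => by
      have := eLpNorm_comp_measurePreserving (p := ENNReal.ofReal (2 * M))
        ((measurable_pi_apply m).comp hWm).aestronglyMeasurable
        (measurePreserving_fst (μ := iidLaw (μ.map (ε 0))) (ν := iidLaw (μ.map (ε 0))))
      exact this.le.trans (hmom0 m)
  have hmom2 : ∀ m, eLpNorm (fun p => Z' p m) (ENNReal.ofReal (2 * M)) ρ ≤ ENNReal.ofReal c :=
    fun m => by
      have := eLpNorm_comp_measurePreserving (p := ENNReal.ofReal (2 * M))
        ((measurable_pi_apply m).comp hWm).aestronglyMeasurable
        (measurePreserving_resample (μ.map (ε 0)) {i - (j : ℤ)}ᶜ)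
      exact this.le.trans (hmom0 m)
  have hinc := eLpNorm_increment_le ρ hZm hZm' hF.one_le hc hmom1 hmom2
  set H : (ℤ → S) × (ℤ → S) → ℝ := fun p => l1norm (Z p - Z' p) *
      ((1 + l1norm (Z p) ^ (M - 1)) + (1 + l1norm (Z' p) ^ (M - 1))) with hH
  have hsum : ∑ m : Fin k, eLpNorm (fun p => Z p m - Z' p m) (ENNReal.ofReal (2 * M)) ρ ≤
      ENNReal.ofReal (∑ m : Fin k, if (m : ℕ) ≤ j then Δ (j - m) else 0) := by
    rw [ENNReal.ofReal_sum_of_nonneg fun m _ => by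
      split_ifs
      · exact (hΔ0 _).le
      · exact le_rfl]
    exact Finset.sum_le_sum fun m _ => eLpNorm_lagWindow_resample_le hε hJ hΔ hki hin j m
  have hr : 0 ≤ 4 * (1 + 2 * k * c) ^ (M - 1) :=
    mul_nonneg (by norm_num) (Real.rpow_nonneg (by positivity) _)
  have hCH : ENNReal.ofReal C * eLpNorm H 2 ρ ≤ ENNReal.ofReal (windowDep k M c C Δ j) := by
    rw [windowDep, mul_assoc, ENNReal.ofReal_mul hF.pos.le, ENNReal.ofReal_mul hr]
    exact mul_le_mul' le_rfl (hinc.trans (mul_le_mul' le_rfl hsum))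
  have hpt : ∀ p, (⨆ a, ‖truncate B (F (θ a) (Z p)) - truncate B (F (θ a) (Z' p))‖ₑ) ^ 2 ≤
      ENNReal.ofReal C ^ 2 * ‖H p‖ₑ ^ (2 : ℝ) := fun p => by
    rw [ENNReal.rpow_ofNat, ← mul_pow]
    refine pow_le_pow_left' (iSup_le fun a => ?_) 2
    rw [Real.enorm_eq_ofReal_abs, Real.enorm_eq_ofReal_abs, ← ENNReal.ofReal_mul hF.pos.le]
    refine ENNReal.ofReal_le_ofReal (((abs_truncate_sub_le _ _ _).trans
      (hF.lip _ (hθ a) _ _)).trans ?_)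
    exact mul_le_mul_of_nonneg_left (le_abs_self _) hF.pos.le
  calc _ ≤ ∫⁻ p, ENNReal.ofReal C ^ 2 * ‖H p‖ₑ ^ (2 : ℝ) ∂ρ := lintegral_mono hpt
    _ = (ENNReal.ofReal C * eLpNorm H 2 ρ) ^ 2 := by
      rw [lintegral_const_mul' _ _ (by simp), mul_pow,
        eLpNorm_eq_lintegral_rpow_enorm_toReal (by norm_num) (by norm_num), ENNReal.toReal_ofNat,
        ← ENNReal.rpow_natCast (_ ^ (1 / 2 : ℝ)), ← ENNReal.rpow_mul]
      norm_num
    _ ≤ ENNReal.ofReal (windowDep k M c C Δ j) ^ 2 := pow_le_pow_left' hCH 2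
    _ = _ := (ENNReal.ofReal_pow
      (windowDep_pos hk hc hF.pos hΔ0 j).le 2).symm

lemma sum_Icc_eq_sum_range (hkn : k ≤ n) (f : ℤ → ℝ) :
    ∑ i ∈ Finset.Icc (k : ℤ) n, f i = ∑ t ∈ Finset.range (n + 1 - k), f ((n : ℤ) - t) := by
  refine Finset.sum_nbij' (fun i => ((n : ℤ) - i).toNat) (fun t => (n : ℤ) - t) ?_ ?_ ?_ ?_ ?_
  · intro i hi
    simp only [Finset.mem_Icc, Finset.mem_range] at hi ⊢
    omega
  · intro t ht
    simp only [Finset.mem_Icc, Finset.mem_range] at ht ⊢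
    omega
  · intro i hi
    simp only [Finset.mem_Icc] at hi
    omega
  · intro t ht
    omega
  · intro i hi
    simp only [Finset.mem_Icc] at hi
    congr 1
    omega

/-- Concentration of weighted sums of truncated functions of the windows, uniformly over a finite
set of weights and functions. -/
theorem lintegral_iSup_truncate_le (hε : IsIIDInnovation μ ε)
    (hJ : ∀ i : ℤ, 1 ≤ i → i ≤ n → Measurable (J i)) (hc : 0 ≤ c)
    (hmom : ∀ i : ℤ, 1 ≤ i → i ≤ n → eLpNorm (fun ω => J i (innovPast ε i ω))
      (ENNReal.ofReal (2 * M)) μ ≤ ENNReal.ofReal c)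
    (hF : IsPolyClass T F M C) {Δ : ℕ → ℝ} (hΔ0 : ∀ j, 0 < Δ j)
    (hΔ : ∀ j, depMeasure μ ε J n (2 * M) j ≤ ENNReal.ofReal (Δ j))
    (hk : 1 ≤ k) (hkn : k ≤ n)
    {A : Type*} [Fintype A] [Nonempty A] (θ : A → EuclideanSpace ℝ (Fin d)) (hθ : ∀ a, θ a ∈ T)
    {B : ℝ} (hB : 0 ≤ B) (w : ℤ → A → ℝ) {κ : ℝ} (hκ : 0 < κ) (hw : ∀ i a, |w i a| ≤ κ)
    {W : ℝ} (hW : ∀ a, ∑ i ∈ Finset.Icc (k : ℤ) n, w i a ^ 2 ≤ W)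
    (m : ℕ) {D : ℝ} (hD : ∑ j ∈ Finset.range (m + 1), windowDep k M c C Δ j ≤ D)
    {D' : ℝ} (hD' : ∀ r, ∑ j ∈ Finset.range r, windowDep k M c C Δ (m + 1 + j) ≤ D')
    {s : ℝ} (hs0 : 0 < s) (hs : 2 * s * ((m + 1) * (κ * (2 * B))) ≤ 1) :
    ∫⁻ ω, ⨆ a, ‖∑ i ∈ Finset.Icc (k : ℤ) n, w i a *
        (truncate B (F (θ a) (lagWindow k (fun i ω => J i (innovPast ε i ω)) i ω)) -
          ∫ ω', truncate B (F (θ a) (lagWindow k (fun i ω => J i (innovPast ε i ω)) i ω')) ∂μ)‖ₑ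
        ∂μ ≤
      ENNReal.ofReal (s⁻¹ * (Real.log (2 * Fintype.card A) + 4 * s ^ 2 * D ^ 2 * W)) +
      ENNReal.ofReal (3 * κ * Real.sqrt (n * Real.log (2 * Fintype.card A)) * D') := by
  have := isProbabilityMeasure_innov hε
  have hmp := measurePreserving_innov hε
  set P := μ.map (ε 0) with hP
  set N := n + 1 - k with hN
  have hcard : (1 : ℝ) ≤ Fintype.card A := by exact_mod_cast Fintype.card_pos
  have hlog : 0 ≤ Real.log (2 * Fintype.card A) := Real.log_nonneg (by linarith)
  set g : ℕ → A → (ℤ → S) → ℝ := fun t a x =>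
    if t < N then truncate B (F (θ a) (lagWindow k (coordProcess J) ((n : ℤ) - t) x)) else 0
    with hg
  have hgt : ∀ t, t < N → ∀ a, g t a =
      fun x => truncate B (F (θ a) (lagWindow k (coordProcess J) ((n : ℤ) - t) x)) :=
    fun t ht a => funext fun x => if_pos ht
  have hgt' : ∀ t, ¬ t < N → ∀ a, g t a = fun _ => 0 :=
    fun t ht a => funext fun x => if_neg ht
  have hgm : ∀ t a, Measurable (g t a) := fun t a => by
    by_cases ht : t < N
    · rw [hgt t ht]
      exact (measurable_truncate B).comp ((hF.measurable (hθ a)).comp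
        (measurable_lagWindow_coordProcess hJ (by omega) (by omega)))
    · rw [hgt' t ht]
      exact measurable_const
  have hgB : ∀ t a x, |g t a x| ≤ B := fun t a x => by
    by_cases ht : t < N
    · rw [hgt t ht]
      exact abs_truncate_le hB _
    · rw [hgt' t ht]
      simpa using hB
  have hgd : ∀ t a, DependsOn (g t a) (Iic ((n : ℤ) - t)) := fun t a => by
    by_cases ht : t < N
    · rw [hgt t ht]
      intro x y hxy
      have : lagWindow k (coordProcess J) ((n : ℤ) - t) x =
          lagWindow k (coordProcess J) ((n : ℤ) - t) y := funext fun r =>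
        ((dependsOn_coordProcess (J := J) ((n : ℤ) - t - (r : ℕ))).mono
          (Iic_subset_Iic.2 (by omega))) hxy
      simp only [this]
    · rw [hgt' t ht]
      exact fun _ _ _ => rfl
  have hdep : ∀ t j : ℕ, ∫⁻ p,
      (⨆ a, ‖g t a p.1 - g t a (resample {(n : ℤ) - t - (j : ℤ)}ᶜ p.1 p.2)‖ₑ) ^ 2
      ∂((iidLaw P).prod (iidLaw P)) ≤ ENNReal.ofReal (windowDep k M c C Δ j ^ 2) := fun t j => by
    by_cases ht : t < N
    · simp only [hgt t ht]
      exact lintegral_iSup_truncate_resample_le hε hJ hc hmom hF hΔ0 hΔ θ hθ B hk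
        (by omega) (by omega) j
    · simp only [hgt' t ht]
      simp
  set w' : ℕ → A → ℝ := fun t a => if t < N then w ((n : ℤ) - t) a else 0 with hw'
  have hsumw : ∀ a (f : ℕ → ℝ), ∑ t ∈ Finset.range N, w' t a * f t =
      ∑ t ∈ Finset.range N, w ((n : ℤ) - t) a * f t := fun a f =>
    Finset.sum_congr rfl fun t ht => by simp only [hw', if_pos (Finset.mem_range.1 ht)]
  have hmain := lintegral_iSup_sum_sub_integral_le (P := P) (n : ℤ) g w' hgm hgB hgd (κ := κ)
    (fun t a => by
      simp only [hw']
      split_ifs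
      · exact hw _ _
      · simpa using hκ.le) hκ (windowDep_pos hk hc hF.pos hΔ0) hdep (N := N) (by omega)
    (fun t a ht => if_neg (by omega)) (W := W)
    (fun a => by
      refine le_trans (le_of_eq ?_) (hW a)
      rw [sum_Icc_eq_sum_range hkn]
      exact Finset.sum_congr rfl fun t ht => by
        simp only [hw']
        rw [if_pos (Finset.mem_range.1 ht)])
    m hD hD' hs0 hs
  have hint : ∀ t, t < N → ∀ a, ∫ y, g t a y ∂(iidLaw P) = ∫ ω', truncate B (F (θ a)
      (lagWindow k (fun i ω => J i (innovPast ε i ω)) ((n : ℤ) - t) ω')) ∂μ := fun t ht a => by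
    rw [← hmp.map_eq, integral_map hmp.measurable.aemeasurable (hgm t a).aestronglyMeasurable]
    simp only [hgt t ht]
    rfl
  have hmeas : Measurable fun x => ⨆ a, ‖∑ t ∈ Finset.range N,
      w' t a * (g t a x - ∫ y, g t a y ∂(iidLaw P))‖ₑ :=
    Measurable.iSup fun a => (Finset.measurable_sum _ fun t _ =>
      ((hgm t a).sub_const _).const_mul _).enorm
  calc _ = ∫⁻ x, ⨆ a, ‖∑ t ∈ Finset.range N, w' t a * (g t a x - ∫ y, g t a y ∂(iidLaw P))‖ₑ
        ∂(iidLaw P) := by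
        rw [← hmp.map_eq, lintegral_map (by rw [hmp.map_eq]; exact hmeas) hmp.measurable]
        refine lintegral_congr fun ω => ?_
        congr 1
        funext a
        rw [hmp.map_eq, sum_Icc_eq_sum_range hkn, hsumw]
        congr 1
        refine Finset.sum_congr rfl fun t ht => ?_
        rw [hint t (Finset.mem_range.1 ht), hgt t (Finset.mem_range.1 ht)]
        rfl
    _ ≤ _ := hmain.trans (add_le_add le_rfl (ENNReal.ofReal_le_ofReal ?_))
  have hD0 : 0 ≤ D' := by simpa using hD' 0
  have hNn : (N : ℝ) ≤ n := by exact_mod_cast (by omega : N ≤ n)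
  gcongr

end ArrayBound

/-! ### Kernel weights and covering numbers -/

section KernelWeights

lemma IsLocKernel.eq_zero {K : ℝ → ℝ} (hK : IsLocKernel K) {x : ℝ} (hx : 1 / 2 < |x|) :
    K x = 0 := by
  by_contra hne
  have h := hK.support_subset (Function.mem_support.2 hne)
  exact absurd (abs_le.2 ⟨h.1, h.2⟩) (not_le.2 hx)

/-- A window of width `h` contains at most `n h + 1` of the design points `i / n`. -/
lemma card_window_le {n : ℕ} (hn : 0 < n) {h : ℝ} (hh : 0 < h) (v : ℝ) (I : Finset ℤ) :
    ((I.filter fun i : ℤ => |((i : ℝ) / n - v) / h| ≤ 1 / 2).card : ℝ) ≤ n * h + 1 := by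
  have hn' : (0 : ℝ) < n := by exact_mod_cast hn
  set a := (n : ℝ) * (v - h / 2)
  set b := (n : ℝ) * (v + h / 2)
  have hsub : (I.filter fun i : ℤ => |((i : ℝ) / n - v) / h| ≤ 1 / 2) ⊆
      Finset.Icc ⌈a⌉ ⌊b⌋ := by
    intro i hi
    have hi' := (Finset.mem_filter.1 hi).2
    rw [abs_le, le_div_iff₀ hh, div_le_iff₀ hh] at hi'
    have h1 : v - h / 2 ≤ (i : ℝ) / n := by linarith [hi'.1]
    have h2 : (i : ℝ) / n ≤ v + h / 2 := by linarith [hi'.2]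
    rw [le_div_iff₀ hn'] at h1
    rw [div_le_iff₀ hn'] at h2
    rw [Finset.mem_Icc, Int.ceil_le, Int.le_floor]
    constructor
    · show (n : ℝ) * (v - h / 2) ≤ i; linarith
    · show (i : ℝ) ≤ n * (v + h / 2); linarith
  have hcard := Finset.card_le_card hsub
  rw [Int.card_Icc] at hcard
  have hle : ((⌊b⌋ + 1 - ⌈a⌉).toNat : ℝ) ≤ n * h + 1 := by
    rcases le_total 0 (⌊b⌋ + 1 - ⌈a⌉) with h0 | h0
    · have : ((⌊b⌋ + 1 - ⌈a⌉).toNat : ℝ) = ((⌊b⌋ + 1 - ⌈a⌉ : ℤ) : ℝ) := by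
        exact_mod_cast congrArg (Int.cast (R := ℝ)) (Int.toNat_of_nonneg h0)
      rw [this]
      push_cast
      have h1 := Int.floor_le b
      have h2 := Int.le_ceil a
      have h3 : b - a = n * h := by simp only [a, b]; ring
      linarith
    · rw [Int.toNat_of_nonpos h0]
      simp only [Nat.cast_zero]
      positivity
  exact le_trans (by exact_mod_cast hcard) hle

/-- Sums of functions of the kernel weights only involve the design points in a window. -/
lemma sum_kernel_le {K : ℝ → ℝ} (hK : IsLocKernel K) {n : ℕ} (hn : 0 < n) {h : ℝ} (hh : 0 < h)
    (v : ℝ) (I : Finset ℤ) {f : ℝ → ℝ} (hf0 : f 0 = 0) {b : ℝ} (hf : ∀ x, f (K x) ≤ b)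
    (hb : 0 ≤ b) :
    ∑ i ∈ I, f (K (((i : ℝ) / n - v) / h)) ≤ b * (n * h + 1) := by
  have h1 : ∑ i ∈ I, f (K (((i : ℝ) / n - v) / h)) =
      ∑ i ∈ I.filter (fun i : ℤ => |((i : ℝ) / n - v) / h| ≤ 1 / 2),
        f (K (((i : ℝ) / n - v) / h)) := by
    refine (Finset.sum_filter_of_ne fun i _ hne => ?_).symm
    by_contra hlt
    exact hne (by rw [hK.eq_zero (not_le.1 hlt), hf0])
  rw [h1]
  refine (Finset.sum_le_card_nsmul _ _ b fun i _ => hf _).trans ?_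
  rw [nsmul_eq_mul, mul_comm]
  exact mul_le_mul_of_nonneg_left (card_window_le hn hh v I) hb

/-- A bounded subset of `ℝ^d` has an `O(1/s)`-net of cardinality `O(s^d)`. -/
lemma exists_finset_net {d : ℕ} {T : Set (EuclideanSpace ℝ (Fin d))}
    (hT : Bornology.IsBounded T) : ∃ C : ℝ, 1 ≤ C ∧ ∀ s : ℝ, 1 ≤ s →
      ∃ G : Finset (EuclideanSpace ℝ (Fin d)), ↑G ⊆ T ∧
        (∀ θ ∈ T, ∃ θ' ∈ G, ‖θ - θ'‖ ≤ d / s) ∧ (G.card : ℝ) ≤ (C * s) ^ d := by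
  classical
  obtain ⟨ρ, hρ⟩ := hT.exists_norm_le
  set R := max ρ 0 with hR
  have hR0 : 0 ≤ R := le_max_right _ _
  refine ⟨2 * R + 3, by linarith, fun s hs => ?_⟩
  have hs0 : 0 < s := by linarith
  set cell : EuclideanSpace ℝ (Fin d) → Fin d → ℤ := fun θ i => ⌊θ i * s⌋ with hcell
  set box : Finset (Fin d → ℤ) := Fintype.piFinset fun _ => Finset.Icc (-⌈R * s⌉) ⌈R * s⌉ with hbox
  have hmem : ∀ θ ∈ T, cell θ ∈ box := fun θ hθ => by
    rw [hbox, Fintype.mem_piFinset]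
    intro i
    have h1 : |θ i| ≤ R := by
      have := PiLp.norm_apply_le θ i
      exact (this.trans (hρ θ hθ)).trans (le_max_left _ _)
    have h2 := abs_le.1 h1
    have h3 : (R * s) ≤ ⌈R * s⌉ := Int.le_ceil _
    rw [Finset.mem_Icc]
    constructor
    · rw [hcell, Int.le_floor]
      push_cast
      nlinarith
    · have h4 : ((cell θ i : ℤ) : ℝ) ≤ θ i * s := Int.floor_le _
      have h5 : ((cell θ i : ℤ) : ℝ) ≤ (⌈R * s⌉ : ℤ) := by nlinarith
      exact_mod_cast h5
  set used := box.filter fun q => ∃ θ ∈ T, cell θ = q with hused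
  have hch : ∀ q : Fin d → ℤ, ∃ θ, (∃ θ ∈ T, cell θ = q) → θ ∈ T ∧ cell θ = q := fun q => by
    by_cases h : ∃ θ ∈ T, cell θ = q
    · obtain ⟨θ, h1, h2⟩ := h
      exact ⟨θ, fun _ => ⟨h1, h2⟩⟩
    · exact ⟨0, fun h' => absurd h' h⟩
  choose rep hrep using hch
  refine ⟨used.image rep, ?_, ?_, ?_⟩
  · intro θ hθ
    obtain ⟨q, hq, rfl⟩ := Finset.mem_image.1 (Finset.mem_coe.1 hθ)
    exact (hrep q (Finset.mem_filter.1 hq).2).1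
  · intro θ hθ
    have hex : ∃ θ' ∈ T, cell θ' = cell θ := ⟨θ, hθ, rfl⟩
    refine ⟨rep (cell θ), Finset.mem_image_of_mem _ (Finset.mem_filter.2 ⟨hmem θ hθ, hex⟩), ?_⟩
    have heq := (hrep (cell θ) hex).2
    have hcoord : ∀ i, ‖(θ - rep (cell θ)) i‖ ≤ 1 / s := fun i => by
      have h1 : ⌊(rep (cell θ)) i * s⌋ = ⌊θ i * s⌋ := congrFun heq i
      have h2 := Int.abs_sub_lt_one_of_floor_eq_floor h1.symm
      rw [← sub_mul, abs_mul, abs_of_pos hs0] at h2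
      rw [le_div_iff₀ hs0]
      exact h2.le
    calc ‖θ - rep (cell θ)‖ ≤ ∑ i, ‖(θ - rep (cell θ)) i‖ := by
          rw [EuclideanSpace.norm_eq]
          refine Real.sqrt_le_iff.2 ⟨Finset.sum_nonneg fun i _ => norm_nonneg _, ?_⟩
          exact Finset.sum_sq_le_sq_sum_of_nonneg fun i _ => norm_nonneg _
      _ ≤ ∑ _i : Fin d, 1 / s := Finset.sum_le_sum fun i _ => hcoord i
      _ = d / s := by simp [div_eq_mul_inv]
  · have h1 : (used.image rep).card ≤ box.card :=
      Finset.card_image_le.trans (Finset.card_le_card (Finset.filter_subset _ _))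
    have h2 : box.card = (⌈R * s⌉ + 1 - -⌈R * s⌉).toNat ^ d := by
      simp [hbox, Int.card_Icc]
    have h3 : ((⌈R * s⌉ + 1 - -⌈R * s⌉).toNat : ℝ) ≤ (2 * R + 3) * s := by
      have hc0 : 0 ≤ ⌈R * s⌉ := Int.ceil_nonneg (by positivity)
      have h4 : ((⌈R * s⌉ + 1 - -⌈R * s⌉).toNat : ℝ) = ((⌈R * s⌉ + 1 - -⌈R * s⌉ : ℤ) : ℝ) := by
        exact_mod_cast congrArg (Int.cast (R := ℝ)) (Int.toNat_of_nonneg (by omega))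
      rw [h4]
      push_cast
      have := Int.ceil_lt_add_one (R * s)
      nlinarith
    calc ((used.image rep).card : ℝ) ≤ box.card := by exact_mod_cast h1
      _ = ((⌈R * s⌉ + 1 - -⌈R * s⌉).toNat : ℝ) ^ d := by rw [h2]; push_cast; rfl
      _ ≤ _ := by gcongr

end KernelWeights

/-! ### Truncation and tail bounds -/

section Tails

variable {Ω : Type*} [MeasurableSpace Ω] {μ : Measure Ω}

/-- Markov's inequality for the moment of order `q`. -/
lemma measure_lt_le_of_eLpNorm {Y : Ω → ℝ} (hY : Measurable Y) {q c B : ℝ} (hq : 0 < q)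
    (hc : 0 ≤ c) (hB : 0 < B) (hYq : eLpNorm Y (ENNReal.ofReal q) μ ≤ ENNReal.ofReal c) :
    μ {ω | B < Y ω} ≤ ENNReal.ofReal ((c / B) ^ q) := by
  have h := meas_ge_le_mul_pow_eLpNorm_enorm μ (p := ENNReal.ofReal q)
    (ENNReal.ofReal_pos.2 hq).ne' ENNReal.ofReal_ne_top hY.aestronglyMeasurable
    (ε := ENNReal.ofReal B) (ENNReal.ofReal_pos.2 hB).ne' (by simp)
  rw [ENNReal.toReal_ofReal hq.le] at h
  refine (measure_mono fun ω hω => ?_).trans (h.trans ?_)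
  · show ENNReal.ofReal B ≤ ‖Y ω‖ₑ
    rw [Real.enorm_eq_ofReal_abs]
    exact ENNReal.ofReal_le_ofReal ((le_of_lt hω).trans (le_abs_self _))
  · calc _ ≤ (ENNReal.ofReal B)⁻¹ ^ q * ENNReal.ofReal c ^ q := by gcongr
      _ = _ := by
        rw [← ENNReal.mul_rpow_of_nonneg _ _ hq.le, ← ENNReal.ofReal_inv_of_pos hB,
          ← ENNReal.ofReal_mul (by positivity),
          ENNReal.ofReal_rpow_of_nonneg (by positivity) hq.le]
        congr 2
        field_simp

lemma measure_lt_le_of_lintegral {Y : Ω → ℝ≥0∞} (hY : Measurable Y) {c η : ℝ} (hη : 0 < η)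
    (hc : 0 < c) (h : ∫⁻ ω, Y ω ∂μ ≤ ENNReal.ofReal c) :
    μ {ω | ENNReal.ofReal (c / η) < Y ω} ≤ ENNReal.ofReal η := by
  have h1 := (mul_meas_ge_le_lintegral (μ := μ) hY (ENNReal.ofReal (c / η))).trans h
  have h2 : μ {ω | ENNReal.ofReal (c / η) ≤ Y ω} ≤ ENNReal.ofReal c / ENNReal.ofReal (c / η) := by
    rw [ENNReal.le_div_iff_mul_le (Or.inl (ENNReal.ofReal_pos.2 (by positivity)).ne')
      (Or.inl ENNReal.ofReal_ne_top), mul_comm]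
    exact h1
  have h3 : {ω | ENNReal.ofReal (c / η) < Y ω} ⊆ {ω | ENNReal.ofReal (c / η) ≤ Y ω} :=
    fun ω (hω : ENNReal.ofReal (c / η) < Y ω) => hω.le
  refine (measure_mono h3).trans (h2.trans (le_of_eq ?_))
  rw [← ENNReal.ofReal_div_of_pos (by positivity)]
  congr 1
  field_simp

/-- The effect of truncation on a variable with a dominating moment of order `q`. -/
lemma abs_sub_truncate_le {y e B q : ℝ} (hB : 0 < B) (hq : 1 ≤ q) (hy : |y| ≤ e) :
    |y - truncate B y| ≤ e ^ q / B ^ (q - 1) := by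
  rcases le_or_gt |y| B with h | h
  · rw [truncate_eq_self h, sub_self, abs_zero]
    have : 0 ≤ e := (abs_nonneg _).trans hy
    positivity
  · have he : B < e := h.trans_le hy
    have he0 : 0 < e := hB.trans he
    have h1 : |y - truncate B y| ≤ |y| := by
      unfold truncate
      rcases abs_cases y with ⟨h', h''⟩ | ⟨h', h''⟩
      · rw [h'] at h
        rw [min_eq_right h.le, max_eq_right (by linarith), h', abs_le]
        constructor <;> linarith
      · rw [h'] at h
        rw [min_eq_left (by linarith), max_eq_left (by linarith), h', abs_le]
        constructor <;> linarith
    refine (h1.trans hy).trans ?_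
    rw [le_div_iff₀ (Real.rpow_pos_of_pos hB _)]
    calc e * B ^ (q - 1) ≤ e * e ^ (q - 1) := by
          gcongr
      _ = e ^ q := by
          rw [← Real.rpow_one_add' he0.le (by linarith)]
          congr 1
          ring

/-- A moment bound as an integrability statement with a bound for the integral. -/
lemma integrable_rpow_of_eLpNorm_le {Y : Ω → ℝ} (hY : Measurable Y) (hY0 : ∀ ω, 0 ≤ Y ω) {q c : ℝ}
    (hq : 0 < q) (hc : 0 ≤ c) (hYq : eLpNorm Y (ENNReal.ofReal q) μ ≤ ENNReal.ofReal c) :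
    Integrable (fun ω => Y ω ^ q) μ ∧ ∫ ω, Y ω ^ q ∂μ ≤ c ^ q := by
  have hm : Measurable fun ω => Y ω ^ q := hY.pow_const q
  have h1 : ∫⁻ ω, ENNReal.ofReal (Y ω ^ q) ∂μ ≤ ENNReal.ofReal (c ^ q) := by
    rw [eLpNorm_eq_lintegral_rpow_enorm_toReal (ENNReal.ofReal_pos.2 hq).ne'
      ENNReal.ofReal_ne_top, ENNReal.toReal_ofReal hq.le] at hYq
    have h2 := ENNReal.rpow_le_rpow hYq hq.le
    rw [← ENNReal.rpow_mul, one_div_mul_cancel hq.ne', ENNReal.rpow_one,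
      ENNReal.ofReal_rpow_of_nonneg hc hq.le] at h2
    refine le_trans (le_of_eq (lintegral_congr fun ω => ?_)) h2
    rw [Real.enorm_eq_ofReal (hY0 ω), ENNReal.ofReal_rpow_of_nonneg (hY0 ω) hq.le]
  have hi : Integrable (fun ω => Y ω ^ q) μ := by
    refine ⟨hm.aestronglyMeasurable, ?_⟩
    rw [hasFiniteIntegral_iff_ofReal (Eventually.of_forall fun ω => Real.rpow_nonneg (hY0 ω) q)]
    exact h1.trans_lt ENNReal.ofReal_lt_top
  refine ⟨hi, ?_⟩
  rw [← ENNReal.ofReal_le_ofReal_iff (by positivity), ofReal_integral_eq_lintegral_ofReal hi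
    (Eventually.of_forall fun ω => Real.rpow_nonneg (hY0 ω) q)]
  exact h1

end Tails

/-! ### Uniform concentration of the kernel averages -/

section UniformConcentration

/-- The kernel-weighted sum `∑ i ∈ [k, n], K ((i/n - v)/h) f i`. -/
noncomputable def kernelSum (K : ℝ → ℝ) (k n : ℕ) (h v : ℝ) (f : ℤ → ℝ) : ℝ :=
  ∑ i ∈ Finset.Icc (k : ℤ) n, K (((i : ℝ) / n - v) / h) * f i

variable {K : ℝ → ℝ} {k n : ℕ} {h : ℝ}

lemma kernelSum_sub (v : ℝ) (f g : ℤ → ℝ) :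
    kernelSum K k n h v (fun i => f i - g i) =
      kernelSum K k n h v f - kernelSum K k n h v g := by
  simp only [kernelSum, mul_sub, Finset.sum_sub_distrib]

lemma kernelSum_congr (v : ℝ) {f g : ℤ → ℝ} (hfg : ∀ i : ℤ, k ≤ i → i ≤ n → f i = g i) :
    kernelSum K k n h v f = kernelSum K k n h v g :=
  Finset.sum_congr rfl fun i hi => by
    rw [hfg i (Finset.mem_Icc.1 hi).1 (Finset.mem_Icc.1 hi).2]

lemma abs_kernelSum_le (hK : IsLocKernel K) {κ : ℝ} (hκ : ∀ x, |K x| ≤ κ) (hn : 0 < n)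
    (hh : 0 < h) (v : ℝ) {f : ℤ → ℝ} {b : ℝ} (hb : 0 ≤ b)
    (hf : ∀ i : ℤ, k ≤ i → i ≤ n → |((i : ℝ) / n - v) / h| ≤ 1 / 2 → |f i| ≤ b) :
    |kernelSum K k n h v f| ≤ κ * (n * h + 1) * b := by
  have hκ0 : 0 ≤ κ := (abs_nonneg _).trans (hκ 0)
  calc |kernelSum K k n h v f|
      ≤ ∑ i ∈ Finset.Icc (k : ℤ) n, |K (((i : ℝ) / n - v) / h)| * b := by
        refine (Finset.abs_sum_le_sum_abs _ _).trans (Finset.sum_le_sum fun i hi => ?_)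
        rw [abs_mul]
        rcases le_or_gt |((i : ℝ) / n - v) / h| (1 / 2) with h' | h'
        · exact mul_le_mul_of_nonneg_left
            (hf i (Finset.mem_Icc.1 hi).1 (Finset.mem_Icc.1 hi).2 h') (abs_nonneg _)
        · rw [hK.eq_zero h', abs_zero, zero_mul, zero_mul]
    _ = (∑ i ∈ Finset.Icc (k : ℤ) n, |K (((i : ℝ) / n - v) / h)|) * b := by
        rw [Finset.sum_mul]
    _ ≤ κ * (n * h + 1) * b :=
        mul_le_mul_of_nonneg_right
          (sum_kernel_le hK hn hh v _ (f := fun x => |x|) abs_zero hκ hκ0) hb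

variable {d : ℕ} {T : Set (EuclideanSpace ℝ (Fin d))}
  {F : EuclideanSpace ℝ (Fin d) → (Fin k → ℝ) → ℝ} {M C c : ℝ}

/-- Moving the window and the parameter changes the kernel sum by at most a multiple of the sum of
the envelope over all design points. -/
lemma abs_kernelSum_sub_le {κ LK : ℝ} (hκ : ∀ x, |K x| ≤ κ) (hLK : 0 ≤ LK)
    (hlip : ∀ x y, |K x - K y| ≤ LK * |x - y|) (hh : 0 < h) (hF : IsPolyClass T F M C)
    {v v' : ℝ} {θ θ' : EuclideanSpace ℝ (Fin d)} (hθ : θ ∈ T) (hθ' : θ' ∈ T)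
    (z : ℤ → Fin k → ℝ) :
    |kernelSum K k n h v (fun i => F θ (z i)) - kernelSum K k n h v' (fun i => F θ' (z i))| ≤
      (LK * (|v - v'| / h) * (5 * C) + κ * C * ‖θ - θ'‖) *
        ∑ i ∈ Finset.Icc (k : ℤ) n, (1 + l1norm (z i) ^ M) := by
  rw [kernelSum, kernelSum, ← Finset.sum_sub_distrib, Finset.mul_sum]
  refine (Finset.abs_sum_le_sum_abs _ _).trans (Finset.sum_le_sum fun i _ => ?_)
  set x := ((i : ℝ) / n - v) / h
  set x' := ((i : ℝ) / n - v') / h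
  have hY : 0 ≤ 1 + l1norm (z i) ^ M := by
    have := Real.rpow_nonneg (l1norm_nonneg (z i)) M
    linarith
  have h1 : |K x - K x'| ≤ LK * (|v - v'| / h) := by
    refine (hlip x x').trans (le_of_eq ?_)
    congr 1
    have : x - x' = (v' - v) / h := by simp only [x, x']; ring
    rw [this, abs_div, abs_of_pos hh, abs_sub_comm]
  have h2 := hF.growth hθ (z i)
  have h3 := hF.param θ hθ θ' hθ' (z i)
  have hκ0 : 0 ≤ κ := (abs_nonneg _).trans (hκ 0)
  have h4 : K x * F θ (z i) - K x' * F θ' (z i) =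
      (K x - K x') * F θ (z i) + K x' * (F θ (z i) - F θ' (z i)) := by ring
  rw [h4]
  refine (abs_add_le _ _).trans ?_
  rw [abs_mul, abs_mul]
  have hv0 : 0 ≤ LK * (|v - v'| / h) := by positivity
  calc _ ≤ LK * (|v - v'| / h) * (5 * C * (1 + l1norm (z i) ^ M)) +
        κ * (C * (1 + l1norm (z i) ^ M) * ‖θ - θ'‖) :=
        add_le_add (mul_le_mul h1 h2 (abs_nonneg _) hv0)
          (mul_le_mul (hκ _) h3 (abs_nonneg _) hκ0)
    _ = _ := by ring

variable {Ω S : Type*} [MeasurableSpace Ω] [MeasurableSpace S] {μ : Measure Ω}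
  [IsProbabilityMeasure μ] {ε : ℤ → Ω → S}

lemma sum_windowDep_le {Δ : ℕ → ℝ} (hΔ0 : ∀ j, 0 < Δ j) (hc : 0 ≤ c) (hC : 0 < C) {b : ℝ}
    {m : ℕ} (hb : ∀ r, ∑ j ∈ Finset.range r, Δ (m + j) ≤ b) (r : ℕ) :
    ∑ j ∈ Finset.range r, windowDep k M c C Δ (m + k + j) ≤
      C * (4 * (1 + 2 * k * c) ^ (M - 1)) * (k * b) := by
  have hr : 0 ≤ C * (4 * (1 + 2 * k * c) ^ (M - 1)) :=
    mul_nonneg hC.le (mul_nonneg (by norm_num) (Real.rpow_nonneg (by positivity) _))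
  simp only [windowDep]
  rw [← Finset.mul_sum, Finset.sum_comm]
  refine mul_le_mul_of_nonneg_left ?_ hr
  have : ∀ l : Fin k, ∑ j ∈ Finset.range r,
      (if (l : ℕ) ≤ m + k + j then Δ (m + k + j - l) else 0) ≤ b := by
    intro l
    have hl := l.2
    refine le_trans ?_ (hb (k - l + r))
    rw [Finset.sum_range_add]
    have h1 : ∀ j, (if (l : ℕ) ≤ m + k + j then Δ (m + k + j - l) else 0) =
        Δ (m + (k - l + j)) := fun j => by
      rw [if_pos (by omega)]
      congr 1
      omega
    simp only [h1]
    exact le_add_of_nonneg_left (Finset.sum_nonneg fun j _ => (hΔ0 _).le)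
  refine (Finset.sum_le_sum fun l _ => this l).trans ?_
  simp

lemma sum_windowDep_le' {Δ : ℕ → ℝ} (hΔ0 : ∀ j, 0 < Δ j) (hc : 0 ≤ c) (hC : 0 < C) {b : ℝ}
    (hb : ∀ r, ∑ j ∈ Finset.range r, Δ j ≤ b) (r : ℕ) :
    ∑ j ∈ Finset.range r, windowDep k M c C Δ j ≤
      C * (4 * (1 + 2 * k * c) ^ (M - 1)) * (k * b) := by
  have hr : 0 ≤ C * (4 * (1 + 2 * k * c) ^ (M - 1)) :=
    mul_nonneg hC.le (mul_nonneg (by norm_num) (Real.rpow_nonneg (by positivity) _))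
  simp only [windowDep]
  rw [← Finset.mul_sum, Finset.sum_comm]
  refine mul_le_mul_of_nonneg_left ?_ hr
  have : ∀ l : Fin k, ∑ j ∈ Finset.range r,
      (if (l : ℕ) ≤ j then Δ (j - l) else 0) ≤ b := by
    intro l
    refine le_trans ?_ (hb r)
    rcases le_or_gt (l : ℕ) r with hlr | hlr
    · obtain ⟨s, rfl⟩ := Nat.exists_eq_add_of_le hlr
      rw [Finset.sum_range_add, Finset.sum_eq_zero fun j hj =>
        if_neg (not_le.2 (Finset.mem_range.1 hj)), zero_add]
      have h1 : ∀ j, (if (l : ℕ) ≤ l + j then Δ (l + j - l) else 0) = Δ j := fun j => by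
        rw [if_pos (by omega)]
        congr 1
        omega
      simp only [h1]
      exact Finset.sum_le_sum_of_subset_of_nonneg (Finset.range_mono (by omega))
        fun j _ _ => (hΔ0 j).le
    · rw [Finset.sum_eq_zero fun j hj => if_neg (by have := Finset.mem_range.1 hj; omega)]
      exact Finset.sum_nonneg fun j _ => (hΔ0 j).le
  refine (Finset.sum_le_sum fun l _ => this l).trans ?_
  simp

/-- The expected maximum of the truncated and centered kernel sums over a polynomial number of
windows and functions is of the order `√(n h log n)`. The block length `m` has to be small enough
for Bernstein's bound, and large enough to make the dependence at lags `> m` of the order `√h`. -/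
lemma lintegral_iSup_kernelSum_truncate_le (hε : IsIIDInnovation μ ε) {J : ℤ → (ℕ → S) → ℝ}
    (hJ : ∀ i : ℤ, 1 ≤ i → i ≤ n → Measurable (J i)) (hc : 0 ≤ c)
    (hmom : ∀ i : ℤ, 1 ≤ i → i ≤ n → eLpNorm (fun ω => J i (innovPast ε i ω))
      (ENNReal.ofReal (2 * M)) μ ≤ ENNReal.ofReal c)
    (hF : IsPolyClass T F M C) {Δ : ℕ → ℝ} (hΔ0 : ∀ j, 0 < Δ j)
    (hΔ : ∀ j, depMeasure μ ε J n (2 * M) j ≤ ENNReal.ofReal (Δ j))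
    {D₀ : ℝ} (hD₀ : ∀ r, ∑ j ∈ Finset.range r, Δ j ≤ D₀)
    (hk : 1 ≤ k) (hkn : k ≤ n) (hK : IsLocKernel K) {κ : ℝ} (hκ0 : 0 < κ) (hκ : ∀ x, |K x| ≤ κ)
    (hh : 0 < h) (hnh : 1 ≤ n * h) (hlog : 1 ≤ Real.log n) {B₀ b : ℝ} (hB₀ : 0 < B₀) (hb : 0 < b)
    {m : ℕ} {Cm Ct : ℝ} (hCm : 0 < Cm)
    (hm : (m + 1) * (Real.sqrt (Real.log n) * b) ≤ Cm * Real.sqrt (n * h))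
    (hmt : ∀ r, ∑ j ∈ Finset.range r, Δ (m + 1 + j) ≤ Ct * Real.sqrt h)
    {A : Type*} [Fintype A] [Nonempty A] (v : A → ℝ) (θ : A → EuclideanSpace ℝ (Fin d))
    (hθ : ∀ a, θ a ∈ T) {Cp : ℝ} (hA : Real.log (2 * Fintype.card A) ≤ Cp * Real.log n) :
    ∫⁻ ω, ⨆ a, ‖kernelSum K k n h (v a) fun i =>
        truncate (B₀ * b) (F (θ a) (lagWindow k (fun i ω => J i (innovPast ε i ω)) i ω)) -
          ∫ ω', truncate (B₀ * b)
            (F (θ a) (lagWindow k (fun i ω => J i (innovPast ε i ω)) i ω')) ∂μ‖ₑ ∂μ ≤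
      ENNReal.ofReal ((4 * κ * B₀ * ((1 + k) * Cm) * Cp +
        2 * (C * (4 * (1 + 2 * k * c) ^ (M - 1)) * (k * D₀)) ^ 2 * κ / (B₀ * ((1 + k) * Cm)) +
        3 * κ * Real.sqrt Cp * (C * (4 * (1 + 2 * k * c) ^ (M - 1)) * (k * Ct))) *
        (Real.sqrt (n * h) * Real.sqrt (Real.log n))) := by
  have hn : 0 < n := by omega
  have hn' : (0 : ℝ) < n := by exact_mod_cast hn
  have hcard : (1 : ℝ) ≤ Fintype.card A := by exact_mod_cast Fintype.card_pos
  set l := Real.sqrt (Real.log n) with hl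
  set a := Real.sqrt (n * h) with ha
  have hl1 : 1 ≤ l := Real.one_le_sqrt.2 hlog
  have ha1 : 1 ≤ a := Real.one_le_sqrt.2 hnh
  have hl2 : l ^ 2 = Real.log n := Real.sq_sqrt (by linarith)
  have ha2 : a ^ 2 = n * h := Real.sq_sqrt (by linarith)
  have hl0 : 0 < l := by linarith
  have ha0 : 0 < a := by linarith
  set q := 4 * κ * B₀ * ((1 + k) * Cm) with hq
  have hq0 : 0 < q := by positivity
  -- the factor of the exponential moments is the largest one that Bernstein's bound admits
  set s := l / (q * a) with hs
  have hs0 : 0 < s := by positivity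
  have hm' : (((m + k : ℕ) : ℝ) + 1) * (l * b) ≤ (1 + k) * Cm * a := by
    have h1 : ((m + k : ℕ) : ℝ) + 1 ≤ (1 + k) * (m + 1) := by
      push_cast
      nlinarith [mul_nonneg (Nat.cast_nonneg (α := ℝ) k) (Nat.cast_nonneg (α := ℝ) m)]
    calc _ ≤ (1 + k) * (m + 1) * (l * b) := by gcongr
      _ = (1 + k) * ((m + 1) * (l * b)) := by ring
      _ ≤ (1 + k) * (Cm * a) := by gcongr
      _ = _ := by ring
  have hscond : 2 * s * ((((m + k : ℕ) : ℝ) + 1) * (κ * (2 * (B₀ * b)))) ≤ 1 := by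
    have h1 : 2 * s * ((((m + k : ℕ) : ℝ) + 1) * (κ * (2 * (B₀ * b)))) =
        4 * κ * B₀ * ((((m + k : ℕ) : ℝ) + 1) * (l * b)) / (q * a) := by
      rw [hs]; ring
    rw [h1, div_le_one (by positivity)]
    calc _ ≤ 4 * κ * B₀ * ((1 + k) * Cm * a) := by gcongr
      _ = q * a := by rw [hq]; ring
  have hD := sum_windowDep_le' (k := k) (M := M) hΔ0 hc hF.pos hD₀ (m + k + 1)
  have hD' : ∀ r, ∑ j ∈ Finset.range r, windowDep k M c C Δ (m + k + 1 + j) ≤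
      C * (4 * (1 + 2 * k * c) ^ (M - 1)) * (k * (Ct * Real.sqrt h)) := fun r => by
    have := sum_windowDep_le (k := k) (M := M) hΔ0 hc hF.pos hmt r
    refine le_trans (le_of_eq ?_) this
    exact Finset.sum_congr rfl fun j _ => by congr 1; omega
  have hW : ∀ a' : A, ∑ i ∈ Finset.Icc (k : ℤ) n, K (((i : ℝ) / n - v a') / h) ^ 2 ≤
      κ ^ 2 * (2 * a ^ 2) := fun a' => by
    refine (sum_kernel_le hK hn hh (v a') _ (f := fun x => x ^ 2) (by norm_num)
      (fun x => sq_le_sq' (abs_le.1 (hκ x)).1 (abs_le.1 (hκ x)).2) (sq_nonneg κ)).trans ?_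
    rw [ha2]
    gcongr
    linarith
  have hmain := lintegral_iSup_truncate_le hε hJ hc hmom hF hΔ0 hΔ hk hkn θ hθ
    (B := B₀ * b) (by positivity) (fun i a' => K (((i : ℝ) / n - v a') / h)) hκ0
    (fun i a' => hκ _) hW (m + k) hD hD' hs0 hscond
  refine hmain.trans ?_
  have hr0 : 0 ≤ C * (4 * (1 + 2 * k * c) ^ (M - 1)) :=
    mul_nonneg hF.pos.le (mul_nonneg (by norm_num) (Real.rpow_nonneg (by positivity) _))
  have hCt : 0 ≤ Ct * Real.sqrt h := by simpa using hmt 0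
  have hlogA : 0 ≤ Real.log (2 * Fintype.card A) := Real.log_nonneg (by linarith)
  have hCp : 0 ≤ Cp := by
    by_contra hneg
    have : Cp * Real.log n < 0 := mul_neg_of_neg_of_pos (not_le.1 hneg) (by linarith)
    linarith
  set R := C * (4 * (1 + 2 * k * c) ^ (M - 1)) with hR
  have hterm1 : s⁻¹ * (Real.log (2 * Fintype.card A) +
      4 * s ^ 2 * (R * (k * D₀)) ^ 2 * (κ ^ 2 * (2 * a ^ 2))) ≤
      (q * Cp + 2 * (R * (k * D₀)) ^ 2 * κ / (B₀ * ((1 + k) * Cm))) * (a * l) := by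
    calc _ ≤ s⁻¹ * (Cp * l ^ 2 + 4 * s ^ 2 * (R * (k * D₀)) ^ 2 * (κ ^ 2 * (2 * a ^ 2))) := by
          rw [hl2]; gcongr
      _ = _ := by
          rw [hs, hq]
          field_simp
  have hterm2 : 3 * κ * Real.sqrt (n * Real.log (2 * Fintype.card A)) *
      (R * (k * (Ct * Real.sqrt h))) ≤
      3 * κ * Real.sqrt Cp * (R * (k * Ct)) * (a * l) := by
    calc _ ≤ 3 * κ * Real.sqrt (n * (Cp * Real.log n)) * (R * (k * (Ct * Real.sqrt h))) := by
          gcongr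
      _ = _ := by
          rw [Real.sqrt_mul hn'.le, Real.sqrt_mul hCp, ha, hl, Real.sqrt_mul hn'.le]
          ring
  rw [← ENNReal.ofReal_add]
  · refine ENNReal.ofReal_le_ofReal ?_
    rw [add_mul]
    exact add_le_add hterm1 hterm2
  · positivity
  · exact mul_nonneg (by positivity) (mul_nonneg hr0 (mul_nonneg (by positivity) hCt))

end UniformConcentration

section UniformConcentration

variable {k n d : ℕ} {h : ℝ} {K : ℝ → ℝ} {T : Set (EuclideanSpace ℝ (Fin d))}
  {F : EuclideanSpace ℝ (Fin d) → (Fin k → ℝ) → ℝ} {M C c ν : ℝ}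
  {Ω S : Type*} [MeasurableSpace Ω] [MeasurableSpace S] {μ : Measure Ω}
  [IsProbabilityMeasure μ] {ε : ℤ → Ω → S}

lemma one_le_envelope {M : ℝ} (z : Fin k → ℝ) : 1 ≤ 1 + l1norm z ^ M :=
  le_add_of_nonneg_right (Real.rpow_nonneg (l1norm_nonneg z) M)

lemma measurable_envelope {W : Ω → Fin k → ℝ} (hW : Measurable W) (M : ℝ) :
    Measurable fun ω => 1 + l1norm (W ω) ^ M :=
  ((measurable_l1norm.comp hW).pow_const M).const_add 1

lemma integral_envelope_le {W : Ω → Fin k → ℝ} (hW : Measurable W) (hM : 1 ≤ M) (hν : 1 ≤ ν)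
    (hc : 0 ≤ c)
    (hmom : ∀ l, eLpNorm (fun ω => W ω l) (ENNReal.ofReal (ν * M)) μ ≤ ENNReal.ofReal c) :
    Integrable (fun ω => 1 + l1norm (W ω) ^ M) μ ∧
      ∫ ω, (1 + l1norm (W ω) ^ M) ∂μ ≤ 1 + (k * c) ^ M := by
  have hm := measurable_envelope hW M
  have h1 := eLpNorm_one_add_l1norm_rpow_le μ hW hM hν hc hmom
  have h2 : eLpNorm (fun ω => 1 + l1norm (W ω) ^ M) (ENNReal.ofReal 1) μ ≤
      ENNReal.ofReal (1 + (k * c) ^ M) :=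
    (eLpNorm_le_eLpNorm_of_exponent_le (ENNReal.ofReal_le_ofReal hν)
      hm.aestronglyMeasurable).trans h1
  have := integrable_rpow_of_eLpNorm_le hm (fun ω => zero_le_one.trans (one_le_envelope _))
    one_pos (by positivity) h2
  simpa using this

lemma IsPolyClass.integrable_comp (hF : IsPolyClass T F M C) {θ : EuclideanSpace ℝ (Fin d)}
    (hθ : θ ∈ T) {W : Ω → Fin k → ℝ} (hW : Measurable W) (hν : 1 ≤ ν) (hc : 0 ≤ c)
    (hmom : ∀ l, eLpNorm (fun ω => W ω l) (ENNReal.ofReal (ν * M)) μ ≤ ENNReal.ofReal c) :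
    Integrable (fun ω => F θ (W ω)) μ :=
  ((integral_envelope_le hW hF.one_le hν hc hmom).1.const_mul (5 * C)).mono'
    ((hF.measurable hθ).comp hW).aestronglyMeasurable
    (Eventually.of_forall fun ω => hF.growth hθ (W ω))

lemma IsPolyClass.abs_integral_sub_truncate_le (hF : IsPolyClass T F M C)
    {θ : EuclideanSpace ℝ (Fin d)}
    (hθ : θ ∈ T) {W : Ω → Fin k → ℝ} (hW : Measurable W) (hν : 1 ≤ ν) (hc : 0 ≤ c)
    (hmom : ∀ l, eLpNorm (fun ω => W ω l) (ENNReal.ofReal (ν * M)) μ ≤ ENNReal.ofReal c)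
    {B : ℝ} (hB : 0 < B) :
    |∫ ω, truncate B (F θ (W ω)) ∂μ - ∫ ω, F θ (W ω) ∂μ| ≤
      (5 * C * (1 + (k * c) ^ M)) ^ ν / B ^ (ν - 1) := by
  have hm := measurable_envelope hW M
  have hν0 : 0 < ν := by linarith
  have hC := hF.pos
  have hFm := (hF.measurable hθ).comp hW
  have hi := hF.integrable_comp hθ hW hν hc hmom
  have h0 : ∀ ω, 0 ≤ 1 + l1norm (W ω) ^ M := fun ω => zero_le_one.trans (one_le_envelope _)
  obtain ⟨h1, h2⟩ := integrable_rpow_of_eLpNorm_le hm h0 hν0 (by positivity)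
    (eLpNorm_one_add_l1norm_rpow_le μ hW hF.one_le hν hc hmom)
  have hit : Integrable (fun ω => truncate B (F θ (W ω))) μ :=
    integrable_of_abs_le ((measurable_truncate B).comp hFm) fun ω => abs_truncate_le hB.le _
  rw [abs_sub_comm, ← integral_sub hi hit]
  refine (norm_integral_le_of_norm_le (f := fun ω => F θ (W ω) - truncate B (F θ (W ω)))
    ((h1.const_mul ((5 * C) ^ ν)).div_const (B ^ (ν - 1))) (Eventually.of_forall fun ω => ?_)).trans ?_
  · rw [Real.norm_eq_abs, ← Real.mul_rpow (by positivity) (h0 ω)]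
    exact abs_sub_truncate_le hB hν (hF.growth hθ (W ω))
  · rw [integral_div, integral_const_mul,
      Real.mul_rpow (x := 5 * C) (by positivity) (by positivity)]
    gcongr

/-- The approximation of the centered kernel sum at `(v, θ)` by the truncated one at `(v', θ')`,
at points where the truncation has no effect. -/
lemma abs_kernelSum_centered_le {κ LK : ℝ} (hK : IsLocKernel K) (hκ : ∀ x, |K x| ≤ κ) (hLK : 0 ≤ LK)
    (hlip : ∀ x y, |K x - K y| ≤ LK * |x - y|) (hk : 1 ≤ k) (hn : 0 < n) (hh : 0 < h)
    (hF : IsPolyClass T F M C) (hν : 1 ≤ ν) (hc : 0 ≤ c) {Z : ℤ → Ω → Fin k → ℝ}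
    (hZ : ∀ i : ℤ, k ≤ i → i ≤ n → Measurable (Z i))
    (hmom : ∀ i : ℤ, k ≤ i → i ≤ n → ∀ l,
      eLpNorm (fun ω => Z i ω l) (ENNReal.ofReal (ν * M)) μ ≤ ENNReal.ofReal c)
    {B : ℝ} (hB : 0 < B) {v v' : ℝ} {θ θ' : EuclideanSpace ℝ (Fin d)} (hθ : θ ∈ T) (hθ' : θ' ∈ T)
    {ω : Ω} (hω : ∀ i : ℤ, k ≤ i → i ≤ n → 5 * C * (1 + l1norm (Z i ω) ^ M) ≤ B) :
    |kernelSum K k n h v fun i => F θ (Z i ω) - ∫ ω', F θ (Z i ω') ∂μ| ≤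
      (LK * (|v - v'| / h) * (5 * C) + κ * C * ‖θ - θ'‖) *
        (∑ i ∈ Finset.Icc (k : ℤ) n, (1 + l1norm (Z i ω) ^ M) + n * (1 + (k * c) ^ M)) +
      |kernelSum K k n h v' fun i => truncate B (F θ' (Z i ω)) -
        ∫ ω', truncate B (F θ' (Z i ω')) ∂μ| +
      κ * (n * h + 1) * ((5 * C * (1 + (k * c) ^ M)) ^ ν / B ^ (ν - 1)) := by
  have hC := hF.pos
  have hκ0 : 0 ≤ κ := (abs_nonneg _).trans (hκ 0)
  set q := LK * (|v - v'| / h) * (5 * C) + κ * C * ‖θ - θ'‖ with hq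
  have hq0 : 0 ≤ q := by positivity
  have hint : ∀ ϑ ∈ T, ∀ i : ℤ, k ≤ i → i ≤ n → Integrable (fun ω => F ϑ (Z i ω)) μ :=
    fun ϑ hϑ i h1 h2 => hF.integrable_comp hϑ (hZ i h1 h2) hν hc (hmom i h1 h2)
  have e1 := abs_kernelSum_sub_le (n := n) hκ hLK hlip hh hF (v := v) (v' := v') hθ hθ'
    (fun i => Z i ω)
  have hE : ∀ (w : ℝ) (ϑ : EuclideanSpace ℝ (Fin d)), ϑ ∈ T →
      kernelSum K k n h w (fun i => ∫ ω', F ϑ (Z i ω') ∂μ) =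
        ∫ ω', kernelSum K k n h w (fun i => F ϑ (Z i ω')) ∂μ := by
    intro w ϑ hϑ
    unfold kernelSum
    rw [integral_finsetSum]
    · simp only [integral_const_mul]
    · intro i hi
      exact (hint ϑ hϑ i (Finset.mem_Icc.1 hi).1 (Finset.mem_Icc.1 hi).2).const_mul _
  have hiK : ∀ (w : ℝ) (ϑ : EuclideanSpace ℝ (Fin d)), ϑ ∈ T →
      Integrable (fun ω' => kernelSum K k n h w (fun i => F ϑ (Z i ω'))) μ := fun w ϑ hϑ =>
    integrable_finsetSum _ fun i hi =>
      (hint ϑ hϑ i (Finset.mem_Icc.1 hi).1 (Finset.mem_Icc.1 hi).2).const_mul _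
  have e2 : |kernelSum K k n h v (fun i => ∫ ω', F θ (Z i ω') ∂μ) -
      kernelSum K k n h v' (fun i => ∫ ω', F θ' (Z i ω') ∂μ)| ≤ q * (n * (1 + (k * c) ^ M)) := by
    rw [hE v θ hθ, hE v' θ' hθ', ← integral_sub (hiK v θ hθ) (hiK v' θ' hθ')]
    have hY : ∀ i ∈ Finset.Icc (k : ℤ) n,
        Integrable (fun ω => 1 + l1norm (Z i ω) ^ M) μ ∧
          ∫ ω, (1 + l1norm (Z i ω) ^ M) ∂μ ≤ 1 + (k * c) ^ M := fun i hi =>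
      integral_envelope_le (hZ i (Finset.mem_Icc.1 hi).1 (Finset.mem_Icc.1 hi).2) hF.one_le hν hc
        (hmom i (Finset.mem_Icc.1 hi).1 (Finset.mem_Icc.1 hi).2)
    refine (norm_integral_le_of_norm_le
      ((integrable_finsetSum _ fun i hi => (hY i hi).1).const_mul q)
      (Eventually.of_forall fun ω' => (Real.norm_eq_abs _).trans_le
        (abs_kernelSum_sub_le (n := n) hκ hLK hlip hh hF (v := v) (v' := v')
        hθ hθ' (fun i => Z i ω')))).trans ?_
    rw [integral_const_mul, integral_finsetSum _ fun i hi => (hY i hi).1]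
    refine mul_le_mul_of_nonneg_left ?_ hq0
    refine (Finset.sum_le_card_nsmul _ _ _ fun i hi => (hY i hi).2).trans ?_
    rw [nsmul_eq_mul, Int.card_Icc]
    refine mul_le_mul_of_nonneg_right ?_ (by positivity)
    exact_mod_cast (by omega : ((n : ℤ) + 1 - k).toNat ≤ n)
  have e3 : |kernelSum K k n h v' (fun i => ∫ ω', truncate B (F θ' (Z i ω')) ∂μ -
      ∫ ω', F θ' (Z i ω') ∂μ)| ≤
      κ * (n * h + 1) * ((5 * C * (1 + (k * c) ^ M)) ^ ν / B ^ (ν - 1)) :=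
    abs_kernelSum_le hK hκ hn hh v' (by positivity) fun i h1 h2 _ =>
      hF.abs_integral_sub_truncate_le hθ' (hZ i h1 h2) hν hc (hmom i h1 h2) hB
  have e4 : kernelSum K k n h v' (fun i => truncate B (F θ' (Z i ω))) =
      kernelSum K k n h v' (fun i => F θ' (Z i ω)) :=
    kernelSum_congr v' fun i h1 h2 =>
      truncate_eq_self ((hF.growth hθ' (Z i ω)).trans (hω i h1 h2))
  rw [kernelSum_sub] at e3 ⊢
  rw [kernelSum_sub, e4, mul_add]
  have t1 := abs_le.1 e1
  have t2 := abs_le.1 e2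
  have t3 := abs_le.1 e3
  have t4 := abs_le.1 (le_refl |kernelSum K k n h v' (fun i => F θ' (Z i ω)) -
    kernelSum K k n h v' (fun i => ∫ ω', truncate B (F θ' (Z i ω')) ∂μ)|)
  exact abs_le.2 ⟨by linarith, by linarith⟩

lemma log_two_mul_card_le {n d p : ℕ} {C₀ : ℝ} (hC₀ : 1 ≤ C₀) (hlog : 1 ≤ Real.log n)
    (hn : 1 ≤ n) (hp0 : 0 < p) (hp : (p : ℝ) ≤ (n ^ 2 + 1) * (C₀ * n ^ 2) ^ d) :
    Real.log (2 * p) ≤ (Real.log 4 + 2 + d * Real.log C₀ + 2 * d) * Real.log n := by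
  have hn' : (1 : ℝ) ≤ n := by exact_mod_cast hn
  have hn2 : (1 : ℝ) ≤ (n : ℝ) ^ 2 := one_le_pow₀ hn'
  have hp0' : (0 : ℝ) < p := by exact_mod_cast hp0
  have h1 : (2 * p : ℝ) ≤ 4 * (n : ℝ) ^ 2 * (C₀ * n ^ 2) ^ d := by
    have : (0 : ℝ) ≤ (C₀ * n ^ 2) ^ d := by positivity
    nlinarith
  refine (Real.log_le_log (by positivity) h1).trans ?_
  have hl4 : 0 ≤ Real.log 4 := Real.log_nonneg (by norm_num)
  have hlC : 0 ≤ Real.log C₀ := Real.log_nonneg hC₀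
  rw [Real.log_mul (by positivity) (by positivity), Real.log_mul (by positivity) (by positivity),
    Real.log_pow, Real.log_pow, Real.log_mul (by positivity) (by positivity), Real.log_pow]
  have h2 := mul_le_mul_of_nonneg_left hlog hl4
  have h3 := mul_le_mul_of_nonneg_left hlog (mul_nonneg (Nat.cast_nonneg (α := ℝ) d) hlC)
  push_cast
  nlinarith

/-- Exceeding the level `B₀ n^{1/ν}` has small probability for the maximum of `n` envelopes. -/
lemma measure_envelope_max_le (hM : 1 ≤ M) (hν : 1 ≤ ν) (hc : 0 ≤ c) (hC : 0 < C) (hk : 1 ≤ k)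
    (hn : 0 < n) {Z : ℤ → Ω → Fin k → ℝ} (hZ : ∀ i : ℤ, k ≤ i → i ≤ n → Measurable (Z i))
    (hmom : ∀ i : ℤ, k ≤ i → i ≤ n → ∀ l,
      eLpNorm (fun ω => Z i ω l) (ENNReal.ofReal (ν * M)) μ ≤ ENNReal.ofReal c)
    {η : ℝ} (hη : 0 < η) :
    μ (⋃ i ∈ Finset.Icc (k : ℤ) n, {ω | C * (1 + (k * c) ^ M) * (1 / η) ^ (1 / ν) *
      (n : ℝ) ^ (1 / ν) / C < 1 + l1norm (Z i ω) ^ M}) ≤ ENNReal.ofReal η := by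
  have hν0 : 0 < ν := by linarith
  have hn' : (0 : ℝ) < n := by exact_mod_cast hn
  have hc₁ : 0 < 1 + (k * c) ^ M := by positivity
  refine (measure_biUnion_finset_le _ _).trans ?_
  refine (Finset.sum_le_card_nsmul _ _ (ENNReal.ofReal (η / n)) fun i h' => ?_).trans ?_
  · have hi' := Finset.mem_Icc.1 h'
    refine (measure_lt_le_of_eLpNorm (measurable_envelope (hZ i hi'.1 hi'.2) M) hν0 hc₁.le
      (by positivity) (eLpNorm_one_add_l1norm_rpow_le μ (hZ i hi'.1 hi'.2) hM hν hc
        (hmom i hi'.1 hi'.2))).trans (ENNReal.ofReal_le_ofReal (le_of_eq ?_))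
    have : (1 + (k * c) ^ M) / (C * (1 + (k * c) ^ M) * (1 / η) ^ (1 / ν) *
        (n : ℝ) ^ (1 / ν) / C) = (η / n) ^ (1 / ν) := by
      rw [Real.div_rpow hη.le hn'.le, Real.div_rpow zero_le_one hη.le, Real.one_rpow]
      field_simp
    rw [this, ← Real.rpow_mul (by positivity), one_div_mul_cancel hν0.ne', Real.rpow_one]
  · rw [nsmul_eq_mul, Int.card_Icc, ← ENNReal.ofReal_natCast, ← ENNReal.ofReal_mul (by positivity)]
    refine ENNReal.ofReal_le_ofReal ?_
    calc _ ≤ (n : ℝ) * (η / n) := by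
          refine mul_le_mul_of_nonneg_right ?_ (by positivity)
          exact_mod_cast (by omega : ((n : ℤ) + 1 - k).toNat ≤ n)
      _ = η := by field_simp

lemma measure_envelope_sum_le (hM : 1 ≤ M) (hν : 1 ≤ ν) (hc : 0 ≤ c) (hk : 1 ≤ k)
    (hn : 0 < n) {Z : ℤ → Ω → Fin k → ℝ} (hZ : ∀ i : ℤ, k ≤ i → i ≤ n → Measurable (Z i))
    (hmom : ∀ i : ℤ, k ≤ i → i ≤ n → ∀ l,
      eLpNorm (fun ω => Z i ω l) (ENNReal.ofReal (ν * M)) μ ≤ ENNReal.ofReal c)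
    {η : ℝ} (hη : 0 < η) :
    μ {ω | ENNReal.ofReal (n * (1 + (k * c) ^ M) / η) <
      ENNReal.ofReal (∑ i ∈ Finset.Icc (k : ℤ) n, (1 + l1norm (Z i ω) ^ M))} ≤
        ENNReal.ofReal η := by
  have hn' : (0 : ℝ) < n := by exact_mod_cast hn
  have hi : ∀ i ∈ Finset.Icc (k : ℤ) n, Integrable (fun ω => 1 + l1norm (Z i ω) ^ M) μ ∧
      ∫ ω, (1 + l1norm (Z i ω) ^ M) ∂μ ≤ 1 + (k * c) ^ M := fun i hi =>
    integral_envelope_le (hZ i (Finset.mem_Icc.1 hi).1 (Finset.mem_Icc.1 hi).2) hM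
      hν hc (hmom i (Finset.mem_Icc.1 hi).1 (Finset.mem_Icc.1 hi).2)
  refine measure_lt_le_of_lintegral ?_ hη (by positivity) ?_
  · exact (Finset.measurable_sum _ fun i hi => measurable_envelope
      (hZ i (Finset.mem_Icc.1 hi).1 (Finset.mem_Icc.1 hi).2) M).ennreal_ofReal
  · rw [← ofReal_integral_eq_lintegral_ofReal (integrable_finsetSum _ fun i h' => (hi i h').1)
      (Eventually.of_forall fun ω => Finset.sum_nonneg fun i _ =>
        zero_le_one.trans (one_le_envelope _))]
    refine ENNReal.ofReal_le_ofReal ?_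
    rw [integral_finsetSum _ fun i h' => (hi i h').1]
    refine (Finset.sum_le_card_nsmul _ _ _ fun i h' => (hi i h').2).trans ?_
    rw [nsmul_eq_mul, Int.card_Icc]
    refine mul_le_mul_of_nonneg_right ?_ (by positivity)
    exact_mod_cast (by omega : ((n : ℤ) + 1 - k).toNat ≤ n)

lemma exists_abs_sub_grid_le (hn : 0 < n) {v : ℝ} (hv : v ∈ Icc (0 : ℝ) 1) :
    ∃ q : Fin (n ^ 2 + 1), |v - ((q : ℕ) : ℝ) / (n : ℝ) ^ 2| ≤ 1 / (n : ℝ) ^ 2 := by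
  have hn2 : (0 : ℝ) < (n : ℝ) ^ 2 := by positivity
  have hfl : ⌊v * (n : ℝ) ^ 2⌋₊ < n ^ 2 + 1 := by
    rw [Nat.lt_succ_iff]
    refine Nat.floor_le_of_le ?_
    push_cast
    nlinarith [hv.2]
  refine ⟨⟨_, hfl⟩, ?_⟩
  have h1 := Nat.floor_le (mul_nonneg hv.1 hn2.le)
  have h2 := Nat.lt_floor_add_one (v * (n : ℝ) ^ 2)
  have h3 : v - (⌊v * (n : ℝ) ^ 2⌋₊ : ℝ) / (n : ℝ) ^ 2 =
      (v * (n : ℝ) ^ 2 - ⌊v * (n : ℝ) ^ 2⌋₊) / (n : ℝ) ^ 2 := by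
    field_simp
  rw [h3, abs_of_nonneg (div_nonneg (by linarith) hn2.le)]
  gcongr
  linarith

/-- The discretization error is bounded on a grid of width `n⁻²`. -/
lemma grid_error_le {LK κ C c₁ η s Y e : ℝ} {d : ℕ} (hLK : 0 ≤ LK) (hκ : 0 ≤ κ) (hC : 0 ≤ C)
    (hc₁ : 0 ≤ c₁) (hη : 0 < η) (hn : (1 : ℝ) ≤ n) (hh : 0 < h) (hnh : 1 ≤ n * h)
    (hs : s ≤ 1 / (n : ℝ) ^ 2) (he : e ≤ d / (n : ℝ) ^ 2)
    (hY : Y ≤ n * c₁ / η) (hY0 : 0 ≤ Y) :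
    (LK * (s / h) * (5 * C) + κ * C * e) * (Y + n * c₁) ≤
      (LK * (5 * C) + κ * C * d) * (c₁ / η + c₁) := by
  have hn0 : (0 : ℝ) < n := by linarith
  calc _ ≤ (LK * (1 / (n : ℝ) ^ 2 / h) * (5 * C) + κ * C * (d / (n : ℝ) ^ 2)) *
        (n * c₁ / η + n * c₁) := by gcongr
    _ = (LK * (5 * C) * (1 / (n * h)) + κ * C * d * (1 / n)) * (c₁ / η + c₁) := by
        field_simp
    _ ≤ (LK * (5 * C) * 1 + κ * C * d * 1) * (c₁ / η + c₁) := by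
        have h1 : 1 / ((n : ℝ) * h) ≤ 1 := by
          rw [div_le_one (by linarith)]; exact hnh
        have h2 : 1 / (n : ℝ) ≤ 1 := by
          rw [div_le_one (by linarith)]; exact hn
        gcongr
    _ = _ := by ring

/-- The bias caused by truncation at `B₀ n^{1/ν}`. -/
lemma truncation_bias_le {κ p B₀ ν : ℝ} (hκ : 0 ≤ κ) (hp : 0 ≤ p) (hB₀ : 0 < B₀) (hν : 2 < ν)
    (hn : (1 : ℝ) ≤ n) (hh : 0 < h) (hh1 : h ≤ 1) (hnh : 1 ≤ n * h) :
    κ * (n * h + 1) * (p / (B₀ * (n : ℝ) ^ (1 / ν)) ^ (ν - 1)) ≤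
      κ * 2 * (p / B₀ ^ (ν - 1)) * Real.sqrt (n * h) := by
  have hn0 : (0 : ℝ) < n := by linarith
  set a := Real.sqrt (n * h) with ha
  have hbν : Real.sqrt n ≤ ((n : ℝ) ^ (1 / ν)) ^ (ν - 1) := by
    rw [← Real.rpow_mul (by positivity), Real.sqrt_eq_rpow]
    refine Real.rpow_le_rpow_of_exponent_le hn ?_
    rw [one_div_mul_eq_div, le_div_iff₀ (by linarith)]
    linarith
  have hsn : 0 < Real.sqrt n := Real.sqrt_pos.2 (by linarith)
  have ha0 : 0 ≤ a := Real.sqrt_nonneg _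
  have ha2 : a * a = n * h := Real.mul_self_sqrt (by positivity)
  have hasn : a ≤ Real.sqrt n := Real.sqrt_le_sqrt (by nlinarith)
  rw [Real.mul_rpow hB₀.le (by positivity)]
  calc _ ≤ κ * (2 * (a * a)) * (p / (B₀ ^ (ν - 1) * Real.sqrt n)) := by
        gcongr
        rw [ha2]; linarith
    _ = κ * 2 * (p / B₀ ^ (ν - 1)) * (a * (a / Real.sqrt n)) := by
        field_simp
    _ ≤ κ * 2 * (p / B₀ ^ (ν - 1)) * (a * 1) := by
        gcongr
        exact (div_le_one hsn).2 hasn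
    _ = _ := by rw [mul_one]

/-- Uniformly over windows and parameters, a centered kernel sum is of the order `√(n h log n)`
outside an event of small probability. The constant depends only on the constants of the
assumptions. -/
theorem exists_measure_kernelSum_gt_le (hε : IsIIDInnovation μ ε) (hT : Bornology.IsBounded T)
    (hF : IsPolyClass T F M C) (hν : 2 < ν) (hc : 0 ≤ c) (hK : IsLocKernel K) {Δ : ℕ → ℝ}
    (hΔ0 : ∀ j, 0 < Δ j) {D₀ : ℝ} (hD₀ : ∀ r, ∑ j ∈ Finset.range r, Δ j ≤ D₀) {Cm : ℝ}
    (hCm : 0 < Cm) (Ct : ℝ) (hk : 1 ≤ k) {η : ℝ} (hη : 0 < η) :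
    ∃ Q : ℝ, 0 < Q ∧ ∀ (n : ℕ) (J : ℤ → (ℕ → S) → ℝ) (h : ℝ) (m : ℕ),
      (∀ i : ℤ, 1 ≤ i → i ≤ n → Measurable (J i)) →
      (∀ i : ℤ, 1 ≤ i → i ≤ n → eLpNorm (fun ω => J i (innovPast ε i ω))
        (ENNReal.ofReal (ν * M)) μ ≤ ENNReal.ofReal c) →
      (∀ j, depMeasure μ ε J n (2 * M) j ≤ ENNReal.ofReal (Δ j)) →
      k ≤ n → 0 < h → h ≤ 1 → 1 ≤ n * h → 1 ≤ Real.log n →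
      (m + 1) * (Real.sqrt (Real.log n) * (n : ℝ) ^ (1 / ν)) ≤ Cm * Real.sqrt (n * h) →
      (∀ r, ∑ j ∈ Finset.range r, Δ (m + 1 + j) ≤ Ct * Real.sqrt h) →
      μ {ω | ∃ v ∈ Icc (0 : ℝ) 1, ∃ θ ∈ T,
        Q * (Real.sqrt (n * h) * Real.sqrt (Real.log n)) < |kernelSum K k n h v fun i =>
          F θ (lagWindow k (fun i ω => J i (innovPast ε i ω)) i ω) -
            ∫ ω', F θ (lagWindow k (fun i ω => J i (innovPast ε i ω)) i ω') ∂μ|} ≤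
        ENNReal.ofReal η := by
  obtain ⟨κ', hκ'⟩ := hK.bounded
  obtain ⟨LK, hLK⟩ := hK.lipschitz
  obtain ⟨C₀, hC₀, hnet⟩ := exists_finset_net hT
  set κ := |κ'| + 1 with hκdef
  have hκ0 : 0 < κ := by positivity
  have hκ : ∀ x, |K x| ≤ κ := fun x => (hκ' x).trans ((le_abs_self _).trans (by linarith))
  have hlip : ∀ x y, |K x - K y| ≤ LK * |x - y| := fun x y => by
    simpa [Real.dist_eq] using hLK.dist_le_mul x y
  have hM := hF.one_le
  have hC := hF.pos
  have hν0 : 0 < ν := by linarith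
  set c₁ := 1 + (k * c) ^ M with hc₁
  have hc₁1 : 1 ≤ c₁ := le_add_of_nonneg_right (by positivity)
  -- truncating at `B₀ n^{1/ν}` affects one of the `n` summands with probability at most `η/3`
  set B₀ := 5 * C * c₁ * (1 / (η / 3)) ^ (1 / ν) with hB₀def
  have hB₀ : 0 < B₀ := by positivity
  set Cp := Real.log 4 + 2 + d * Real.log C₀ + 2 * d with hCp
  set R := C * (4 * (1 + 2 * k * c) ^ (M - 1)) with hR
  have hD₀0 : 0 ≤ D₀ := by simpa using hD₀ 0
  have hR0 : 0 ≤ R := by positivity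
  set Q₁ := |4 * κ * B₀ * ((1 + k) * Cm) * Cp + 2 * (R * (k * D₀)) ^ 2 * κ / (B₀ * ((1 + k) * Cm)) +
    3 * κ * Real.sqrt Cp * (R * (k * Ct))| + 1 with hQ₁
  set Q₂ := (LK * (5 * C) + κ * C * d) * (c₁ / (η / 3) + c₁) with hQ₂
  set Q₃ := κ * 2 * ((5 * C * c₁) ^ ν / B₀ ^ (ν - 1)) with hQ₃
  have hQ₂0 : 0 ≤ Q₂ := by positivity
  have hQ₃0 : 0 ≤ Q₃ := by positivity
  refine ⟨Q₂ + Q₁ / (η / 3) + Q₃, by positivity, ?_⟩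
  intro n J h m hJ hmomν hdep hkn hh hh1 hnh hlog hm hmt
  have hn : 0 < n := by omega
  have hn' : (1 : ℝ) ≤ n := by exact_mod_cast hn
  set X : ℤ → Ω → ℝ := fun i ω => J i (innovPast ε i ω) with hX
  have hXm : ∀ i : ℤ, 1 ≤ i → i ≤ n → Measurable (X i) := fun i h1 h2 =>
    (hJ i h1 h2).comp (measurable_innovPast hε.meas i)
  have hZ : ∀ i : ℤ, k ≤ i → i ≤ n → Measurable (lagWindow k X i) := fun i h1 h2 =>
    measurable_pi_lambda _ fun l => hXm _ (by omega) (by omega)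
  have hmomZ : ∀ i : ℤ, k ≤ i → i ≤ n → ∀ l, eLpNorm (fun ω => lagWindow k X i ω l)
      (ENNReal.ofReal (ν * M)) μ ≤ ENNReal.ofReal c := fun i h1 h2 l =>
    hmomν _ (by omega) (by omega)
  have hmom2 : ∀ i : ℤ, 1 ≤ i → i ≤ n → eLpNorm (fun ω => J i (innovPast ε i ω))
      (ENNReal.ofReal (2 * M)) μ ≤ ENNReal.ofReal c := fun i h1 h2 =>
    (eLpNorm_le_eLpNorm_of_exponent_le (ENNReal.ofReal_le_ofReal (by nlinarith))
      (hXm i h1 h2).aestronglyMeasurable).trans (hmomν i h1 h2)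
  set b := (n : ℝ) ^ (1 / ν) with hb
  have hb0 : 0 < b := by positivity
  set Y : ℤ → Ω → ℝ := fun i ω => 1 + l1norm (lagWindow k X i ω) ^ M with hY
  have hYm : ∀ i : ℤ, k ≤ i → i ≤ n → Measurable (Y i) := fun i h1 h2 =>
    measurable_envelope (hZ i h1 h2) M
  set a := Real.sqrt (n * h) with ha
  set l := Real.sqrt (Real.log n) with hl
  have hl1 : 1 ≤ l := Real.one_le_sqrt.2 hlog
  have ha1 : 1 ≤ a := Real.one_le_sqrt.2 hnh
  rcases T.eq_empty_or_nonempty with hTe | hTne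
  · simp [hTe]
  obtain ⟨G, hGT, hGnet, hGcard⟩ := hnet ((n : ℝ) ^ 2) (one_le_pow₀ hn')
  have hGne : Nonempty G := by
    obtain ⟨θ, hθ⟩ := hTne
    obtain ⟨θ', hθ', -⟩ := hGnet θ hθ
    exact ⟨⟨θ', hθ'⟩⟩
  -- the grid of windows and parameters
  let A := Fin (n ^ 2 + 1) × G
  let vA : A → ℝ := fun p => ((p.1 : ℕ) : ℝ) / (n : ℝ) ^ 2
  let θA : A → EuclideanSpace ℝ (Fin d) := fun p => p.2
  have hθA : ∀ p, θA p ∈ T := fun p => hGT p.2.2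
  have hcardA : (Fintype.card A : ℝ) ≤ (n ^ 2 + 1) * (C₀ * n ^ 2) ^ d := by
    simp only [A, Fintype.card_prod, Fintype.card_fin, Fintype.card_coe, Nat.cast_mul]
    push_cast
    gcongr
  have hlogA : Real.log (2 * Fintype.card A) ≤ Cp * Real.log n :=
    log_two_mul_card_le hC₀ hlog hn Fintype.card_pos hcardA
  set U : A → Ω → ℝ := fun p ω => kernelSum K k n h (vA p) fun i =>
    truncate (B₀ * b) (F (θA p) (lagWindow k X i ω)) -
      ∫ ω', truncate (B₀ * b) (F (θA p) (lagWindow k X i ω')) ∂μ with hU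
  have hUm : ∀ p, Measurable (U p) := fun p => by
    refine Finset.measurable_sum _ fun i hi => ?_
    have hi' := Finset.mem_Icc.1 hi
    exact (((measurable_truncate _).comp ((hF.measurable (hθA p)).comp
      (hZ i hi'.1 hi'.2))).sub_const _).const_mul _
  have hmax : ∫⁻ ω, ⨆ p, ‖U p ω‖ₑ ∂μ ≤ ENNReal.ofReal (Q₁ * (a * l)) := by
    refine (lintegral_iSup_kernelSum_truncate_le hε hJ hc hmom2 hF hΔ0 hdep hD₀ hk hkn hK hκ0 hκ hh
      hnh hlog hB₀ hb0 hCm hm hmt vA θA hθA hlogA).trans (ENNReal.ofReal_le_ofReal ?_)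
    exact mul_le_mul_of_nonneg_right ((le_abs_self _).trans (by linarith)) (by positivity)
  have hη3 : 0 < η / 3 := by positivity
  have hE3 := measure_lt_le_of_lintegral (Measurable.iSup fun p => (hUm p).enorm) hη3
    (by positivity : 0 < Q₁ * (a * l)) hmax
  have hE2 := measure_envelope_sum_le hM (by linarith : 1 ≤ ν) hc hk hn hZ hmomZ hη3
  have hE1 := measure_envelope_max_le hM (by linarith : 1 ≤ ν) hc (by positivity : 0 < 5 * C) hk hn
    hZ hmomZ hη3
  refine (measure_mono (t := (⋃ i ∈ Finset.Icc (k : ℤ) n, {ω | B₀ * b / (5 * C) < Y i ω}) ∪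
    ({ω | ENNReal.ofReal (n * c₁ / (η / 3)) < ENNReal.ofReal (∑ i ∈ Finset.Icc (k : ℤ) n, Y i ω)} ∪
      {ω | ENNReal.ofReal (Q₁ * (a * l) / (η / 3)) < ⨆ p, ‖U p ω‖ₑ})) ?_).trans ?_
  · rintro ω ⟨v, hv, θ, hθ, hlt⟩
    by_contra hnot
    simp only [mem_union, mem_iUnion, mem_ofPred_eq, not_or, not_exists, not_lt,
      Finset.mem_Icc, exists_prop, not_and, and_imp] at hnot
    obtain ⟨g1, g2, g3⟩ := hnot
    have hsum0 : 0 ≤ ∑ i ∈ Finset.Icc (k : ℤ) n, Y i ω :=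
      Finset.sum_nonneg fun i _ => zero_le_one.trans (one_le_envelope _)
    rw [ENNReal.ofReal_le_ofReal_iff (by positivity)] at g2
    obtain ⟨θ', hθ'G, hθθ'⟩ := hGnet θ hθ
    obtain ⟨q, hvp⟩ := exists_abs_sub_grid_le hn hv
    let p : A := (q, ⟨θ', hθ'G⟩)
    change |v - vA p| ≤ _ at hvp
    change ‖θ - θA p‖ ≤ _ at hθθ'
    have hUp : |U p ω| ≤ Q₁ * (a * l) / (η / 3) := by
      have := (le_iSup (fun p => ‖U p ω‖ₑ) p).trans g3
      rwa [Real.enorm_eq_ofReal_abs, ENNReal.ofReal_le_ofReal_iff (by positivity)] at this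
    have hmain := abs_kernelSum_centered_le (k := k) hK hκ LK.2 hlip hk hn hh hF
      (by linarith : 1 ≤ ν) hc hZ hmomZ (by positivity : 0 < B₀ * b) (v := v) (v' := vA p) hθ
      (hθA p) (ω := ω) (fun i h1 h2 => by
        have := g1 i h1 h2
        rwa [le_div_iff₀ (by positivity), mul_comm] at this)
    have hgrid := grid_error_le (h := h) (d := d) LK.2 hκ0.le hC.le (by positivity : 0 ≤ c₁) hη3
      hn' hh hnh hvp hθθ' g2 hsum0
    have hbias := truncation_bias_le hκ0.le (by positivity : 0 ≤ (5 * C * c₁) ^ ν) hB₀ hν hn' hh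
      hh1 hnh
    have hal : 1 ≤ a * l := one_le_mul_of_one_le_of_one_le ha1 hl1
    have hal' : a ≤ a * l := le_mul_of_one_le_right (by positivity) hl1
    have : Q₁ * (a * l) / (η / 3) = Q₁ / (η / 3) * (a * l) := by ring
    rw [this] at hUp
    refine absurd hlt (not_lt.2 (hmain.trans ?_))
    rw [add_mul _ _ (a * l), add_mul _ _ (a * l)]
    exact add_le_add (add_le_add (hgrid.trans (le_mul_of_one_le_right hQ₂0 hal)) hUp)
      (hbias.trans (mul_le_mul_of_nonneg_left hal' hQ₃0))
  · refine (measure_union_le _ _).trans ((add_le_add hE1 ((measure_union_le _ _).trans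
      (add_le_add hE2 hE3))).trans (le_of_eq ?_))
    rw [← ENNReal.ofReal_add hη3.le hη3.le, ← ENNReal.ofReal_add hη3.le (by positivity)]
    congr 1
    ring

end UniformConcentration

/-! ### Decay of dependence and admissible bandwidths -/

section Decay

lemma sum_rpow_neg_le {α : ℝ} (hα : 1 < α) (m r : ℕ) :
    ∑ j ∈ Finset.range r, ((m + 1 + j : ℕ) : ℝ) ^ (-α) ≤
      (1 + 1 / (α - 1)) * ((m : ℝ) + 1) ^ (1 - α) := by
  have hm : (1 : ℝ) ≤ (m : ℝ) + 1 := by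
    have := Nat.cast_nonneg (α := ℝ) m
    linarith
  have hm0 : (0 : ℝ) < (m : ℝ) + 1 := by linarith
  have hα1 : 0 < α - 1 := by linarith
  have hanti : AntitoneOn (fun x : ℝ => x ^ (-α)) (Icc ((m : ℝ) + 1) ((m : ℝ) + 1 + r)) :=
    fun x hx y _ hxy => Real.rpow_le_rpow_of_nonpos (by linarith [hx.1]) hxy (by linarith)
  have h1 := hanti.sum_le_integral
  rw [integral_rpow (Or.inr ⟨by linarith, by
    rw [uIcc_of_le (by linarith [Nat.cast_nonneg (α := ℝ) r])]
    exact fun h => by linarith [h.1]⟩)] at h1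
  have h2 : (((m : ℝ) + 1 + r) ^ (-α + 1) - ((m : ℝ) + 1) ^ (-α + 1)) / (-α + 1) ≤
      1 / (α - 1) * ((m : ℝ) + 1) ^ (1 - α) := by
    have h3 : 0 ≤ ((m : ℝ) + 1 + r) ^ (1 - α) := by positivity
    have h4 : -α + 1 = 1 - α := by ring
    have h5 : (((m : ℝ) + 1 + r) ^ (1 - α) - ((m : ℝ) + 1) ^ (1 - α)) / (1 - α) =
        1 / (α - 1) * (((m : ℝ) + 1) ^ (1 - α) - ((m : ℝ) + 1 + r) ^ (1 - α)) := by
      rw [← neg_div_neg_eq, neg_sub, neg_sub]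
      ring
    rw [h4, h5]
    gcongr
    linarith
  have h0 : ((m : ℝ) + 1) ^ (-α) ≤ ((m : ℝ) + 1) ^ (1 - α) :=
    Real.rpow_le_rpow_of_exponent_le hm (by linarith)
  have hr : ∑ j ∈ Finset.range r, ((m + 1 + j : ℕ) : ℝ) ^ (-α) ≤
      ∑ j ∈ Finset.range (r + 1), ((m + 1 + j : ℕ) : ℝ) ^ (-α) :=
    Finset.sum_le_sum_of_subset_of_nonneg (Finset.range_mono (by omega))
      fun j _ _ => by positivity
  rw [Finset.sum_range_succ'] at hr
  refine hr.trans ?_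
  have h6 : ∑ j ∈ Finset.range r, ((m + 1 + (j + 1) : ℕ) : ℝ) ^ (-α) ≤
      1 / (α - 1) * ((m : ℝ) + 1) ^ (1 - α) := by
    refine le_trans (le_of_eq (Finset.sum_congr rfl fun j _ => ?_)) (h1.trans h2)
    push_cast
    ring_nf
  rw [add_mul, one_mul, add_comm]
  refine add_le_add ?_ h6
  simpa using h0

lemma sum_geometric_tail_le {ρ : ℝ} (hρ : 0 < ρ) (hρ1 : ρ < 1) (m r : ℕ) :
    ∑ j ∈ Finset.range r, ρ ^ (m + j) ≤ ρ ^ m / (1 - ρ) := by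
  simp only [pow_add]
  rw [← Finset.mul_sum, div_eq_mul_inv, ← tsum_geometric_of_lt_one hρ.le hρ1]
  exact mul_le_mul_of_nonneg_left ((summable_geometric_of_lt_one hρ.le hρ1).sum_le_tsum _
    fun j _ => by positivity) (by positivity)

/-- The largest admissible block length for truncation at `n^{1/ν}`. -/
lemma sq_blockLength {n : ℕ} {h ν : ℝ} (hn : 0 < n) (hh : 0 < h) (hlog : 0 < Real.log n) :
    (Real.sqrt (n * h) / (Real.sqrt (Real.log n) * (n : ℝ) ^ (1 / ν))) ^ 2 =
      h / (Real.log n / (n : ℝ) ^ (1 - 2 / ν)) := by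
  have hn' : (0 : ℝ) < n := by exact_mod_cast hn
  have h1 : ((n : ℝ) ^ (1 / ν)) ^ 2 = (n : ℝ) ^ (2 / ν) := by
    rw [← Real.rpow_natCast, ← Real.rpow_mul hn'.le]
    congr 1
    push_cast
    ring
  rw [div_pow, mul_pow, Real.sq_sqrt (by positivity), Real.sq_sqrt hlog.le, h1,
    Real.rpow_sub hn', Real.rpow_one]
  have : (0 : ℝ) < (n : ℝ) ^ (2 / ν) := by positivity
  field_simp

/-- Under the assumptions on decay and bandwidth there are block lengths that are admissible for
truncation at `n^{1/ν}`, and beyond which the dependence is of the order `√h`. -/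
theorem exists_blockLength {dep : ℕ → ℕ → ℝ≥0∞} {ν c₀ : ℝ} (hc₀ : 0 < c₀)
    (hdep0 : ∀ n, dep n 0 ≤ ENNReal.ofReal c₀) {h : ℕ → ℝ} (hpos : ∀ n, 0 < h n)
    (hzero : Tendsto h atTop (𝓝 0)) (hnh : Tendsto (fun n : ℕ => (n : ℝ) * h n) atTop atTop)
    (hdecay :
      (∃ κ : ℝ, 0 < κ ∧ ∃ α : ℝ, 1 < α ∧
        (∀ n j : ℕ, 1 ≤ j → dep n j ≤ ENNReal.ofReal (κ * (j : ℝ) ^ (-α))) ∧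
        ∃ c : ℝ, 0 < c ∧ ∀ n : ℕ, 1 ≤ n →
          c * (Real.log n / (n : ℝ) ^ (1 - 2 / ν)) ^ ((α - 1) / α) ≤ h n) ∨
      (∃ κ : ℝ, 0 < κ ∧ ∃ ρ : ℝ, 0 < ρ ∧ ρ < 1 ∧
        (∀ n j : ℕ, 1 ≤ j → dep n j ≤ ENNReal.ofReal (κ * ρ ^ j)) ∧
        ∃ c : ℝ, 0 < c ∧ ∀ n : ℕ, 1 ≤ n →
          c * (Real.log n ^ 3 / (n : ℝ) ^ (1 - 2 / ν)) ≤ h n)) :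
    ∃ Δ : ℕ → ℝ, (∀ j, 0 < Δ j) ∧ (∃ D₀, ∀ r, ∑ j ∈ Finset.range r, Δ j ≤ D₀) ∧
      (∀ n j, dep n j ≤ ENNReal.ofReal (Δ j)) ∧
      ∃ Cm Ct : ℝ, 0 < Cm ∧ ∀ᶠ n : ℕ in atTop, ∃ m : ℕ,
        (m + 1) * (Real.sqrt (Real.log n) * (n : ℝ) ^ (1 / ν)) ≤ Cm * Real.sqrt (n * h n) ∧
        ∀ r, ∑ j ∈ Finset.range r, Δ (m + 1 + j) ≤ Ct * Real.sqrt (h n) := by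
  have hlogt : Tendsto (fun n : ℕ => Real.log n) atTop atTop :=
    Real.tendsto_log_atTop.comp tendsto_natCast_atTop_atTop
  set w : ℕ → ℝ := fun n =>
    Real.sqrt (n * h n) / (Real.sqrt (Real.log n) * (n : ℝ) ^ (1 / ν)) with hw
  -- the block length is a multiple of `w`
  have hblock : ∀ (a : ℝ) (n : ℕ), 0 ≤ a → 0 < n → 0 < Real.log n → 1 ≤ w n →
      ((⌊a * w n⌋₊ : ℝ) + 1) * (Real.sqrt (Real.log n) * (n : ℝ) ^ (1 / ν)) ≤
        (a + 1) * Real.sqrt (n * h n) := by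
    intro a n ha hn hl hwn
    have hn' : (0 : ℝ) < n := by exact_mod_cast hn
    have h1 : (⌊a * w n⌋₊ : ℝ) + 1 ≤ (a + 1) * w n := by
      have := Nat.floor_le (mul_nonneg ha (zero_le_one.trans hwn))
      linarith
    have hq : 0 < Real.sqrt (Real.log n) * (n : ℝ) ^ (1 / ν) :=
      mul_pos (Real.sqrt_pos.2 hl) (by positivity)
    calc _ ≤ (a + 1) * w n * (Real.sqrt (Real.log n) * (n : ℝ) ^ (1 / ν)) := by gcongr
      _ = _ := by rw [hw]; field_simp
  rcases hdecay with ⟨κ, hκ, α, hα, hd, c, hc, hb⟩ | ⟨κ, hκ, ρ, hρ, hρ1, hd, c, hc, hb⟩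
  · have hα0 : 0 < α := by linarith
    have htail : ∀ m r : ℕ, ∑ j ∈ Finset.range r, (if m + 1 + j = 0 then c₀ else
        κ * ((m + 1 + j : ℕ) : ℝ) ^ (-α)) ≤ κ * (1 + 1 / (α - 1)) * ((m : ℝ) + 1) ^ (1 - α) := by
      intro m r
      have : ∀ j, (if m + 1 + j = 0 then c₀ else κ * ((m + 1 + j : ℕ) : ℝ) ^ (-α)) =
          κ * ((m + 1 + j : ℕ) : ℝ) ^ (-α) := fun j => if_neg (by omega)
      simp only [this]
      rw [← Finset.mul_sum, mul_assoc]
      exact mul_le_mul_of_nonneg_left (sum_rpow_neg_le hα m r) hκ.le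
    refine ⟨fun j => if j = 0 then c₀ else κ * (j : ℝ) ^ (-α), fun j => ?_,
      ⟨c₀ + κ * (1 + 1 / (α - 1)), fun r => ?_⟩, fun n j => ?_, 1 + 1,
      κ * (1 + 1 / (α - 1)) * Real.sqrt (c ^ (-α)), by norm_num, ?_⟩
    · dsimp only
      split_ifs with hj
      · exact hc₀
      · have : (0 : ℝ) < j := by exact_mod_cast Nat.pos_of_ne_zero hj
        positivity
    · have h1 := htail 0 r
      simp only [Nat.cast_zero, zero_add, Real.one_rpow, mul_one] at h1
      have hpos' : ∀ j : ℕ, 0 ≤ (if j = 0 then c₀ else κ * (j : ℝ) ^ (-α)) := fun j => by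
        split_ifs
        · exact hc₀.le
        · positivity
      refine (Finset.sum_le_sum_of_subset_of_nonneg (Finset.range_mono (Nat.le_succ r))
        fun j _ _ => hpos' j).trans ?_
      rw [Finset.sum_range_succ', if_pos rfl, add_comm c₀]
      refine add_le_add (le_trans (le_of_eq (Finset.sum_congr rfl fun j _ => ?_)) h1) le_rfl
      rw [add_comm 1 j]
    · dsimp only
      split_ifs with hj
      · rw [hj]; exact hdep0 n
      · exact hd n j (Nat.pos_of_ne_zero hj)
    · have hsmall : ∀ᶠ n in atTop, c ^ (-α) * h n < 1 := by
        have := hzero.const_mul (c ^ (-α))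
        rw [mul_zero] at this
        exact this.eventually (gt_mem_nhds one_pos)
      filter_upwards [eventually_gt_atTop 0, hlogt.eventually_gt_atTop 0, hsmall] with n hn hl hs
      have hn' : (0 : ℝ) < n := by exact_mod_cast hn
      have hh := hpos n
      set r := Real.log n / (n : ℝ) ^ (1 - 2 / ν) with hr
      have hr0 : 0 < r := by positivity
      have hw0 : 0 < w n := div_pos (Real.sqrt_pos.2 (by positivity))
        (mul_pos (Real.sqrt_pos.2 hl) (by positivity))
      have hw2 : w n ^ 2 = h n / r := sq_blockLength hn hh hl
      have hkey : (w n ^ 2) ^ (1 - α) ≤ c ^ (-α) * h n := by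
        have h1 := Real.rpow_le_rpow (by positivity) (hb n hn) hα0.le
        rw [Real.mul_rpow hc.le (by positivity), ← Real.rpow_mul hr0.le,
          div_mul_cancel₀ _ hα0.ne'] at h1
        have h2 : (h n / r) ^ (1 - α) = h n * (r ^ (α - 1) / h n ^ α) := by
          rw [Real.div_rpow hh.le hr0.le, Real.rpow_sub hh, Real.rpow_one,
            show 1 - α = -(α - 1) by ring, Real.rpow_neg hr0.le]
          field_simp
        rw [hw2, h2, mul_comm (c ^ (-α))]
        refine mul_le_mul_of_nonneg_left ?_ hh.le
        rw [div_le_iff₀ (by positivity), Real.rpow_neg hc.le, inv_mul_eq_div,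
          le_div_iff₀ (by positivity), mul_comm]
        exact h1
      have hw1 : 1 ≤ w n := by
        by_contra hlt
        have h1 : w n ^ 2 < 1 := pow_lt_one₀ hw0.le (not_le.1 hlt) two_ne_zero
        have := Real.one_lt_rpow_of_pos_of_lt_one_of_neg (by positivity) h1
          (by linarith : 1 - α < 0)
        linarith
      refine ⟨⌊1 * w n⌋₊, hblock 1 n zero_le_one hn hl hw1, fun r => (htail _ r).trans ?_⟩
      rw [mul_assoc (κ * _)]
      refine mul_le_mul_of_nonneg_left ?_ (by
        have : 0 < α - 1 := by linarith
        positivity)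
      rw [one_mul]
      calc ((⌊w n⌋₊ : ℝ) + 1) ^ (1 - α) ≤ w n ^ (1 - α) :=
            Real.rpow_le_rpow_of_nonpos hw0 (Nat.lt_floor_add_one _).le (by linarith)
        _ = Real.sqrt ((w n ^ 2) ^ (1 - α)) := by
            rw [Real.sqrt_eq_rpow, ← Real.rpow_natCast, ← Real.rpow_mul hw0.le,
              ← Real.rpow_mul hw0.le]
            congr 1
            push_cast
            ring
        _ ≤ Real.sqrt (c ^ (-α) * h n) := Real.sqrt_le_sqrt hkey
        _ = _ := Real.sqrt_mul (by positivity) _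
  · have hlρ : 0 < -Real.log ρ := neg_pos.2 (Real.log_neg hρ hρ1)
    have hsc : 0 < Real.sqrt c := Real.sqrt_pos.2 hc
    have hρ' : 0 < 1 - ρ := by linarith
    have htail : ∀ m r : ℕ, ∑ j ∈ Finset.range r, (if m + 1 + j = 0 then c₀ else
        κ * ρ ^ (m + 1 + j)) ≤ κ / (1 - ρ) * ρ ^ (m + 1) := by
      intro m r
      have : ∀ j, (if m + 1 + j = 0 then c₀ else κ * ρ ^ (m + 1 + j)) =
          κ * ρ ^ (m + 1 + j) := fun j => if_neg (by omega)
      simp only [this]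
      rw [← Finset.mul_sum]
      refine (mul_le_mul_of_nonneg_left (sum_geometric_tail_le hρ hρ1 (m + 1) r) hκ.le).trans
        (le_of_eq ?_)
      ring
    -- this multiple of `w` makes `ρ ^ m` at most `n^{-1/2}`
    set a := 1 / (2 * -Real.log ρ * Real.sqrt c) with ha
    have ha0 : 0 < a := by positivity
    refine ⟨fun j => if j = 0 then c₀ else κ * ρ ^ j, fun j => ?_,
      ⟨c₀ + κ / (1 - ρ) * ρ, fun r => ?_⟩, fun n j => ?_, a + 1,
      κ / (1 - ρ), by positivity, ?_⟩
    · dsimp only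
      split_ifs with hj
      · exact hc₀
      · positivity
    · have h1 := htail 0 r
      simp only [zero_add, pow_one] at h1
      have hpos' : ∀ j : ℕ, 0 ≤ (if j = 0 then c₀ else κ * ρ ^ j) := fun j => by
        split_ifs
        · exact hc₀.le
        · positivity
      refine (Finset.sum_le_sum_of_subset_of_nonneg (Finset.range_mono (Nat.le_succ r))
        fun j _ _ => hpos' j).trans ?_
      rw [Finset.sum_range_succ', if_pos rfl, add_comm c₀]
      refine add_le_add (le_trans (le_of_eq (Finset.sum_congr rfl fun j _ => ?_)) h1) le_rfl
      rw [add_comm 1 j]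
    · dsimp only
      split_ifs with hj
      · rw [hj]; exact hdep0 n
      · exact hd n j (Nat.pos_of_ne_zero hj)
    · filter_upwards [eventually_gt_atTop 0, hlogt.eventually_gt_atTop 0,
        hlogt.eventually_ge_atTop (1 / Real.sqrt c), hnh.eventually_ge_atTop 1] with n hn hl hl' hn1
      have hn' : (0 : ℝ) < n := by exact_mod_cast hn
      have hh := hpos n
      set r := Real.log n / (n : ℝ) ^ (1 - 2 / ν) with hr
      have hr0 : 0 < r := by positivity
      have hw0 : 0 < w n := div_pos (Real.sqrt_pos.2 (by positivity))
        (mul_pos (Real.sqrt_pos.2 hl) (by positivity))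
      have hw2 : w n ^ 2 = h n / r := sq_blockLength hn hh hl
      have hwl : Real.sqrt c * Real.log n ≤ w n := by
        refine (pow_le_pow_iff_left₀ (by positivity) hw0.le two_ne_zero).1 ?_
        rw [hw2, le_div_iff₀ hr0, mul_pow, Real.sq_sqrt hc.le]
        refine le_trans (le_of_eq ?_) (hb n hn)
        rw [hr]
        ring
      have hw1 : 1 ≤ w n := by
        refine le_trans ?_ hwl
        rw [div_le_iff₀ hsc] at hl'
        linarith
      refine ⟨⌊a * w n⌋₊, hblock a n ha0.le hn hl hw1, fun r => (htail _ r).trans ?_⟩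
      refine mul_le_mul_of_nonneg_left ?_ (by positivity)
      have h1 : Real.log n / 2 ≤ (((⌊a * w n⌋₊ + 1 : ℕ)) : ℝ) * -Real.log ρ := by
        have h2 : a * (Real.sqrt c * Real.log n) ≤ ((⌊a * w n⌋₊ + 1 : ℕ) : ℝ) := by
          push_cast
          exact (mul_le_mul_of_nonneg_left hwl ha0.le).trans (Nat.lt_floor_add_one _).le
        refine le_trans (le_of_eq ?_) (mul_le_mul_of_nonneg_right h2 hlρ.le)
        have hne : Real.log ρ ≠ 0 := fun h0 => by simp [h0] at hlρ
        rw [ha]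
        field_simp
      rw [← Real.log_le_log_iff (by positivity) (Real.sqrt_pos.2 hh), Real.log_pow,
        Real.log_sqrt hh.le]
      have h3 := Real.log_nonneg hn1
      rw [Real.log_mul hn'.ne' hh.ne'] at h3
      linarith

end Decay

/-! ### Riemann sums of the kernel -/

section RiemannSum

variable {K : ℝ → ℝ}

lemma IsLocKernel.continuous (hK : IsLocKernel K) : Continuous K := by
  obtain ⟨LK, hLK⟩ := hK.lipschitz
  exact hLK.continuous

lemma IsLocKernel.support_subset_Ioo (hK : IsLocKernel K) :
    Function.support K ⊆ Ioo (-(1 / 2)) (1 / 2) := by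
  rw [← interior_Icc]
  exact hK.continuous.isOpen_support.subset_interior_iff.2 hK.support_subset

/-- The Riemann sum of a kernel over a window inside of `[0, 1]`. The increments of the summands are
of the order `1/(nh)`, and only the design points in a window count. -/
lemma exists_abs_kernelSum_one_sub_le (hK : IsLocKernel K) {k : ℕ} (hk : 1 ≤ k) :
    ∃ C : ℝ, 0 < C ∧ ∀ (n : ℕ) (h v : ℝ), 0 < h → 1 ≤ n * h → k ≤ n → h / 2 ≤ v → v ≤ 1 - h / 2 →
      |kernelSum K k n h v (fun _ => 1) - n * h| ≤ C := by
  obtain ⟨κ, hκ⟩ := hK.bounded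
  obtain ⟨LK, hLK⟩ := hK.lipschitz
  have hlip : ∀ x y, |K x - K y| ≤ LK * |x - y| := fun x y => by
    simpa [Real.dist_eq] using hLK.dist_le_mul x y
  have hκ0 : 0 ≤ κ := (abs_nonneg _).trans (hκ 0)
  refine ⟨4 * LK + k * κ + 1, by positivity, fun n h v hh hnh hkn hv1 hv2 => ?_⟩
  have hn : 0 < n := by
    rcases Nat.eq_zero_or_pos n with h0 | h0
    · rw [h0] at hnh; norm_num at hnh
    · exact h0
  have hn' : (0 : ℝ) < n := by exact_mod_cast hn
  set f : ℝ → ℝ := fun x => K ((x / n - v) / h) with hf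
  have hfc : Continuous f := hK.continuous.comp (by fun_prop)
  have hsupp : Function.support f ⊆ Ioc (((0 : ℕ) : ℝ)) (n : ℝ) := by
    intro x hx
    have h1 := hK.support_subset_Ioo (Function.mem_support.2 hx)
    rw [mem_Ioo, lt_div_iff₀ hh, div_lt_iff₀ hh] at h1
    have h2 : 0 < x / n := by linarith
    have h3 : x / n < 1 := by linarith
    rw [div_lt_one hn'] at h3
    have h4 := (div_pos_iff_of_pos_right hn').1 h2
    exact ⟨by simpa using h4, h3.le⟩
  have hint : ∫ x in (((0 : ℕ) : ℝ))..(n : ℝ), f x = n * h := by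
    rw [intervalIntegral.integral_eq_integral_of_support_subset hsupp]
    calc ∫ x, f x = ∫ x, (fun y => (fun z => K (z / h)) (y - v)) (x / n) := rfl
      _ = |(n : ℝ)| • ∫ y, (fun z => K (z / h)) (y - v) :=
          Measure.integral_comp_div (fun y => (fun z => K (z / h)) (y - v)) (n : ℝ)
      _ = |(n : ℝ)| • ∫ z, K (z / h) := by
          rw [integral_sub_right_eq_self (fun z => K (z / h)) v]
      _ = |(n : ℝ)| • (|h| • ∫ y, K y) := by rw [Measure.integral_comp_div K h]
      _ = n * h := by
          rw [hK.integral_eq_one, abs_of_pos hn', abs_of_pos hh]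
          simp
  rw [← intervalIntegral.sum_integral_adjacent_intervals
    (fun j _ => hfc.intervalIntegrable _ _)] at hint
  -- the cells that meet the support of the kernel lie in a slightly larger window
  set h' := h + 2 / n with hh'
  have hh'0 : 0 < h' := by positivity
  have hcell : ∀ j ∈ Finset.range n, |f ((j + 1 : ℕ) : ℝ) -
      ∫ x in ((j : ℕ) : ℝ)..((j + 1 : ℕ) : ℝ), f x| ≤
        if |((((j : ℤ) + 1 : ℤ) : ℝ) / n - v) / h'| ≤ 1 / 2 then LK / (n * h) else 0 := by
    intro j _
    have h1 : f ((j + 1 : ℕ) : ℝ) = ∫ x in ((j : ℕ) : ℝ)..((j + 1 : ℕ) : ℝ),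
        f ((j + 1 : ℕ) : ℝ) := by
      rw [intervalIntegral.integral_const]
      push_cast
      simp
    rw [h1, ← intervalIntegral.integral_sub (by simp) (hfc.intervalIntegrable _ _)]
    have hb : ∀ x ∈ uIoc ((j : ℕ) : ℝ) ((j + 1 : ℕ) : ℝ), ‖f ((j + 1 : ℕ) : ℝ) - f x‖ ≤
        if |((((j : ℤ) + 1 : ℤ) : ℝ) / n - v) / h'| ≤ 1 / 2 then LK / (n * h) else 0 := by
      intro x hx
      rw [uIoc_of_le (by push_cast; linarith)] at hx
      push_cast at hx ⊢
      have hx' : |((j : ℝ) + 1) - x| ≤ 1 := abs_le.2 ⟨by linarith [hx.2], by linarith [hx.1]⟩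
      split_ifs with hw
      · refine (hlip _ _).trans ?_
        have h2 : (((j : ℝ) + 1) / n - v) / h - (x / n - v) / h = ((j : ℝ) + 1 - x) / (n * h) := by
          field_simp
          ring
        rw [h2, abs_div, abs_of_pos (by positivity : 0 < (n : ℝ) * h), mul_div_assoc']
        gcongr
        exact mul_le_of_le_one_right LK.2 hx'
      · rw [abs_div, abs_of_pos hh'0, not_le, lt_div_iff₀ hh'0] at hw
        have h3 : h / 2 + 1 / n < |((j : ℝ) + 1) / n - v| := by
          refine lt_of_eq_of_lt ?_ hw
          rw [hh']; ring
        have h4 : |((j : ℝ) + 1) / n - x / n| ≤ 1 / n := by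
          rw [← sub_div, abs_div, abs_of_pos hn']
          gcongr
        have h5 : h / 2 < |x / n - v| := by
          have := abs_sub_abs_le_abs_sub (((j : ℝ) + 1) / n - v) (x / n - v)
          rw [show ((j : ℝ) + 1) / n - v - (x / n - v) = ((j : ℝ) + 1) / n - x / n by ring] at this
          linarith
        have h6 : h / 2 < |((j : ℝ) + 1) / n - v| := by
          have : (0 : ℝ) < 1 / n := by positivity
          linarith
        have hz : ∀ y : ℝ, h / 2 < |y| → K (y / h) = 0 := fun y hy => by
          refine hK.eq_zero ?_
          rw [abs_div, abs_of_pos hh, lt_div_iff₀ hh]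
          linarith
        simp only [hf, hz _ h5, hz _ h6, sub_zero, norm_zero, le_refl]
    have := intervalIntegral.norm_integral_le_of_norm_le_const hb
    have hlen : |((j + 1 : ℕ) : ℝ) - (j : ℝ)| = 1 := by push_cast; simp
    rwa [hlen, mul_one, Real.norm_eq_abs] at this
  have hsum1 : |∑ j ∈ Finset.range n, f ((j + 1 : ℕ) : ℝ) - n * h| ≤ 4 * LK := by
    rw [← hint, ← Finset.sum_sub_distrib]
    refine (Finset.abs_sum_le_sum_abs _ _).trans ((Finset.sum_le_sum hcell).trans ?_)
    rw [← Finset.sum_filter, Finset.sum_const, nsmul_eq_mul]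
    have hcard := card_window_le hn hh'0 v ((Finset.range n).image fun j : ℕ => (j : ℤ) + 1)
    rw [Finset.filter_image, Finset.card_image_of_injective _
      (fun a b hab => by simpa using hab)] at hcard
    have h1 : (n : ℝ) * h' + 1 = n * h + 3 := by
      rw [hh']; field_simp; ring
    rw [h1] at hcard
    refine (mul_le_mul_of_nonneg_right hcard (by positivity)).trans ?_
    rw [mul_div_assoc', div_le_iff₀ (by positivity)]
    have := mul_le_mul_of_nonneg_right hnh LK.2
    simp only [NNReal.val_eq_coe] at this
    nlinarith
  have hsum2 : |∑ j ∈ Finset.range n, f ((j + 1 : ℕ) : ℝ) -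
      kernelSum K k n h v (fun _ => 1)| ≤ k * κ := by
    have h1 : kernelSum K k n h v (fun _ => 1) = ∑ i ∈ Finset.Icc (k : ℤ) n, f i := by
      simp [kernelSum, hf]
    have h2 : ∑ j ∈ Finset.range n, f ((j + 1 : ℕ) : ℝ) = ∑ i ∈ Finset.Icc (1 : ℤ) n, f i := by
      refine Finset.sum_bij (fun j _ => (j : ℤ) + 1) ?_ ?_ ?_ ?_
      · intro j hj
        have := Finset.mem_range.1 hj
        rw [Finset.mem_Icc]; omega
      · intro a _ b _ hab; omega
      · intro i hi
        have := Finset.mem_Icc.1 hi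
        exact ⟨(i - 1).toNat, Finset.mem_range.2 (by omega), by omega⟩
      · intro j _
        push_cast
        rfl
    have hsub : Finset.Icc (k : ℤ) n ⊆ Finset.Icc (1 : ℤ) n :=
      Finset.Icc_subset_Icc_left (by exact_mod_cast hk)
    rw [h1, h2, ← Finset.sum_sdiff hsub, add_sub_cancel_right]
    have hcard : (Finset.Icc (1 : ℤ) n \ Finset.Icc (k : ℤ) n).card ≤ k := by
      refine (Finset.card_le_card (t := Finset.Icc (1 : ℤ) k) fun i hi => ?_).trans (by simp)
      simp only [Finset.mem_sdiff, Finset.mem_Icc, not_and, not_le] at hi ⊢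
      omega
    refine (Finset.abs_sum_le_sum_abs _ _).trans
      ((Finset.sum_le_card_nsmul _ _ κ fun i _ => hκ _).trans ?_)
    rw [nsmul_eq_mul]
    exact mul_le_mul_of_nonneg_right (by exact_mod_cast hcard) hκ0
  have := abs_sub_le (kernelSum K k n h v (fun _ => 1)) (∑ j ∈ Finset.range n, f ((j + 1 : ℕ) : ℝ))
    (n * h)
  rw [abs_sub_comm] at hsum2
  linarith

end RiemannSum

/-! ### Bias of the kernel averages -/

section Bias

variable {k n d : ℕ} {T : Set (EuclideanSpace ℝ (Fin d))}
  {F : EuclideanSpace ℝ (Fin d) → (Fin k → ℝ) → ℝ} {M C c CX ς : ℝ}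
  {Ω S : Type*} [MeasurableSpace Ω] [MeasurableSpace S] {μ : Measure Ω} {ε : ℤ → Ω → S}
  {J : ℕ → ℤ → (ℕ → S) → ℝ} {Jt : (ℕ → S) → ℝ → ℝ}

/-- The innovations up to time `i` have the same law for all `i`. -/
lemma identDistrib_innovPast (hε : IsIIDInnovation μ ε) (i : ℤ) :
    IdentDistrib (innovPast ε i) (innovPast ε 0) μ μ := by
  have h1 : ∀ i : ℤ, μ.map (innovPast ε i) = Measure.infinitePi fun _ : ℕ => μ.map (ε 0) := by
    intro i
    have hinj : Function.Injective fun m : ℕ => i - (m : ℤ) := fun a b hab => by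
      have : i - (a : ℤ) = i - (b : ℤ) := hab
      omega
    have := iIndepFun.map_fun_eq_infinitePi_map (X := fun (m : ℕ) ω => ε (i - (m : ℤ)) ω)
      (fun m => hε.meas _) (hε.indep.precomp hinj)
    refine Eq.trans this ?_
    congr 1
    funext m
    exact (hε.identDistrib _).map_eq
  exact ⟨(measurable_innovPast hε.meas i).aemeasurable, (measurable_innovPast hε.meas 0).aemeasurable,
    by rw [h1, h1]⟩

lemma measurable_lagWindow_tilde (hε : IsIIDInnovation μ ε)
    (hloc : IsLocallyStationary μ ε J Jt M CX ς) {v : ℝ} (hv : v ∈ Icc (0 : ℝ) 1) (i : ℤ) :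
    Measurable (lagWindow k (fun i ω => Jt (innovPast ε i ω) v) i) :=
  measurable_pi_lambda _ fun _ => (hloc.meas_Jt v hv).comp (measurable_innovPast hε.meas _)

variable [IsProbabilityMeasure μ]

/-- Expectations of functions of polynomial growth are Lipschitz in `L^{2M}`. -/
lemma IsPolyClass.abs_integral_comp_sub_le (hF : IsPolyClass T F M C)
    {θ : EuclideanSpace ℝ (Fin d)} (hθ : θ ∈ T) {W W' : Ω → Fin k → ℝ} (hW : Measurable W)
    (hW' : Measurable W') (hc : 0 ≤ c)
    (hp : ∀ l, eLpNorm (fun ω => W ω l) (ENNReal.ofReal (2 * M)) μ ≤ ENNReal.ofReal c)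
    (hp' : ∀ l, eLpNorm (fun ω => W' ω l) (ENNReal.ofReal (2 * M)) μ ≤ ENNReal.ofReal c)
    {δ : ℝ} (hδ : 0 ≤ δ) (hd : ∀ l, eLpNorm (fun ω => W ω l - W' ω l) (ENNReal.ofReal (2 * M)) μ ≤
      ENNReal.ofReal δ) :
    |∫ ω, F θ (W ω) ∂μ - ∫ ω, F θ (W' ω) ∂μ| ≤
      C * (4 * (1 + 2 * k * c) ^ (M - 1)) * (k * δ) := by
  have hC := hF.pos
  have hR : 0 ≤ 4 * (1 + 2 * k * c) ^ (M - 1) :=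
    mul_nonneg (by norm_num) (Real.rpow_nonneg (by positivity) _)
  set g : Ω → ℝ := fun ω => l1norm (W ω - W' ω) *
    ((1 + l1norm (W ω) ^ (M - 1)) + (1 + l1norm (W' ω) ^ (M - 1))) with hg
  have hgm : Measurable g := (measurable_l1norm.comp (hW.sub hW')).mul
    ((((measurable_l1norm.comp hW).pow_const _).const_add 1).add
      (((measurable_l1norm.comp hW').pow_const _).const_add 1))
  have hg0 : ∀ ω, 0 ≤ g ω := fun ω => by
    have h1 := Real.rpow_nonneg (l1norm_nonneg (W ω)) (M - 1)
    have h2 := Real.rpow_nonneg (l1norm_nonneg (W' ω)) (M - 1)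
    exact mul_nonneg (l1norm_nonneg _) (by linarith)
  have h1 : eLpNorm g (ENNReal.ofReal 1) μ ≤
      ENNReal.ofReal (4 * (1 + 2 * k * c) ^ (M - 1) * (k * δ)) := by
    rw [ENNReal.ofReal_one]
    refine (eLpNorm_le_eLpNorm_of_exponent_le (by norm_num : (1 : ℝ≥0∞) ≤ 2)
      hgm.aestronglyMeasurable).trans ((eLpNorm_increment_le μ hW hW' hF.one_le hc hp hp').trans ?_)
    rw [ENNReal.ofReal_mul hR]
    gcongr
    refine (Finset.sum_le_sum fun l _ => hd l).trans (le_of_eq ?_)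
    rw [Finset.sum_const, Finset.card_univ, Fintype.card_fin, nsmul_eq_mul,
      ENNReal.ofReal_mul (by positivity), ENNReal.ofReal_natCast]
  obtain ⟨h2, h3⟩ := integrable_rpow_of_eLpNorm_le hgm hg0 one_pos (by positivity) h1
  simp only [Real.rpow_one] at h2 h3
  rw [← integral_sub (hF.integrable_comp hθ hW one_le_two hc hp)
    (hF.integrable_comp hθ hW' one_le_two hc hp')]
  refine (norm_integral_le_of_norm_le (f := fun ω => F θ (W ω) - F θ (W' ω)) (h2.const_mul C)
    (Eventually.of_forall fun ω => hF.lip θ hθ _ _)).trans ?_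
  rw [integral_const_mul, mul_assoc]
  gcongr

omit [IsProbabilityMeasure μ] in
lemma eLpNorm_innovPast (hε : IsIIDInnovation μ ε) (i : ℤ) {g : (ℕ → S) → ℝ} (hg : Measurable g)
    (p : ℝ≥0∞) :
    eLpNorm (fun ω => g (innovPast ε i ω)) p μ = eLpNorm (fun ω => g (innovPast ε 0 ω)) p μ :=
  ((identDistrib_innovPast hε i).comp hg).eLpNorm_eq p

omit [IsProbabilityMeasure μ] in
lemma eLpNorm_lagWindow_tilde_le (hε : IsIIDInnovation μ ε)
    (hloc : IsLocallyStationary μ ε J Jt M CX ς) {v : ℝ} (hv : v ∈ Icc (0 : ℝ) 1) (i : ℤ)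
    (l : Fin k) :
    eLpNorm (fun ω => lagWindow k (fun i ω => Jt (innovPast ε i ω) v) i ω l)
      (ENNReal.ofReal (2 * M)) μ ≤ ENNReal.ofReal CX :=
  (eLpNorm_innovPast hε _ (hloc.meas_Jt v hv) _).trans_le (hloc.moment_tilde v hv)

omit [IsProbabilityMeasure μ] in
lemma eLpNorm_tilde_sub_le (hε : IsIIDInnovation μ ε)
    (hloc : IsLocallyStationary μ ε J Jt M CX ς) {v v' : ℝ} (hv : v ∈ Icc (0 : ℝ) 1)
    (hv' : v' ∈ Icc (0 : ℝ) 1) (i : ℤ) :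
    eLpNorm (fun ω => Jt (innovPast ε i ω) v - Jt (innovPast ε i ω) v')
      (ENNReal.ofReal (2 * M)) μ ≤ ENNReal.ofReal (CX * |v - v'| ^ ς) :=
  (eLpNorm_innovPast hε i (g := fun g => Jt g v - Jt g v')
    ((hloc.meas_Jt v hv).sub (hloc.meas_Jt v' hv')) _).trans_le (hloc.hoelder v hv v' hv')

omit [IsProbabilityMeasure μ] in
/-- The windows of the stationary approximation have the same law at all times. -/
lemma integral_lagWindow_tilde_eq (hε : IsIIDInnovation μ ε)
    (hloc : IsLocallyStationary μ ε J Jt M CX ς) {v : ℝ} (hv : v ∈ Icc (0 : ℝ) 1)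
    {f : (Fin k → ℝ) → ℝ} (hf : Measurable f) (i : ℤ) :
    ∫ ω, f (lagWindow k (fun i ω => Jt (innovPast ε i ω) v) i ω) ∂μ =
      ∫ ω, f (lagWindow k (fun i ω => Jt (innovPast ε i ω) v) 0 ω) ∂μ := by
  let Ψ : (ℕ → S) → Fin k → ℝ := fun g l => Jt (fun m => g ((l : ℕ) + m)) v
  have hΨ : Measurable Ψ := measurable_pi_lambda _ fun l => (hloc.meas_Jt v hv).comp
    (measurable_pi_lambda _ fun m => measurable_pi_apply _)
  have h1 : ∀ i ω, lagWindow k (fun i ω => Jt (innovPast ε i ω) v) i ω = Ψ (innovPast ε i ω) := by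
    intro i ω
    funext l
    have : innovPast ε (i - ((l : ℕ) : ℤ)) ω = fun m => innovPast ε i ω ((l : ℕ) + m) := by
      funext m
      simp only [innovPast]
      rw [show i - ((l : ℕ) : ℤ) - (m : ℤ) = i - (((l : ℕ) + m : ℕ) : ℤ) by push_cast; ring]
    simp only [lagWindow, Ψ, this]
  simp only [h1]
  exact ((identDistrib_innovPast hε i).comp (hf.comp hΨ)).integral_eq

/-- The expectation `E F_θ(Z̃_0(v))` of a function of the stationary approximation. -/
noncomputable def limitMean (μ : Measure Ω) (ε : ℤ → Ω → S) (Jt : (ℕ → S) → ℝ → ℝ)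
    (F : EuclideanSpace ℝ (Fin d) → (Fin k → ℝ) → ℝ) (v : ℝ) (θ : EuclideanSpace ℝ (Fin d)) : ℝ :=
  ∫ ω, F θ (lagWindow k (fun i ω => Jt (innovPast ε i ω) v) 0 ω) ∂μ

lemma abs_limitMean_sub_le (hε : IsIIDInnovation μ ε)
    (hloc : IsLocallyStationary μ ε J Jt M CX ς) (hF : IsPolyClass T F M C) {v v' : ℝ}
    (hv : v ∈ Icc (0 : ℝ) 1) (hv' : v' ∈ Icc (0 : ℝ) 1) {θ : EuclideanSpace ℝ (Fin d)}
    (hθ : θ ∈ T) :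
    |limitMean μ ε Jt F v θ - limitMean μ ε Jt F v' θ| ≤
      C * (4 * (1 + 2 * k * CX) ^ (M - 1)) * (k * (CX * |v - v'| ^ ς)) :=
  have hCX := hloc.CX_pos
  hF.abs_integral_comp_sub_le hθ (measurable_lagWindow_tilde hε hloc hv 0)
    (measurable_lagWindow_tilde hε hloc hv' 0) hCX.le
    (eLpNorm_lagWindow_tilde_le hε hloc hv 0) (eLpNorm_lagWindow_tilde_le hε hloc hv' 0)
    (by positivity) fun _ => eLpNorm_tilde_sub_le hε hloc hv hv' _

lemma abs_limitMean_sub_le_norm (hε : IsIIDInnovation μ ε)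
    (hloc : IsLocallyStationary μ ε J Jt M CX ς) (hF : IsPolyClass T F M C) {v : ℝ}
    (hv : v ∈ Icc (0 : ℝ) 1) {θ θ' : EuclideanSpace ℝ (Fin d)} (hθ : θ ∈ T) (hθ' : θ' ∈ T) :
    |limitMean μ ε Jt F v θ - limitMean μ ε Jt F v θ'| ≤
      C * (1 + (k * CX) ^ M) * ‖θ - θ'‖ := by
  have hCX := hloc.CX_pos
  have hW := measurable_lagWindow_tilde (k := k) hε hloc hv 0
  have hp := eLpNorm_lagWindow_tilde_le (k := k) hε hloc hv 0
  obtain ⟨h1, h2⟩ := integral_envelope_le hW hF.one_le one_le_two hCX.le hp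
  rw [limitMean, limitMean, ← integral_sub (hF.integrable_comp hθ hW one_le_two hCX.le hp)
    (hF.integrable_comp hθ' hW one_le_two hCX.le hp)]
  refine (norm_integral_le_of_norm_le (f := fun ω =>
    F θ (lagWindow k (fun i ω => Jt (innovPast ε i ω) v) 0 ω) -
      F θ' (lagWindow k (fun i ω => Jt (innovPast ε i ω) v) 0 ω))
    ((h1.const_mul C).mul_const ‖θ - θ'‖)
    (Eventually.of_forall fun ω => hF.param θ hθ θ' hθ' _)).trans ?_
  rw [integral_mul_const, integral_const_mul]
  have := hF.pos
  gcongr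

lemma abs_limitMean_le (hε : IsIIDInnovation μ ε)
    (hloc : IsLocallyStationary μ ε J Jt M CX ς) (hF : IsPolyClass T F M C) {v : ℝ}
    (hv : v ∈ Icc (0 : ℝ) 1) {θ : EuclideanSpace ℝ (Fin d)} (hθ : θ ∈ T) :
    |limitMean μ ε Jt F v θ| ≤ 5 * C * (1 + (k * CX) ^ M) := by
  have hCX := hloc.CX_pos
  have hW := measurable_lagWindow_tilde (k := k) hε hloc hv 0
  have hp := eLpNorm_lagWindow_tilde_le (k := k) hε hloc hv 0
  obtain ⟨h1, h2⟩ := integral_envelope_le hW hF.one_le one_le_two hCX.le hp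
  refine (norm_integral_le_of_norm_le (f := fun ω =>
    F θ (lagWindow k (fun i ω => Jt (innovPast ε i ω) v) 0 ω)) (h1.const_mul (5 * C))
    (Eventually.of_forall fun ω => hF.growth hθ _)).trans ?_
  rw [integral_const_mul]
  have := hF.pos
  gcongr

/-- Within the window at `v` the expectations differ by `O(h^ς)` from those of the stationary
approximation at `v`. -/
lemma abs_integral_sub_limitMean_le (hε : IsIIDInnovation μ ε)
    (hloc : IsLocallyStationary μ ε J Jt M CX ς) (hF : IsPolyClass T F M C) {h v : ℝ}
    (hh : 0 < h) (hnh : 1 ≤ n * h) (hv : v ∈ Icc (0 : ℝ) 1) {θ : EuclideanSpace ℝ (Fin d)}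
    (hθ : θ ∈ T) {i : ℤ} (hki : k ≤ i) (hin : i ≤ n) (hi : |((i : ℝ) / n - v) / h| ≤ 1 / 2) :
    |∫ ω, F θ (lagWindow k (fun i ω => J n i (innovPast ε i ω)) i ω) ∂μ -
        limitMean μ ε Jt F v θ| ≤
      C * (4 * (1 + 2 * k * CX) ^ (M - 1)) * (k * (CX * (2 + k) * h ^ ς)) := by
  have hCX := hloc.CX_pos
  have hς := hloc.hoelder_pos
  have hn' : (0 : ℝ) < n := by
    rcases Nat.eq_zero_or_pos n with h0 | h0
    · rw [h0] at hnh; norm_num at hnh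
    · exact_mod_cast h0
  have hnh' : 1 / (n : ℝ) ≤ h := by
    rw [div_le_iff₀ hn']; linarith
  have hM := hF.one_le
  rw [limitMean, ← integral_lagWindow_tilde_eq hε hloc hv (hF.measurable hθ) i]
  refine hF.abs_integral_comp_sub_le hθ (measurable_pi_lambda _ fun l =>
    (hloc.meas_J n _ (by omega) (by omega)).comp (measurable_innovPast hε.meas _))
    (measurable_lagWindow_tilde hε hloc hv i) hCX.le
    (fun l => hloc.moment n _ (by omega) (by omega)) (eLpNorm_lagWindow_tilde_le hε hloc hv i)
    (by positivity) fun l => ?_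
  have hl := l.2
  have h1 : (1 : ℤ) ≤ i - ((l : ℕ) : ℤ) := by omega
  have h2 : i - ((l : ℕ) : ℤ) ≤ n := by omega
  set u : ℝ := ((i - ((l : ℕ) : ℤ) : ℤ) : ℝ) / n with hu
  have hu1 : u ∈ Icc (0 : ℝ) 1 := by
    have h1' : (1 : ℝ) ≤ ((i - ((l : ℕ) : ℤ) : ℤ) : ℝ) := by exact_mod_cast h1
    have h2' : ((i - ((l : ℕ) : ℤ) : ℤ) : ℝ) ≤ n := by exact_mod_cast h2
    exact ⟨by positivity, (div_le_one hn').2 h2'⟩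
  have hm1 : Measurable fun ω => J n (i - ((l : ℕ) : ℤ)) (innovPast ε (i - ((l : ℕ) : ℤ)) ω) :=
    (hloc.meas_J n _ h1 h2).comp (measurable_innovPast hε.meas _)
  have hm2 : ∀ w ∈ Icc (0 : ℝ) 1, Measurable fun ω => Jt (innovPast ε (i - ((l : ℕ) : ℤ)) ω) w :=
    fun w hw => (hloc.meas_Jt w hw).comp (measurable_innovPast hε.meas _)
  have hp1 : 1 ≤ ENNReal.ofReal (2 * M) := by
    rw [← ENNReal.ofReal_one]
    exact ENNReal.ofReal_le_ofReal (by linarith)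
  have hnς : (n : ℝ) ^ (-ς) ≤ h ^ ς := by
    rw [Real.rpow_neg hn'.le, ← Real.inv_rpow hn'.le, ← one_div]
    exact Real.rpow_le_rpow (by positivity) hnh' hς.le
  have huv : |u - v| ≤ (1 + k) * h := by
    have h3 : |(i : ℝ) / n - v| ≤ h / 2 := by
      rw [abs_div, abs_of_pos hh, div_le_iff₀ hh] at hi
      linarith
    have h4 : u - v = ((i : ℝ) / n - v) - ((l : ℕ) : ℝ) * (1 / n) := by
      rw [hu]; push_cast; ring
    have h5 : ((l : ℕ) : ℝ) * (1 / n) ≤ k * h := by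
      have : ((l : ℕ) : ℝ) ≤ k := by exact_mod_cast hl.le
      gcongr
    have h6 : (0 : ℝ) ≤ ((l : ℕ) : ℝ) * (1 / n) := by positivity
    rw [h4]
    have h7 := abs_le.1 h3
    rw [abs_le]
    constructor <;> nlinarith [h7.1, h7.2]
  have huvς : |u - v| ^ ς ≤ (1 + k) * h ^ ς := by
    refine (Real.rpow_le_rpow (abs_nonneg _) huv hς.le).trans ?_
    rw [Real.mul_rpow (by positivity) hh.le]
    gcongr
    have : (1 : ℝ) ≤ 1 + k := by
      have := Nat.cast_nonneg (α := ℝ) k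
      linarith
    simpa using Real.rpow_le_rpow_of_exponent_le this hloc.hoelder_le_one
  have h3 : (fun ω => lagWindow k (fun i ω => J n i (innovPast ε i ω)) i ω l -
      lagWindow k (fun i ω => Jt (innovPast ε i ω) v) i ω l) =
      (fun ω => J n (i - ((l : ℕ) : ℤ)) (innovPast ε (i - ((l : ℕ) : ℤ)) ω) -
        Jt (innovPast ε (i - ((l : ℕ) : ℤ)) ω) u) +
      fun ω => Jt (innovPast ε (i - ((l : ℕ) : ℤ)) ω) u -
        Jt (innovPast ε (i - ((l : ℕ) : ℤ)) ω) v := by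
    funext ω
    simp only [lagWindow, Pi.add_apply]
    ring
  refine (congrArg (fun f => eLpNorm f (ENNReal.ofReal (2 * M)) μ) h3).trans_le ?_
  refine (eLpNorm_add_le (hm1.sub (hm2 u hu1)).aestronglyMeasurable
    ((hm2 u hu1).sub (hm2 v hv)).aestronglyMeasurable hp1).trans
    ((add_le_add (hloc.approx n _ h1 h2) (eLpNorm_tilde_sub_le hε hloc hu1 hv _)).trans ?_)
  rw [← ENNReal.ofReal_add (by positivity) (by positivity)]
  refine ENNReal.ofReal_le_ofReal ?_
  calc _ ≤ CX * h ^ ς + CX * ((1 + k) * h ^ ς) := by gcongr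
    _ = _ := by ring

/-- The bias of the kernel sum around a constant that is the limit of the expectations. -/
lemma exists_abs_kernelSum_integral_sub_le (hε : IsIIDInnovation μ ε)
    (hloc : IsLocallyStationary μ ε J Jt M CX ς) (hF : IsPolyClass T F M C) {K : ℝ → ℝ}
    (hK : IsLocKernel K) : ∃ Q : ℝ, 0 < Q ∧ ∀ (n : ℕ) (h v : ℝ), 0 < h → 1 ≤ n * h →
      v ∈ Icc (0 : ℝ) 1 → ∀ θ ∈ T,
      |kernelSum K k n h v fun i =>
        ∫ ω, F θ (lagWindow k (fun i ω => J n i (innovPast ε i ω)) i ω) ∂μ -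
          limitMean μ ε Jt F v θ| ≤ Q * (n * h) * h ^ ς := by
  obtain ⟨κ, hκ⟩ := hK.bounded
  have hκ0 : 0 ≤ κ := (abs_nonneg _).trans (hκ 0)
  have hCX := hloc.CX_pos
  have hC := hF.pos
  set R := C * (4 * (1 + 2 * k * CX) ^ (M - 1)) * (k * (CX * (2 + k))) with hR
  have hR0 : 0 ≤ R := by positivity
  refine ⟨2 * κ * R + 1, by positivity, fun n h v hh hnh hv θ hθ => ?_⟩
  have hn : 0 < n := by
    rcases Nat.eq_zero_or_pos n with h0 | h0
    · rw [h0] at hnh; norm_num at hnh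
    · exact h0
  have hhς : 0 ≤ h ^ ς := by positivity
  refine (abs_kernelSum_le hK hκ hn hh v (b := R * h ^ ς) (by positivity)
    fun i h1 h2 h3 => ?_).trans ?_
  · refine (abs_integral_sub_limitMean_le hε hloc hF hh hnh hv hθ h1 h2 h3).trans (le_of_eq ?_)
    rw [hR]; ring
  · calc κ * (n * h + 1) * (R * h ^ ς) ≤ κ * (n * h + n * h) * (R * h ^ ς) := by gcongr
      _ = 2 * κ * R * (n * h) * h ^ ς := by ring
      _ ≤ _ := by gcongr; linarith

end Bias

/-! ### Derivatives of the objective function -/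

section Derivatives

variable {d : ℕ}

lemma clm_eq_sum_proj (L : EuclideanSpace ℝ (Fin d) →L[ℝ] ℝ) :
    L = ∑ b, L (EuclideanSpace.single b 1) • EuclideanSpace.proj b := by
  ext x
  have hx : ∑ b, x b • EuclideanSpace.single b (1 : ℝ) = x := by
    simpa using (EuclideanSpace.basisFun (Fin d) ℝ).sum_repr x
  conv_lhs => rw [← hx, map_sum]
  simp [mul_comm]

lemma gradient_apply_eq (f : EuclideanSpace ℝ (Fin d) → ℝ) (θ : EuclideanSpace ℝ (Fin d))
    (a : Fin d) : gradient f θ a = fderiv ℝ f θ (EuclideanSpace.single a 1) := by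
  have h1 : inner ℝ (gradient f θ) (EuclideanSpace.single a 1) =
      fderiv ℝ f θ (EuclideanSpace.single a 1) := by
    rw [gradient, InnerProductSpace.toDual_symm_apply]
  rw [← h1, EuclideanSpace.inner_single_right]
  simp

lemma nablaTensor_zero_apply (f : EuclideanSpace ℝ (Fin d) → ℝ) (θ : EuclideanSpace ℝ (Fin d))
    (a : Fin 0 → Fin d) : nablaTensor 0 f θ a = f θ := by
  simp [nablaTensor]

lemma nablaTensor_one_apply (f : EuclideanSpace ℝ (Fin d) → ℝ) (θ : EuclideanSpace ℝ (Fin d))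
    (a : Fin 1 → Fin d) : nablaTensor 1 f θ a = fderiv ℝ f θ (EuclideanSpace.single (a 0) 1) := by
  rw [nablaTensor, iteratedFDeriv_one_apply]

lemma nablaTensor_two_apply (f : EuclideanSpace ℝ (Fin d) → ℝ) (θ : EuclideanSpace ℝ (Fin d))
    (a : Fin 2 → Fin d) : nablaTensor 2 f θ a = fderiv ℝ (fderiv ℝ f) θ
      (EuclideanSpace.single (a 0) 1) (EuclideanSpace.single (a 1) 1) := by
  rw [nablaTensor, iteratedFDeriv_two_apply]

/-- The first partial derivatives, as the total derivative. -/
lemma hasFDerivAt_of_contDiffOn {f : EuclideanSpace ℝ (Fin d) → ℝ}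
    {U : Set (EuclideanSpace ℝ (Fin d))} (hU : IsOpen U) (hf : ContDiffOn ℝ 2 f U)
    {θ : EuclideanSpace ℝ (Fin d)} (hθ : θ ∈ U) :
    HasFDerivAt f (∑ b, nablaTensor 1 f θ ![b] • EuclideanSpace.proj (𝕜 := ℝ) b) θ := by
  have h1 := ((hf.contDiffAt (hU.mem_nhds hθ)).differentiableAt two_ne_zero).hasFDerivAt
  rw [clm_eq_sum_proj (fderiv ℝ f θ)] at h1
  simpa only [nablaTensor_one_apply, Matrix.cons_val_zero] using h1

/-- The second partial derivatives, as the total derivatives of the first ones. -/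
lemma hasFDerivAt_nablaTensor_one {f : EuclideanSpace ℝ (Fin d) → ℝ}
    {U : Set (EuclideanSpace ℝ (Fin d))} (hU : IsOpen U) (hf : ContDiffOn ℝ 2 f U)
    {θ : EuclideanSpace ℝ (Fin d)} (hθ : θ ∈ U) (a : Fin d) :
    HasFDerivAt (fun ϑ => nablaTensor 1 f ϑ ![a])
      (∑ b, nablaTensor 2 f θ ![b, a] • EuclideanSpace.proj (𝕜 := ℝ) b) θ := by
  have h1 : ContDiffAt ℝ 1 (fderiv ℝ f) θ :=
    (hf.contDiffAt (hU.mem_nhds hθ)).fderiv_right (by norm_num)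
  have h2 := (h1.differentiableAt one_ne_zero).hasFDerivAt.clm_apply
    (hasFDerivAt_const (EuclideanSpace.single a (1 : ℝ)) θ)
  rw [clm_eq_sum_proj (_ + _)] at h2
  simpa [nablaTensor_one_apply, nablaTensor_two_apply] using h2

variable {k n : ℕ} {Ω : Type*} {K : ℝ → ℝ} {h v : ℝ} {X : ℤ → Ω → ℝ} {ω : Ω}
  {ℓ : EuclideanSpace ℝ (Fin d) → (Fin k → ℝ) → ℝ}

lemma locObjective_eq (θ : EuclideanSpace ℝ (Fin d)) :
    locObjective K ℓ X n h v ω θ =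
      1 / (n * h) * kernelSum K k n h v fun i => ℓ θ (lagWindow k X i ω) := by
  rw [locObjective, kernelSum, Finset.mul_sum, Finset.mul_sum]
  refine Finset.sum_congr rfl fun i _ => ?_
  rw [scaledKernel, one_div_mul_eq_div, one_div_mul_eq_div, one_div_mul_eq_div]
  field_simp

/-- A kernel sum can be differentiated term by term. -/
lemma hasFDerivAt_kernelSum {g : EuclideanSpace ℝ (Fin d) → ℤ → ℝ} {θ : EuclideanSpace ℝ (Fin d)}
    {g' : Fin d → ℤ → ℝ}
    (hg : ∀ i, HasFDerivAt (fun ϑ => g ϑ i)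
      (∑ b, g' b i • EuclideanSpace.proj (𝕜 := ℝ) b) θ) (c : ℝ) :
    HasFDerivAt (fun ϑ => c * kernelSum K k n h v (g ϑ))
      (∑ b, (c * kernelSum K k n h v (g' b)) • EuclideanSpace.proj (𝕜 := ℝ) b) θ := by
  have h1 : HasFDerivAt (fun ϑ => c * kernelSum K k n h v (g ϑ))
      (c • ∑ i ∈ Finset.Icc (k : ℤ) n, K (((i : ℝ) / n - v) / h) •
        ∑ b, g' b i • EuclideanSpace.proj (𝕜 := ℝ) b) θ := by
    unfold kernelSum
    exact (HasFDerivAt.fun_sum fun i _ => (hg i).const_mul _).const_mul c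
  convert h1 using 1
  simp only [kernelSum, Finset.smul_sum, Finset.mul_sum, Finset.sum_smul, mul_smul]
  rw [Finset.sum_comm]

lemma gradient_locObjective {Θ : Set (EuclideanSpace ℝ (Fin d))}
    (hdiff : ∀ z, ContDiffOn ℝ 2 (fun θ => ℓ θ z) (interior Θ)) {θ : EuclideanSpace ℝ (Fin d)}
    (hθ : θ ∈ interior Θ) (a : Fin d) :
    gradient (locObjective K ℓ X n h v ω) θ a = 1 / (n * h) * kernelSum K k n h v fun i =>
      nablaTensor 1 (fun ϑ => ℓ ϑ (lagWindow k X i ω)) θ ![a] := by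
  have h1 := hasFDerivAt_kernelSum (K := K) (k := k) (n := n) (h := h) (v := v)
    (g := fun ϑ i => ℓ ϑ (lagWindow k X i ω))
    (fun i => hasFDerivAt_of_contDiffOn isOpen_interior (hdiff (lagWindow k X i ω)) hθ)
    (1 / (n * h))
  have h2 : HasFDerivAt (locObjective K ℓ X n h v ω) _ θ :=
    h1.congr_of_eventuallyEq (Eventually.of_forall fun ϑ => locObjective_eq ϑ)
  rw [gradient_apply_eq, h2.fderiv]
  simp

end Derivatives

/-! ### The score and the Hessian in the limit -/

section Score

variable {d k : ℕ} {Θ : Set (EuclideanSpace ℝ (Fin d))}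
  {ℓ : EuclideanSpace ℝ (Fin d) → (Fin k → ℝ) → ℝ} {M : ℝ}

/-- The assumptions on the tensors of derivatives, entry by entry. -/
lemma isPolyClass_nablaTensor (hM : 1 ≤ M) {LF : Fin k → ℝ} {CR Cf CΘ : ℝ} (hCΘ : 0 < CΘ) {j : ℕ}
    (hA1 : IsLRCClass
      {f | ∃ θ ∈ nablaDomain Θ j, f = fun z => nablaTensor j (fun θ' => ℓ θ' z) θ}
      LF 1 (fun z => 1 + l1norm z ^ (M - 1)) CR Cf)
    (hA2 : ∀ z : Fin k → ℝ, ∀ θ ∈ nablaDomain Θ j, ∀ θ' ∈ nablaDomain Θ j,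
      ‖nablaTensor j (fun ϑ => ℓ ϑ z) θ - nablaTensor j (fun ϑ => ℓ ϑ z) θ'‖
        ≤ CΘ * (1 + l1norm z ^ M) * ‖θ - θ'‖) (a : Fin j → Fin d) :
    IsPolyClass (nablaDomain Θ j) (fun θ z => nablaTensor j (fun ϑ => ℓ ϑ z) θ a) M
      (∑ i, LF i + Cf + CΘ) := by
  have hL : 0 ≤ ∑ i, LF i := Finset.sum_nonneg fun i _ => hA1.L_nonneg i
  have hCf := hA1.Cf_pos
  refine ⟨hM, by linarith, fun θ hθ z z' => ?_, fun θ hθ => ?_, fun θ hθ θ' hθ' z => ?_⟩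
  · have h1 := (norm_le_pi_norm (nablaTensor j (fun ϑ => ℓ ϑ z) θ -
      nablaTensor j (fun ϑ => ℓ ϑ z') θ) a).trans (hA1.hoelder _ ⟨θ, hθ, rfl⟩ z z')
    refine h1.trans ?_
    rw [← mul_assoc]
    have h2 := Real.rpow_nonneg (l1norm_nonneg z) (M - 1)
    have h3 := Real.rpow_nonneg (l1norm_nonneg z') (M - 1)
    refine mul_le_mul_of_nonneg_right ?_ (by linarith)
    have h4 : ∀ i, |z i - z' i| ≤ l1norm (z - z') := fun i =>
      Finset.single_le_sum (f := fun i => |(z - z') i|) (fun i _ => abs_nonneg _)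
        (Finset.mem_univ i)
    calc ∑ i, LF i * |z i - z' i| ^ (1 : ℝ) ≤ ∑ i, LF i * l1norm (z - z') :=
          Finset.sum_le_sum fun i _ => by
            rw [Real.rpow_one]
            exact mul_le_mul_of_nonneg_left (h4 i) (hA1.L_nonneg i)
      _ = (∑ i, LF i) * l1norm (z - z') := by rw [Finset.sum_mul]
      _ ≤ _ := mul_le_mul_of_nonneg_right (by linarith) (l1norm_nonneg _)
  · have h1 := (norm_le_pi_norm (nablaTensor j (fun ϑ => ℓ ϑ 0) θ) a).trans
      (hA1.zero_le _ ⟨θ, hθ, rfl⟩)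
    exact h1.trans (by linarith)
  · have h1 := (norm_le_pi_norm (nablaTensor j (fun ϑ => ℓ ϑ z) θ -
      nablaTensor j (fun ϑ => ℓ ϑ z) θ') a).trans (hA2 z θ hθ θ' hθ')
    refine h1.trans ?_
    have h2 := Real.rpow_nonneg (l1norm_nonneg z) M
    gcongr
    linarith

variable {Ω S : Type*} [MeasurableSpace Ω] [MeasurableSpace S] {μ : Measure Ω}
  [IsProbabilityMeasure μ] {ε : ℤ → Ω → S} {J : ℕ → ℤ → (ℕ → S) → ℝ} {Jt : (ℕ → S) → ℝ → ℝ}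
  {CX ς : ℝ}

/-- The expected score vanishes at an interior minimizer of the expected loss. -/
lemma limitMean_nablaTensor_one_eq_zero (hε : IsIIDInnovation μ ε)
    (hloc : IsLocallyStationary μ ε J Jt M CX ς)
    (hdiff : ∀ z, ContDiffOn ℝ 2 (fun θ => ℓ θ z) (interior Θ)) {C C' : ℝ} {a : Fin d}
    (hF : IsPolyClass Θ ℓ M C)
    (hF' : IsPolyClass (interior Θ) (fun θ z => nablaTensor 1 (fun ϑ => ℓ ϑ z) θ ![a]) M C')
    {v : ℝ} (hv : v ∈ Icc (0 : ℝ) 1) {θ : EuclideanSpace ℝ (Fin d)} (hθ : θ ∈ interior Θ)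
    (hmin : IsMinOn (limitMean μ ε Jt ℓ v) Θ θ) :
    limitMean μ ε Jt (fun θ z => nablaTensor 1 (fun ϑ => ℓ ϑ z) θ ![a]) v θ = 0 := by
  have hCX := hloc.CX_pos
  set W : Ω → Fin k → ℝ := lagWindow k (fun i ω => Jt (innovPast ε i ω) v) 0 with hWdef
  have hW : Measurable W := measurable_lagWindow_tilde hε hloc hv 0
  have hp := eLpNorm_lagWindow_tilde_le (k := k) hε hloc hv 0
  set e : EuclideanSpace ℝ (Fin d) := EuclideanSpace.single a 1 with he
  set p : ℝ → EuclideanSpace ℝ (Fin d) := fun t => θ + t • e with hpdef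
  have hpc : Continuous p := by fun_prop
  have hp0 : p 0 = θ := by simp [hpdef]
  have hpd : ∀ t, HasDerivAt p e t := fun t => by
    have := ((hasDerivAt_id t).smul_const e).const_add θ
    rw [one_smul] at this
    exact this
  have hs : p ⁻¹' interior Θ ∈ 𝓝 (0 : ℝ) :=
    (isOpen_interior.preimage hpc).mem_nhds (by rwa [mem_preimage, hp0])
  have hder : ∀ t ∈ p ⁻¹' interior Θ, ∀ z, HasDerivAt (fun t => ℓ (p t) z)
      (nablaTensor 1 (fun ϑ => ℓ ϑ z) (p t) ![a]) t := by
    intro t ht z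
    have h1 := ((hdiff z).contDiffAt (isOpen_interior.mem_nhds ht)).differentiableAt two_ne_zero
    have h2 := h1.hasFDerivAt.comp_hasDerivAt t (hpd t)
    rw [nablaTensor_one_apply]
    exact h2
  have hint := hasDerivAt_integral_of_dominated_loc_of_deriv_le (μ := μ)
    (F := fun t ω => ℓ (p t) (W ω)) (x₀ := (0 : ℝ)) hs
    (Filter.mem_of_superset hs fun t ht =>
      ((hF.measurable (interior_subset ht)).comp hW).aestronglyMeasurable)
    (hF.integrable_comp (interior_subset (by rwa [hp0])) hW one_le_two hCX.le hp)
    (F' := fun t ω => nablaTensor 1 (fun ϑ => ℓ ϑ (W ω)) (p t) ![a])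
    (bound := fun ω => 5 * C' * (1 + l1norm (W ω) ^ M))
    (((hF'.measurable (by rwa [hp0])).comp hW).aestronglyMeasurable)
    (Eventually.of_forall fun ω t ht => hF'.growth ht (W ω))
    ((integral_envelope_le hW hF.one_le one_le_two hCX.le hp).1.const_mul _)
    (Eventually.of_forall fun ω t ht => hder t ht (W ω))
  have hlocmin : IsLocalMin (fun t => ∫ ω, ℓ (p t) (W ω) ∂μ) 0 := by
    filter_upwards [hs] with t ht
    have := hmin (interior_subset ht : p t ∈ Θ)
    simp only [hp0]
    exact this
  have := hlocmin.hasDerivAt_eq_zero hint.2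
  rwa [hp0] at this

end Score

/-! ### Linearization of the estimating equation -/

section Linearization

variable {d : ℕ}

lemma norm_le_sum_abs (x : EuclideanSpace ℝ (Fin d)) : ‖x‖ ≤ ∑ a, |x a| := by
  rw [EuclideanSpace.norm_eq]
  refine Real.sqrt_le_iff.2 ⟨Finset.sum_nonneg fun _ _ => abs_nonneg _, ?_⟩
  simp only [Real.norm_eq_abs]
  exact Finset.sum_sq_le_sq_sum_of_nonneg fun a _ => abs_nonneg (x a)

/-- If the derivative of `G` is close to a symmetric matrix `A` along the segment from `θ₀` to a zero
`θ` of `G`, then `A (θ - θ₀)` is close to `-G(θ₀)`. -/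
lemma abs_add_mulVec_le {G : Fin d → EuclideanSpace ℝ (Fin d) → ℝ}
    {H : Fin d → Fin d → EuclideanSpace ℝ (Fin d) → ℝ} {A : Matrix (Fin d) (Fin d) ℝ}
    (hA : A.IsHermitian) {θ₀ θ : EuclideanSpace ℝ (Fin d)} {q : ℝ}
    (hG : ∀ a, ∀ ϑ ∈ segment ℝ θ₀ θ, HasFDerivAt (G a)
      (∑ b, H b a ϑ • EuclideanSpace.proj (𝕜 := ℝ) b) ϑ)
    (hH : ∀ a b, ∀ ϑ ∈ segment ℝ θ₀ θ, |H b a ϑ - A b a| ≤ q) (hzero : ∀ a, G a θ = 0)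
    (a : Fin d) : |G a θ₀ + (A.mulVec (θ - θ₀).ofLp) a| ≤ d * q * ‖θ - θ₀‖ := by
  have h1 := Convex.norm_image_sub_le_of_norm_hasFDerivWithin_le' (𝕜 := ℝ) (f := G a)
    (φ := ∑ b, A b a • EuclideanSpace.proj (𝕜 := ℝ) b) (C := d * q)
    (fun ϑ hϑ => (hG a ϑ hϑ).hasFDerivWithinAt) (fun ϑ hϑ => ?_)
    (convex_segment θ₀ θ) (left_mem_segment ℝ θ₀ θ) (right_mem_segment ℝ θ₀ θ)
  · rw [hzero a, Real.norm_eq_abs, abs_sub_comm] at h1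
    refine le_trans (le_of_eq ?_) h1
    congr 1
    have h2 : (A.mulVec (θ - θ₀).ofLp) a = ∑ b, A b a * (θ - θ₀) b := by
      simp only [Matrix.mulVec, dotProduct]
      refine Finset.sum_congr rfl fun b _ => ?_
      have := hA.apply b a
      simp only [star_trivial] at this
      rw [this]
    rw [h2]
    simp
    ring
  · rw [← Finset.sum_sub_distrib]
    refine (norm_sum_le _ _).trans ((Finset.sum_le_card_nsmul _ _ q fun b _ => ?_).trans
      (by rw [Finset.card_univ, Fintype.card_fin, nsmul_eq_mul]))
    rw [← sub_smul, norm_smul, Real.norm_eq_abs]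
    have h3 : ‖(EuclideanSpace.proj b : EuclideanSpace ℝ (Fin d) →L[ℝ] ℝ)‖ ≤ 1 :=
      ContinuousLinearMap.opNorm_le_bound _ zero_le_one fun x => by
        simpa using PiLp.norm_apply_le x b
    exact (mul_le_mul (hH a b ϑ hϑ) h3 (norm_nonneg _)
      ((abs_nonneg _).trans (hH a b ϑ hϑ))).trans_eq (mul_one q)

lemma abs_mulVec_le {A : Matrix (Fin d) (Fin d) ℝ} {Λ e : ℝ} (hA : ∀ a b, |A a b| ≤ Λ)
    {g : Fin d → ℝ} (hg : ∀ b, |g b| ≤ e) (a : Fin d) : |(A.mulVec g) a| ≤ d * (Λ * e) := by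
  simp only [Matrix.mulVec, dotProduct]
  refine (Finset.abs_sum_le_sum_abs _ _).trans ((Finset.sum_le_card_nsmul _ _ (Λ * e)
    fun b _ => ?_).trans (by rw [Finset.card_univ, Fintype.card_fin, nsmul_eq_mul]))
  rw [abs_mul]
  exact mul_le_mul (hA a b) (hg b) (abs_nonneg _) ((abs_nonneg _).trans (hA a b))

lemma norm_toLp_mulVec_le {A : Matrix (Fin d) (Fin d) ℝ} {Λ e : ℝ} (hA : ∀ a b, |A a b| ≤ Λ)
    {g : Fin d → ℝ} (hg : ∀ b, |g b| ≤ e) : ‖WithLp.toLp 2 (A.mulVec g)‖ ≤ d * (d * (Λ * e)) := by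
  refine (norm_le_sum_abs _).trans ((Finset.sum_le_card_nsmul _ _ (d * (Λ * e))
    fun b _ => abs_mulVec_le hA hg b).trans
      (by rw [Finset.card_univ, Fintype.card_fin, nsmul_eq_mul]))

/-- Solving the linearized equation `A x ≈ -g` for `x`. -/
lemma norm_add_inv_mulVec_le {A : Matrix (Fin d) (Fin d) ℝ} (hA : A.PosDef) {Λ e : ℝ}
    (hΛ : ∀ a b, |A⁻¹ a b| ≤ Λ) {g : Fin d → ℝ} {x : EuclideanSpace ℝ (Fin d)}
    (h : ∀ a, |g a + (A.mulVec x.ofLp) a| ≤ e) :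
    ‖x + WithLp.toLp 2 (A⁻¹.mulVec g)‖ ≤ d * (d * (Λ * e)) := by
  have h1 : x + WithLp.toLp 2 (A⁻¹.mulVec g) =
      WithLp.toLp 2 (A⁻¹.mulVec (g + A.mulVec x.ofLp)) := by
    rw [Matrix.mulVec_add, Matrix.mulVec_mulVec,
      Matrix.nonsing_inv_mul _ ((Matrix.isUnit_iff_isUnit_det A).1 hA.isUnit), Matrix.one_mulVec,
      add_comm, WithLp.toLp_add]
  rw [h1]
  exact norm_toLp_mulVec_le hΛ h

end Linearization

/-! ### Uniform identification of the parameter curve -/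

section Identification

variable {d : ℕ} {Θ : Set (EuclideanSpace ℝ (Fin d))} {Φ : ℝ → EuclideanSpace ℝ (Fin d) → ℝ}
  {θ₀ : ℝ → EuclideanSpace ℝ (Fin d)}

/-- By compactness, near-minimizers of a continuous family of functions with unique minimizers are
close to the minimizers, uniformly in the family. -/
lemma exists_uniform_identification (hΘ : IsCompact Θ)
    (hcont : ContinuousOn (fun p : ℝ × EuclideanSpace ℝ (Fin d) => Φ p.1 p.2) (Icc 0 1 ×ˢ Θ))
    (hθ₀ : ∀ v ∈ Icc (0 : ℝ) 1, θ₀ v ∈ Θ)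
    (hmin : ∀ v ∈ Icc (0 : ℝ) 1, ∀ θ ∈ Θ, θ ≠ θ₀ v → Φ v (θ₀ v) < Φ v θ) {r : ℝ} (hr : 0 < r) :
    ∃ δ : ℝ, 0 < δ ∧ ∀ v ∈ Icc (0 : ℝ) 1, ∀ θ ∈ Θ, Φ v θ ≤ Φ v (θ₀ v) + δ → ‖θ - θ₀ v‖ < r := by
  by_contra! hcon
  have hle : ∀ v ∈ Icc (0 : ℝ) 1, ∀ θ ∈ Θ, Φ v (θ₀ v) ≤ Φ v θ := fun v hv θ hθ => by
    rcases eq_or_ne θ (θ₀ v) with h | h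
    · rw [h]
    · exact (hmin v hv θ hθ h).le
  choose v hv θ hθ hΦ hne using fun n : ℕ => hcon (1 / ((n : ℝ) + 1)) Nat.one_div_pos_of_nat
  obtain ⟨⟨w, ϑ, ϑ'⟩, ⟨hw, hϑ, hϑ'⟩, φ, hφ, hlim⟩ :=
    (isCompact_Icc.prod (hΘ.prod hΘ)).tendsto_subseq (x := fun n => (v n, θ n, θ₀ (v n)))
      fun n => ⟨hv n, hθ n, hθ₀ _ (hv n)⟩
  simp only at hw hϑ hϑ'
  have hl1 : Tendsto (fun n => v (φ n)) atTop (𝓝 w) := (continuous_fst.tendsto _).comp hlim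
  have hl2 : Tendsto (fun n => θ (φ n)) atTop (𝓝 ϑ) :=
    ((continuous_fst.comp continuous_snd).tendsto _).comp hlim
  have hl3 : Tendsto (fun n => θ₀ (v (φ n))) atTop (𝓝 ϑ') :=
    ((continuous_snd.comp continuous_snd).tendsto _).comp hlim
  have hconv : ∀ {u : ℕ → EuclideanSpace ℝ (Fin d)} {y : EuclideanSpace ℝ (Fin d)},
      (∀ n, u n ∈ Θ) → y ∈ Θ → Tendsto u atTop (𝓝 y) →
      Tendsto (fun n => Φ (v (φ n)) (u n)) atTop (𝓝 (Φ w y)) := by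
    intro u y hu hy hlimu
    exact (hcont (w, y) ⟨hw, hy⟩).tendsto.comp (tendsto_nhdsWithin_iff.2
      ⟨hl1.prodMk_nhds hlimu, Eventually.of_forall fun n => ⟨hv _, hu n⟩⟩)
  have h1 := hconv (fun n => hθ (φ n)) hϑ hl2
  have h2 := hconv (fun n => hθ₀ _ (hv (φ n))) hϑ' hl3
  have h3 := hconv (fun _ => hθ₀ w hw) (hθ₀ w hw) tendsto_const_nhds
  have h4 : Φ w ϑ' ≤ Φ w (θ₀ w) :=
    le_of_tendsto_of_tendsto' h2 h3 fun n => hle _ (hv _) _ (hθ₀ w hw)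
  have h5 : Φ w ϑ ≤ Φ w ϑ' := by
    have h6 : Tendsto (fun n => Φ (v (φ n)) (θ₀ (v (φ n))) + 1 / ((φ n : ℝ) + 1)) atTop
        (𝓝 (Φ w ϑ' + 0)) :=
      h2.add (tendsto_one_div_add_atTop_nhds_zero_nat.comp hφ.tendsto_atTop)
    rw [add_zero] at h6
    exact le_of_tendsto_of_tendsto' h1 h6 fun n => hΦ (φ n)
  have h7 : ∀ y ∈ Θ, Φ w y ≤ Φ w (θ₀ w) → y = θ₀ w := fun y hy hle' => by
    by_contra hy'
    exact absurd (hmin w hw y hy hy') (not_lt.2 hle')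
  have h8 : ϑ = ϑ' := (h7 ϑ hϑ (h5.trans h4)).trans (h7 ϑ' hϑ' h4).symm
  have h9 : r ≤ ‖ϑ - ϑ'‖ := ge_of_tendsto' (hl2.sub hl3).norm fun n => hne (φ n)
  rw [h8, sub_self, norm_zero] at h9
  linarith

lemma continuousOn_minimizer (hΘ : IsCompact Θ)
    (hcont : ContinuousOn (fun p : ℝ × EuclideanSpace ℝ (Fin d) => Φ p.1 p.2) (Icc 0 1 ×ˢ Θ))
    (hθ₀ : ∀ v ∈ Icc (0 : ℝ) 1, θ₀ v ∈ Θ)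
    (hmin : ∀ v ∈ Icc (0 : ℝ) 1, ∀ θ ∈ Θ, θ ≠ θ₀ v → Φ v (θ₀ v) < Φ v θ) :
    ContinuousOn θ₀ (Icc 0 1) := by
  rw [Metric.continuousOn_iff]
  intro w hw r hr
  obtain ⟨δ, hδ, hid⟩ := exists_uniform_identification hΘ hcont hθ₀ hmin hr
  obtain ⟨s, hs, hunif⟩ := Metric.uniformContinuousOn_iff.1
    ((isCompact_Icc.prod hΘ).uniformContinuousOn_of_continuous hcont) (δ / 2) (by positivity)
  refine ⟨s, hs, fun v hv hvw => ?_⟩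
  rw [dist_eq_norm]
  refine hid w hw _ (hθ₀ v hv) ?_
  have h1 : ∀ θ ∈ Θ, |Φ v θ - Φ w θ| < δ / 2 := fun θ hθ => by
    have := hunif (v, θ) ⟨hv, hθ⟩ (w, θ) ⟨hw, hθ⟩ (by
      rw [Prod.dist_eq]
      simpa [hs] using hvw)
    rwa [Real.dist_eq] at this
  have h2 := abs_lt.1 (h1 _ (hθ₀ v hv))
  have h3 := abs_lt.1 (h1 _ (hθ₀ w hw))
  have h4 : Φ v (θ₀ v) ≤ Φ v (θ₀ w) := by
    rcases eq_or_ne (θ₀ w) (θ₀ v) with h | h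
    · rw [h]
    · exact (hmin v hv _ (hθ₀ w hw) h).le
  linarith [h2.1, h3.2]

/-- A continuous curve in the interior stays away from the boundary. -/
lemma exists_closedBall_subset_interior (hc : ContinuousOn θ₀ (Icc 0 1))
    (hθ₀ : ∀ v ∈ Icc (0 : ℝ) 1, θ₀ v ∈ interior Θ) :
    ∃ r : ℝ, 0 < r ∧ ∀ v ∈ Icc (0 : ℝ) 1, Metric.closedBall (θ₀ v) r ⊆ interior Θ := by
  obtain ⟨r, hr, hsub⟩ := (isCompact_Icc.image_of_continuousOn hc).exists_cthickening_subset_open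
    isOpen_interior (by rintro _ ⟨v, hv, rfl⟩; exact hθ₀ v hv)
  exact ⟨r, hr, fun v hv => (Metric.closedBall_subset_cthickening (mem_image_of_mem θ₀ hv) r).trans
    hsub⟩

lemma exists_abs_inv_apply_le {A : ℝ → Matrix (Fin d) (Fin d) ℝ}
    (hA : ∀ a b, ContinuousOn (fun v => A v a b) (Icc 0 1))
    (hpos : ∀ v ∈ Icc (0 : ℝ) 1, (A v).PosDef) :
    ∃ Λ : ℝ, 0 < Λ ∧ ∀ v ∈ Icc (0 : ℝ) 1, ∀ a b, |(A v)⁻¹ a b| ≤ Λ := by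
  have hAc : ContinuousOn A (Icc 0 1) :=
    continuousOn_pi.2 fun a => continuousOn_pi.2 fun b => hA a b
  have hdet : ContinuousOn (fun v => (A v).det) (Icc 0 1) :=
    (continuous_id.matrix_det).comp_continuousOn hAc
  have hadj : ContinuousOn (fun v => (A v).adjugate) (Icc 0 1) :=
    (continuous_id.matrix_adjugate).comp_continuousOn hAc
  have hinv : ∀ a b, ContinuousOn (fun v => (A v)⁻¹ a b) (Icc 0 1) := fun a b => by
    have h1 : ∀ v, (A v)⁻¹ a b = ((A v).det)⁻¹ * (A v).adjugate a b := fun v => by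
      rw [Matrix.inv_def, Ring.inverse_eq_inv', Matrix.smul_apply, smul_eq_mul]
    simp only [h1]
    exact (hdet.inv₀ fun v hv => (hpos v hv).det_pos.ne').mul
      (continuousOn_pi.1 (continuousOn_pi.1 hadj a) b)
  obtain ⟨Λ, hΛ⟩ := isCompact_Icc.exists_bound_of_continuousOn
    (continuousOn_finsetSum Finset.univ fun a _ => continuousOn_finsetSum Finset.univ
      fun b _ => (hinv a b).abs)
  refine ⟨|Λ| + 1, by positivity, fun v hv a b => ?_⟩
  have h1 := (le_abs_self _).trans (hΛ v hv)
  have h2 : |(A v)⁻¹ a b| ≤ ∑ a, ∑ b, |(A v)⁻¹ a b| :=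
    (Finset.single_le_sum (f := fun b => |(A v)⁻¹ a b|) (fun _ _ => abs_nonneg _)
      (Finset.mem_univ b)).trans
    (Finset.single_le_sum (f := fun a => ∑ b, |(A v)⁻¹ a b|)
      (fun _ _ => Finset.sum_nonneg fun _ _ => abs_nonneg _) (Finset.mem_univ a))
  linarith [le_abs_self Λ]

variable {k : ℕ} {T : Set (EuclideanSpace ℝ (Fin d))}
  {F : EuclideanSpace ℝ (Fin d) → (Fin k → ℝ) → ℝ} {M C CX ς : ℝ}
  {Ω S : Type*} [MeasurableSpace Ω] [MeasurableSpace S] {μ : Measure Ω}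
  [IsProbabilityMeasure μ] {ε : ℤ → Ω → S} {J : ℕ → ℤ → (ℕ → S) → ℝ} {Jt : (ℕ → S) → ℝ → ℝ}

lemma continuousOn_limitMean (hε : IsIIDInnovation μ ε)
    (hloc : IsLocallyStationary μ ε J Jt M CX ς) (hF : IsPolyClass T F M C) :
    ContinuousOn (fun p : ℝ × EuclideanSpace ℝ (Fin d) => limitMean μ ε Jt F p.1 p.2)
      (Icc 0 1 ×ˢ T) := by
  rintro ⟨v, θ⟩ ⟨hv, hθ⟩
  rw [ContinuousWithinAt, tendsto_iff_dist_tendsto_zero]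
  refine squeeze_zero' (Eventually.of_forall fun _ => dist_nonneg)
    (g := fun p : ℝ × EuclideanSpace ℝ (Fin d) =>
      C * (4 * (1 + 2 * k * CX) ^ (M - 1)) * (k * (CX * |p.1 - v| ^ ς)) +
        C * (1 + (k * CX) ^ M) * ‖p.2 - θ‖) ?_ ?_
  · filter_upwards [self_mem_nhdsWithin] with p hp
    rw [Real.dist_eq]
    exact (abs_sub_le _ (limitMean μ ε Jt F v p.2) _).trans
      (add_le_add (abs_limitMean_sub_le hε hloc hF hp.1 hv hp.2)
        (abs_limitMean_sub_le_norm hε hloc hF hv hp.2 hθ))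
  · have hcont : Continuous fun p : ℝ × EuclideanSpace ℝ (Fin d) =>
        C * (4 * (1 + 2 * k * CX) ^ (M - 1)) * (k * (CX * |p.1 - v| ^ ς)) +
          C * (1 + (k * CX) ^ M) * ‖p.2 - θ‖ := by
      have : Continuous fun p : ℝ × EuclideanSpace ℝ (Fin d) => |p.1 - v| ^ ς :=
        (by fun_prop : Continuous fun p : ℝ × EuclideanSpace ℝ (Fin d) => |p.1 - v|).rpow_const
          fun _ => Or.inr hloc.hoelder_pos.le
      fun_prop
    have h1 := (hcont.tendsto (v, θ)).mono_left (nhdsWithin_le_nhds (s := Icc 0 1 ×ˢ T))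
    simpa [Real.zero_rpow hloc.hoelder_pos.ne'] using h1

end Identification

/-! ### Uniform approximation of the kernel averages -/

section KernelAverages

variable {k d : ℕ} {T : Set (EuclideanSpace ℝ (Fin d))}
  {F : EuclideanSpace ℝ (Fin d) → (Fin k → ℝ) → ℝ} {M C c CX ς ν : ℝ}
  {Ω S : Type*} [MeasurableSpace Ω] [MeasurableSpace S] {μ : Measure Ω}
  [IsProbabilityMeasure μ] {ε : ℤ → Ω → S} {K : ℝ → ℝ}

/-- The dependence measure is at most twice the moment. -/
lemma depMeasure_le_two_mul (hε : IsIIDInnovation μ ε) {J : ℤ → (ℕ → S) → ℝ} {n : ℕ}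
    (hJ : ∀ i : ℤ, 1 ≤ i → i ≤ n → Measurable (J i)) {q : ℝ} (hq : 1 ≤ q) (hc : 0 ≤ c)
    (hmom : ∀ i : ℤ, 1 ≤ i → i ≤ n → eLpNorm (fun ω => J i (innovPast ε i ω))
      (ENNReal.ofReal q) μ ≤ ENNReal.ofReal c) (j : ℕ) :
    depMeasure μ ε J n q j ≤ ENNReal.ofReal (2 * c) := by
  have := isProbabilityMeasure_innov hε
  have hmp := measurePreserving_innov hε
  refine iSup₂_le fun i hi => ?_
  have hJm := measurable_coordProcess (hJ i hi.1 hi.2)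
  have hq1 : 1 ≤ ENNReal.ofReal q := by
    rw [← ENNReal.ofReal_one]
    exact ENNReal.ofReal_le_ofReal hq
  have h0 : eLpNorm (coordProcess J i) (ENNReal.ofReal q) (iidLaw (μ.map (ε 0))) ≤
      ENNReal.ofReal c := by
    rw [← eLpNorm_comp_measurePreserving hJm.aestronglyMeasurable hmp]
    exact hmom i hi.1 hi.2
  have h1 : MeasurePreserving (fun p : Ω × Ω => fun l => ε l p.1) (μ.prod μ)
      (iidLaw (μ.map (ε 0))) := hmp.comp measurePreserving_fst
  have h2 : MeasurePreserving (fun p : Ω × Ω => resample {i - (j : ℤ)}ᶜ (fun l => ε l p.1)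
      fun l => ε l p.2) (μ.prod μ) (iidLaw (μ.map (ε 0))) :=
    (measurePreserving_resample (μ.map (ε 0)) {i - (j : ℤ)}ᶜ).comp (hmp.prod hmp)
  have h3 : (fun p : Ω × Ω => J i (innovPast ε i p.1) - J i (coupledPast ε i j p)) =
      (coordProcess J i ∘ fun p : Ω × Ω => fun l => ε l p.1) -
        coordProcess J i ∘ fun p : Ω × Ω => resample {i - (j : ℤ)}ᶜ (fun l => ε l p.1)
          fun l => ε l p.2 := by
    funext p
    simp only [Pi.sub_apply, Function.comp, coordProcess]
    congr 2
    funext r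
    rw [coupledPast]
    by_cases hr : r = j
    · rw [hr, Function.update_self, innovPast, resample_of_notMem (by simp)]
    · rw [Function.update_of_ne hr, innovPast, innovPast, resample_of_mem]
      simp only [mem_compl_iff, mem_singleton_iff]
      omega
  rw [h3, two_mul, ENNReal.ofReal_add hc hc]
  refine (eLpNorm_sub_le (hJm.comp h1.measurable).aestronglyMeasurable
    (hJm.comp h2.measurable).aestronglyMeasurable hq1).trans (add_le_add ?_ ?_)
  · rw [eLpNorm_comp_measurePreserving hJm.aestronglyMeasurable h1]
    exact h0
  · rw [eLpNorm_comp_measurePreserving hJm.aestronglyMeasurable h2]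
    exact h0

/-- The uniform concentration, for finitely many classes at the same time. -/
lemma exists_measure_kernelSum_gt_le_of_fintype (hε : IsIIDInnovation μ ε) {A : Type*} [Fintype A]
    [Nonempty A] {T : A → Set (EuclideanSpace ℝ (Fin d))}
    {F : A → EuclideanSpace ℝ (Fin d) → (Fin k → ℝ) → ℝ} (hT : ∀ x, Bornology.IsBounded (T x))
    (hF : ∀ x, IsPolyClass (T x) (F x) M C) (hν : 2 < ν) (hc : 0 ≤ c) (hK : IsLocKernel K)
    {Δ : ℕ → ℝ} (hΔ0 : ∀ j, 0 < Δ j) {D₀ : ℝ} (hD₀ : ∀ r, ∑ j ∈ Finset.range r, Δ j ≤ D₀) {Cm : ℝ}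
    (hCm : 0 < Cm) (Ct : ℝ) (hk : 1 ≤ k) {η : ℝ} (hη : 0 < η) :
    ∃ Q : ℝ, 0 < Q ∧ ∀ (n : ℕ) (J : ℤ → (ℕ → S) → ℝ) (h : ℝ) (m : ℕ),
      (∀ i : ℤ, 1 ≤ i → i ≤ n → Measurable (J i)) →
      (∀ i : ℤ, 1 ≤ i → i ≤ n → eLpNorm (fun ω => J i (innovPast ε i ω))
        (ENNReal.ofReal (ν * M)) μ ≤ ENNReal.ofReal c) →
      (∀ j, depMeasure μ ε J n (2 * M) j ≤ ENNReal.ofReal (Δ j)) →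
      k ≤ n → 0 < h → h ≤ 1 → 1 ≤ n * h → 1 ≤ Real.log n →
      (m + 1) * (Real.sqrt (Real.log n) * (n : ℝ) ^ (1 / ν)) ≤ Cm * Real.sqrt (n * h) →
      (∀ r, ∑ j ∈ Finset.range r, Δ (m + 1 + j) ≤ Ct * Real.sqrt h) →
      μ {ω | ∃ x, ∃ v ∈ Icc (0 : ℝ) 1, ∃ θ ∈ T x,
        Q * (Real.sqrt (n * h) * Real.sqrt (Real.log n)) < |kernelSum K k n h v fun i =>
          F x θ (lagWindow k (fun i ω => J i (innovPast ε i ω)) i ω) -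
            ∫ ω', F x θ (lagWindow k (fun i ω => J i (innovPast ε i ω)) i ω') ∂μ|} ≤
        ENNReal.ofReal η := by
  have hcard : (0 : ℝ) < Fintype.card A := by exact_mod_cast Fintype.card_pos
  choose Q hQ0 hQ using fun x => exists_measure_kernelSum_gt_le hε (hT x) (hF x) hν hc hK hΔ0 hD₀
    hCm Ct hk (div_pos hη hcard)
  refine ⟨∑ x, Q x, Finset.sum_pos (fun x _ => hQ0 x) Finset.univ_nonempty, ?_⟩
  intro n J h m hJ hmom hdep hkn hh hh1 hnh hlog hm hmt
  refine (measure_mono (t := ⋃ x, {ω | ∃ v ∈ Icc (0 : ℝ) 1, ∃ θ ∈ T x,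
    Q x * (Real.sqrt (n * h) * Real.sqrt (Real.log n)) < |kernelSum K k n h v fun i =>
      F x θ (lagWindow k (fun i ω => J i (innovPast ε i ω)) i ω) -
        ∫ ω', F x θ (lagWindow k (fun i ω => J i (innovPast ε i ω)) i ω') ∂μ|}) ?_).trans ?_
  · rintro ω ⟨x, v, hv, θ, hθ, hlt⟩
    refine mem_iUnion.2 ⟨x, v, hv, θ, hθ, lt_of_le_of_lt ?_ hlt⟩
    refine mul_le_mul_of_nonneg_right ?_ (by positivity)
    exact Finset.single_le_sum (f := Q) (fun x _ => (hQ0 x).le) (Finset.mem_univ x)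
  · refine (measure_iUnion_fintype_le _ _).trans
      ((Finset.sum_le_sum fun x _ => hQ x n J h m hJ hmom hdep hkn hh hh1 hnh hlog hm hmt).trans ?_)
    rw [Finset.sum_const, Finset.card_univ, nsmul_eq_mul, ← ENNReal.ofReal_natCast,
      ← ENNReal.ofReal_mul hcard.le]
    refine ENNReal.ofReal_le_ofReal (le_of_eq ?_)
    field_simp

variable {J : ℕ → ℤ → (ℕ → S) → ℝ} {Jt : (ℕ → S) → ℝ → ℝ}

/-- The distance of a kernel average to its limit: stochastic error, bias, and the error of the
Riemann sum. -/
lemma exists_abs_kernelAverage_sub_limitMean_le (hε : IsIIDInnovation μ ε)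
    (hloc : IsLocallyStationary μ ε J Jt M CX ς) (hF : IsPolyClass T F M C)
    (hK : IsLocKernel K) (hk : 1 ≤ k) :
    ∃ Q : ℝ, 0 < Q ∧ ∀ (n : ℕ) (h v : ℝ), 0 < h → 1 ≤ n * h → k ≤ n → h / 2 ≤ v → v ≤ 1 - h / 2 →
      ∀ θ ∈ T, ∀ (ω : Ω) (e : ℝ),
      |kernelSum K k n h v fun i =>
        F θ (lagWindow k (fun i ω => J n i (innovPast ε i ω)) i ω) -
          ∫ ω', F θ (lagWindow k (fun i ω => J n i (innovPast ε i ω)) i ω') ∂μ| ≤ e →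
      |1 / (n * h) * (kernelSum K k n h v fun i =>
        F θ (lagWindow k (fun i ω => J n i (innovPast ε i ω)) i ω)) - limitMean μ ε Jt F v θ| ≤
        e / (n * h) + Q * (h ^ ς + 1 / (n * h)) := by
  obtain ⟨Q₁, hQ₁, hbias⟩ := exists_abs_kernelSum_integral_sub_le hε hloc hF hK
  obtain ⟨Q₂, hQ₂, hriem⟩ := exists_abs_kernelSum_one_sub_le hK hk
  have hC := hF.pos
  have hCX := hloc.CX_pos
  set Q₃ := 5 * C * (1 + (k * CX) ^ M) with hQ₃
  have hQ₃0 : 0 < Q₃ := by positivity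
  refine ⟨Q₁ + Q₂ * Q₃, by positivity, fun n h v hh hnh hkn hv1 hv2 θ hθ ω e he => ?_⟩
  have hnh0 : 0 < (n : ℝ) * h := by linarith
  have hn0 : (n : ℝ) ≠ 0 := fun h0 => by simp [h0] at hnh0
  have hv : v ∈ Icc (0 : ℝ) 1 := ⟨by linarith, by linarith⟩
  have h1 := hbias n h v hh hnh hv θ hθ
  have h2 := hriem n h v hh hnh hkn hv1 hv2
  have h3 : |limitMean μ ε Jt F v θ| ≤ Q₃ := abs_limitMean_le hε hloc hF hv hθ
  set Φ := limitMean μ ε Jt F v θ with hΦ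
  rw [kernelSum_sub] at he h1
  have h4 : kernelSum K k n h v (fun _ => Φ) = kernelSum K k n h v (fun _ => 1) * Φ := by
    simp only [kernelSum, Finset.sum_mul, mul_one]
  rw [h4] at h1
  set s₁ := kernelSum K k n h v fun i => F θ (lagWindow k (fun i ω => J n i (innovPast ε i ω)) i ω)
  set s₂ := kernelSum K k n h v fun i =>
    ∫ ω', F θ (lagWindow k (fun i ω => J n i (innovPast ε i ω)) i ω') ∂μ
  set s₃ := kernelSum K k n h v fun _ => 1
  have h5 : 1 / (n * h) * s₁ - Φ = ((s₁ - s₂) + (s₂ - s₃ * Φ) + (s₃ - n * h) * Φ) / (n * h) := by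
    field_simp
    ring
  rw [h5, abs_div, abs_of_pos hnh0, div_le_iff₀ hnh0]
  have h6 : |(s₃ - n * h) * Φ| ≤ Q₂ * Q₃ := by
    rw [abs_mul]
    exact mul_le_mul h2 h3 (abs_nonneg _) hQ₂.le
  have hς : 0 ≤ h ^ ς := by positivity
  calc |s₁ - s₂ + (s₂ - s₃ * Φ) + (s₃ - n * h) * Φ| ≤ e + Q₁ * (n * h) * h ^ ς + Q₂ * Q₃ :=
        (abs_add_three _ _ _).trans (add_le_add (add_le_add he h1) h6)
    _ ≤ e + Q₁ * (n * h) * h ^ ς + Q₂ * Q₃ + (Q₂ * Q₃ * (n * h) * h ^ ς + Q₁) :=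
        le_add_of_nonneg_right (by positivity)
    _ = _ := by
        field_simp
        ring

/-! ### The expected gradient -/

variable {ℓ : EuclideanSpace ℝ (Fin d) → (Fin k → ℝ) → ℝ} {Θ : Set (EuclideanSpace ℝ (Fin d))}

lemma integral_gradient_locObjective (hε : IsIIDInnovation μ ε)
    (hloc : IsLocallyStationary μ ε J Jt M CX ς)
    (hdiff : ∀ z, ContDiffOn ℝ 2 (fun θ => ℓ θ z) (interior Θ))
    (hF : ∀ a : Fin d, IsPolyClass (interior Θ)
      (fun θ z => nablaTensor 1 (fun ϑ => ℓ ϑ z) θ ![a]) M C) (n : ℕ) (h v : ℝ)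
    {θ : EuclideanSpace ℝ (Fin d)} (hθ : θ ∈ interior Θ) (a : Fin d) :
    (∫ ω, gradient (locObjective K ℓ (fun i ω => J n i (innovPast ε i ω)) n h v ω) θ ∂μ) a =
      1 / (n * h) * kernelSum K k n h v fun i => ∫ ω, nablaTensor 1
        (fun ϑ => ℓ ϑ (lagWindow k (fun i ω => J n i (innovPast ε i ω)) i ω)) θ ![a] ∂μ := by
  have hint : ∀ b : Fin d, ∀ i ∈ Finset.Icc (k : ℤ) n, Integrable (fun ω => nablaTensor 1
      (fun ϑ => ℓ ϑ (lagWindow k (fun i ω => J n i (innovPast ε i ω)) i ω)) θ ![b]) μ := by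
    intro b i hi
    have hi' := Finset.mem_Icc.1 hi
    exact (hF b).integrable_comp hθ (measurable_pi_lambda _ fun l =>
      (hloc.meas_J n _ (by omega) (by omega)).comp (measurable_innovPast hε.meas _))
      one_le_two hloc.CX_pos.le fun l => hloc.moment n _ (by omega) (by omega)
  have hcomp : ∀ b : Fin d, Integrable (fun ω => gradient
      (locObjective K ℓ (fun i ω => J n i (innovPast ε i ω)) n h v ω) θ b) μ := by
    intro b
    simp only [gradient_locObjective hdiff hθ]
    exact (integrable_finsetSum _ fun i hi => (hint b i hi).const_mul _).const_mul _
  have h1 : Integrable (fun ω => gradient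
      (locObjective K ℓ (fun i ω => J n i (innovPast ε i ω)) n h v ω) θ) μ :=
    Integrable.of_eval_piLp hcomp
  have h2 := (EuclideanSpace.proj (𝕜 := ℝ) a).integral_comp_comm h1
  refine h2.symm.trans ((integral_congr_ae (Eventually.of_forall fun ω =>
    gradient_locObjective hdiff hθ a)).trans ?_)
  rw [integral_const_mul]
  congr 1
  unfold kernelSum
  rw [integral_finsetSum _ fun i hi => (hint a i hi).const_mul _]
  simp only [integral_const_mul]

/-- The bias of the gradient is `O(h^ς)`, since the expected score vanishes in the limit. -/
lemma exists_locBias_le (hε : IsIIDInnovation μ ε) (hloc : IsLocallyStationary μ ε J Jt M CX ς)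
    (hK : IsLocKernel K) (hdiff : ∀ z, ContDiffOn ℝ 2 (fun θ => ℓ θ z) (interior Θ)) {C' : ℝ}
    (hF₀ : IsPolyClass Θ ℓ M C') (hF : ∀ a : Fin d, IsPolyClass (interior Θ)
      (fun θ z => nablaTensor 1 (fun ϑ => ℓ ϑ z) θ ![a]) M C)
    {θ₀ : ℝ → EuclideanSpace ℝ (Fin d)} (hθ₀ : ∀ v ∈ Icc (0 : ℝ) 1, θ₀ v ∈ interior Θ)
    (hmin : ∀ v ∈ Icc (0 : ℝ) 1, IsMinOn (limitMean μ ε Jt ℓ v) Θ (θ₀ v)) :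
    ∃ Q : ℝ, 0 < Q ∧ ∀ (n : ℕ) (h : ℝ), 0 < h → 1 ≤ n * h →
      locBias μ K ℓ (fun i ω => J n i (innovPast ε i ω)) θ₀ n h ≤ ENNReal.ofReal (Q * h ^ ς) := by
  choose Q hQ0 hQ using fun a => exists_abs_kernelSum_integral_sub_le hε hloc (hF a) hK
  refine ⟨∑ a, Q a + 1, add_pos_of_nonneg_of_pos (Finset.sum_nonneg fun a _ => (hQ0 a).le) one_pos,
    fun n h hh hnh => iSup₂_le fun v hv => ?_⟩
  have hnh0 : 0 < (n : ℝ) * h := by linarith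
  have hς : 0 ≤ h ^ ς := by positivity
  rw [← ofReal_norm]
  refine ENNReal.ofReal_le_ofReal ((norm_le_sum_abs _).trans ?_)
  have h1 : ∀ a, |(∫ ω, gradient (locObjective K ℓ (fun i ω => J n i (innovPast ε i ω)) n h v ω)
      (θ₀ v) ∂μ) a| ≤ Q a * h ^ ς := by
    intro a
    have h2 := hQ a n h v hh hnh hv (θ₀ v) (hθ₀ v hv)
    rw [limitMean_nablaTensor_one_eq_zero hε hloc hdiff hF₀ (hF a) hv (hθ₀ v hv) (hmin v hv)] at h2
    simp only [sub_zero] at h2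
    rw [integral_gradient_locObjective hε hloc hdiff hF n h v (hθ₀ v hv), one_div_mul_eq_div,
      abs_div, abs_of_pos hnh0, div_le_iff₀ hnh0]
    refine h2.trans (le_of_eq (by ring))
  refine (Finset.sum_le_sum fun a _ => h1 a).trans ?_
  rw [← Finset.sum_mul]
  exact mul_le_mul_of_nonneg_right (by linarith) hς

end KernelAverages

/-! ### The minimizer -/

section MEstimation

variable {k n d : ℕ} {Ω : Type*} {K : ℝ → ℝ} {h v : ℝ} {X : ℤ → Ω → ℝ} {ω : Ω}
  {ℓ : EuclideanSpace ℝ (Fin d) → (Fin k → ℝ) → ℝ} {Θ : Set (EuclideanSpace ℝ (Fin d))}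

/-- Linearization of the estimating equation around the true parameter, when the Hessian is
uniformly close to a limit that is Lipschitz in the parameter. -/
lemma norm_sub_add_inv_mulVec_gradient_le
    (hdiff : ∀ z, ContDiffOn ℝ 2 (fun θ => ℓ θ z) (interior Θ))
    {θ θ₀ : EuclideanSpace ℝ (Fin d)} (hmin : IsMinOn (locObjective K ℓ X n h v ω) Θ θ) {r : ℝ}
    (hr : Metric.closedBall θ₀ r ⊆ interior Θ) (hθ : ‖θ - θ₀‖ ≤ r)
    {A : Matrix (Fin d) (Fin d) ℝ} (hA : A.PosDef) {Λ : ℝ} (hΛ : ∀ a b, |A⁻¹ a b| ≤ Λ)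
    {Φ : Fin d → Fin d → EuclideanSpace ℝ (Fin d) → ℝ} {e L : ℝ} (hL : 0 ≤ L)
    (hΦ : ∀ b a, ∀ ϑ ∈ interior Θ, |Φ b a ϑ - A b a| ≤ L * ‖ϑ - θ₀‖)
    (hclose : ∀ b a, ∀ ϑ ∈ interior Θ, |1 / (n * h) * (kernelSum K k n h v fun i =>
      nablaTensor 2 (fun ϑ => ℓ ϑ (lagWindow k X i ω)) ϑ ![b, a]) - Φ b a ϑ| ≤ e) :
    ‖(θ - θ₀) + WithLp.toLp 2
        (A⁻¹.mulVec (gradient (locObjective K ℓ X n h v ω) θ₀).ofLp)‖ ≤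
      d * (d * (Λ * (d * (e + L * ‖θ - θ₀‖) * ‖θ - θ₀‖))) := by
  have hr0 : 0 ≤ r := (norm_nonneg _).trans hθ
  have hball : ∀ ϑ ∈ segment ℝ θ₀ θ, ‖ϑ - θ₀‖ ≤ ‖θ - θ₀‖ := fun ϑ hϑ => norm_sub_le_of_mem_segment hϑ
  have hseg : ∀ ϑ ∈ segment ℝ θ₀ θ, ϑ ∈ interior Θ := fun ϑ hϑ => hr (by
    rw [Metric.mem_closedBall, dist_eq_norm]
    exact (hball ϑ hϑ).trans hθ)
  have hθi : θ ∈ interior Θ := hseg θ (right_mem_segment ℝ θ₀ θ)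
  have hθ₀i : θ₀ ∈ interior Θ := hseg θ₀ (left_mem_segment ℝ θ₀ θ)
  have hzero : gradient (locObjective K ℓ X n h v ω) θ = 0 := by
    ext a
    rw [gradient_apply_eq, (hmin.isLocalMin (mem_interior_iff_mem_nhds.1 hθi)).fderiv_eq_zero]
    simp
  refine norm_add_inv_mulVec_le hA hΛ fun a => ?_
  have h1 := abs_add_mulVec_le hA.isHermitian (θ₀ := θ₀) (θ := θ) (q := e + L * ‖θ - θ₀‖)
    (G := fun a ϑ => 1 / (n * h) * kernelSum K k n h v fun i =>
      nablaTensor 1 (fun ϑ => ℓ ϑ (lagWindow k X i ω)) ϑ ![a])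
    (H := fun b a ϑ => 1 / (n * h) * kernelSum K k n h v fun i =>
      nablaTensor 2 (fun ϑ => ℓ ϑ (lagWindow k X i ω)) ϑ ![b, a])
    (fun a ϑ hϑ => hasFDerivAt_kernelSum
      (fun i => hasFDerivAt_nablaTensor_one isOpen_interior (hdiff _) (hseg ϑ hϑ) a) _)
    (fun a b ϑ hϑ => ?_) (fun a => ?_) a
  · rwa [gradient_locObjective hdiff hθ₀i]
  · refine (abs_sub_le _ (Φ b a ϑ) _).trans (add_le_add (hclose b a ϑ (hseg ϑ hϑ))
      ((hΦ b a ϑ (hseg ϑ hϑ)).trans (mul_le_mul_of_nonneg_left (hball ϑ hϑ) hL)))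
  · rw [← gradient_locObjective hdiff hθi, hzero]
    simp

lemma sqrt_mul_sqrt_log_div {n : ℕ} {h : ℝ} (hnh : 0 < n * h) :
    Real.sqrt (n * h) * Real.sqrt (Real.log n) / (n * h) = Real.sqrt (Real.log n / (n * h)) := by
  have h1 : 0 < Real.sqrt (n * h) := Real.sqrt_pos.2 hnh
  have h2 := Real.mul_self_sqrt hnh.le
  rw [Real.sqrt_div' _ hnh.le, div_eq_div_iff hnh.ne' h1.ne']
  linear_combination Real.sqrt (Real.log n) * h2

lemma one_div_le_sqrt_log_div {n : ℕ} {h : ℝ} (hnh : 1 ≤ n * h) (hlog : 1 ≤ Real.log n) :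
    1 / (n * h) ≤ Real.sqrt (Real.log n / (n * h)) := by
  have hnh0 : 0 < n * h := by linarith
  refine Real.le_sqrt_of_sq_le ?_
  rw [div_pow, one_pow, div_le_div_iff₀ (by positivity) hnh0]
  nlinarith

variable {S : Type*} [MeasurableSpace Ω] [MeasurableSpace S] {μ : Measure Ω}
  [IsProbabilityMeasure μ] {ε : ℤ → Ω → S} {J : ℕ → ℤ → (ℕ → S) → ℝ} {Jt : (ℕ → S) → ℝ → ℝ}
  {M CX ς : ℝ}

set_option maxHeartbeats 400000 in
/-- Consistency and linearization of the minimizer at the points where the centered kernel sums of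
the loss, of its gradient, and of its Hessian are uniformly small. -/
theorem exists_minimizer_expansion (hε : IsIIDInnovation μ ε)
    (hloc : IsLocallyStationary μ ε J Jt M CX ς) (hK : IsLocKernel K) {h : ℕ → ℝ}
    (hpos : ∀ n, 0 < h n) (hzero : Tendsto h atTop (𝓝 0))
    (hnh : Tendsto (fun n : ℕ => (n : ℝ) * h n) atTop atTop)
    (hτ : Tendsto (fun n : ℕ => Real.sqrt (Real.log n / (n * h n))) atTop (𝓝 0))
    (hk : 1 ≤ k) (hΘ : IsCompact Θ) {θ₀ : ℝ → EuclideanSpace ℝ (Fin d)}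
    (hθ₀ : ∀ v ∈ Icc (0 : ℝ) 1, θ₀ v ∈ interior Θ)
    (hdiff : ∀ z, ContDiffOn ℝ 2 (fun θ => ℓ θ z) (interior Θ))
    {θhat : ℕ → ℝ → Ω → EuclideanSpace ℝ (Fin d)}
    (hθhat : ∀ n : ℕ, ∀ v ∈ Icc (0 : ℝ) 1, ∀ ω, θhat n v ω ∈ Θ ∧
      IsMinOn (locObjective K ℓ (fun i ω => J n i (innovPast ε i ω)) n (h n) v ω) Θ (θhat n v ω))
    {C₀ : ℝ} (hP₀ : IsPolyClass Θ ℓ M C₀) (hP₁ : ∀ a : Fin d, IsPolyClass (interior Θ)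
      (fun θ z => nablaTensor 1 (fun ϑ => ℓ ϑ z) θ ![a]) M C₀)
    (hP₂ : ∀ b a : Fin d, IsPolyClass (interior Θ)
      (fun θ z => nablaTensor 2 (fun ϑ => ℓ ϑ z) θ ![b, a]) M C₀)
    (hmin : ∀ v ∈ Icc (0 : ℝ) 1, ∀ θ ∈ Θ, θ ≠ θ₀ v →
      limitMean μ ε Jt ℓ v (θ₀ v) < limitMean μ ε Jt ℓ v θ)
    {A : ℝ → Matrix (Fin d) (Fin d) ℝ} (hA : ∀ v b a, A v b a =
      limitMean μ ε Jt (fun θ z => nablaTensor 2 (fun ϑ => ℓ ϑ z) θ ![b, a]) v (θ₀ v))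
    (hApos : ∀ v ∈ Icc (0 : ℝ) 1, (A v).PosDef) {Q : ℝ} (hQ : 0 < Q) :
    ∃ C : ℝ, 0 < C ∧ ∀ᶠ n : ℕ in atTop, ∀ ω,
      (∀ v ∈ Icc (0 : ℝ) 1, ∀ θ ∈ Θ, |kernelSum K k n (h n) v fun i =>
        ℓ θ (lagWindow k (fun i ω => J n i (innovPast ε i ω)) i ω) -
          ∫ ω', ℓ θ (lagWindow k (fun i ω => J n i (innovPast ε i ω)) i ω') ∂μ| ≤
            Q * (Real.sqrt (n * h n) * Real.sqrt (Real.log n))) →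
      (∀ a, ∀ v ∈ Icc (0 : ℝ) 1, ∀ θ ∈ interior Θ, |kernelSum K k n (h n) v fun i =>
        nablaTensor 1
            (fun ϑ => ℓ ϑ (lagWindow k (fun i ω => J n i (innovPast ε i ω)) i ω)) θ ![a] -
          ∫ ω', nablaTensor 1
            (fun ϑ => ℓ ϑ (lagWindow k (fun i ω => J n i (innovPast ε i ω)) i ω')) θ ![a] ∂μ| ≤
            Q * (Real.sqrt (n * h n) * Real.sqrt (Real.log n))) →
      (∀ b a, ∀ v ∈ Icc (0 : ℝ) 1, ∀ θ ∈ interior Θ, |kernelSum K k n (h n) v fun i =>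
        nablaTensor 2
            (fun ϑ => ℓ ϑ (lagWindow k (fun i ω => J n i (innovPast ε i ω)) i ω)) θ ![b, a] -
          ∫ ω', nablaTensor 2
            (fun ϑ => ℓ ϑ (lagWindow k (fun i ω => J n i (innovPast ε i ω)) i ω')) θ ![b, a] ∂μ| ≤
            Q * (Real.sqrt (n * h n) * Real.sqrt (Real.log n))) →
      ∀ v ∈ Icc (h n / 2) (1 - h n / 2),
        ‖θhat n v ω - θ₀ v‖ ≤ C * (Real.sqrt (Real.log n / (n * h n)) +
          (locBias μ K ℓ (fun i ω => J n i (innovPast ε i ω)) θ₀ n (h n)).toReal) ∧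
        ‖(θhat n v ω - θ₀ v) + WithLp.toLp 2 ((A v)⁻¹.mulVec (gradient (locObjective K ℓ
            (fun i ω => J n i (innovPast ε i ω)) n (h n) v ω) (θ₀ v)).ofLp)‖ ≤
          C * ((Real.sqrt (Real.log n / (n * h n)) + h n ^ ς) *
            (Real.sqrt (Real.log n / (n * h n)) +
              (locBias μ K ℓ (fun i ω => J n i (innovPast ε i ω)) θ₀ n (h n)).toReal)) := by
  have hCX := hloc.CX_pos
  have hC₀ := hP₀.pos
  have hθ₀Θ : ∀ v ∈ Icc (0 : ℝ) 1, θ₀ v ∈ Θ := fun v hv => interior_subset (hθ₀ v hv)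
  have hcont := continuousOn_limitMean hε hloc hP₀
  have hθ₀c : ContinuousOn θ₀ (Icc 0 1) := continuousOn_minimizer hΘ hcont hθ₀Θ hmin
  obtain ⟨r₀, hr₀, hball⟩ := exists_closedBall_subset_interior hθ₀c hθ₀
  have hAc : ∀ b a, ContinuousOn (fun v => A v b a) (Icc 0 1) := fun b a => by
    have hpair : ContinuousOn (fun v => (v, θ₀ v)) (Icc 0 1) := continuousOn_id.prodMk hθ₀c
    have hmaps : MapsTo (fun v => (v, θ₀ v)) (Icc 0 1) (Icc 0 1 ×ˢ interior Θ) :=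
      fun v hv => mk_mem_prod hv (hθ₀ v hv)
    have h1 := (continuousOn_limitMean hε hloc (hP₂ b a)).comp hpair hmaps
    exact h1.congr fun v _ => hA v b a
  obtain ⟨Λ, hΛ, hinv⟩ := exists_abs_inv_apply_le hAc hApos
  have hminOn : ∀ v ∈ Icc (0 : ℝ) 1, IsMinOn (limitMean μ ε Jt ℓ v) Θ (θ₀ v) :=
      fun v hv => isMinOn_iff.2 fun θ hθ => by
    rcases eq_or_ne θ (θ₀ v) with h' | h'
    · rw [h']
    · exact (hmin v hv θ hθ h').le
  obtain ⟨CB, hCB, hbias⟩ := exists_locBias_le hε hloc hK hdiff hP₀ hP₁ hθ₀ hminOn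
  obtain ⟨Q₀, hQ₀, happ₀⟩ := exists_abs_kernelAverage_sub_limitMean_le hε hloc hP₀ hK hk
  choose Q₂ hQ₂ happ₂ using fun b a =>
    exists_abs_kernelAverage_sub_limitMean_le hε hloc (hP₂ b a) hK hk
  have hQ₂s : ∀ b a, Q₂ b a ≤ ∑ b, ∑ a, Q₂ b a := fun b a =>
    (Finset.single_le_sum (f := Q₂ b) (fun a _ => (hQ₂ b a).le) (Finset.mem_univ a)).trans
      (Finset.single_le_sum (f := fun b => ∑ a, Q₂ b a)
        (fun b _ => Finset.sum_nonneg fun a _ => (hQ₂ b a).le) (Finset.mem_univ b))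
  have hQ₂0 : 0 ≤ ∑ b, ∑ a, Q₂ b a :=
    Finset.sum_nonneg fun b _ => Finset.sum_nonneg fun a _ => (hQ₂ b a).le
  set E := Q + Q₀ + ∑ b, ∑ a, Q₂ b a with hE
  have hE0 : 0 < E := by positivity
  set L := C₀ * (1 + (k * CX) ^ M) with hL
  have hL0 : 0 < L := by positivity
  -- `D q ‖θ - θ₀‖` bounds the remainder if the Hessian is `q`-close to its limit
  set D : ℝ := d * (d * (Λ * d)) with hD
  have hD0 : 0 ≤ D := by positivity
  set r := min r₀ (1 / (4 * (D * L + 1))) with hr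
  have hr0 : 0 < r := by positivity
  obtain ⟨δ, hδ, hident⟩ := exists_uniform_identification hΘ hcont hθ₀Θ hmin hr0
  -- `C₃` is the constant of the rate, `C₄` the one of the expansion
  set C₃ : ℝ := 2 * (d * (d * (Λ * (Q + 1)))) with hC₃
  have hC₃0 : 0 ≤ C₃ := by positivity
  set C₄ := D * (E + L * C₃ * (1 + CB)) * C₃ with hC₄
  have hC₄0 : 0 ≤ C₄ := by positivity
  have hhς : Tendsto (fun n => h n ^ ς) atTop (𝓝 0) := by
    have := hzero.rpow_const (p := ς) (Or.inr hloc.hoelder_pos.le)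
    rwa [Real.zero_rpow hloc.hoelder_pos.ne'] at this
  have hsum := hτ.add hhς
  rw [add_zero] at hsum
  have hsmall₁ : ∀ᶠ n : ℕ in atTop,
      2 * E * (Real.sqrt (Real.log n / (n * h n)) + h n ^ ς) < δ := by
    have := hsum.const_mul (2 * E)
    rw [mul_zero] at this
    exact this.eventually (gt_mem_nhds hδ)
  have hsmall₂ : ∀ᶠ n : ℕ in atTop,
      D * E * (Real.sqrt (Real.log n / (n * h n)) + h n ^ ς) < 1 / 4 := by
    have := hsum.const_mul (D * E)
    rw [mul_zero] at this
    exact this.eventually (gt_mem_nhds (by norm_num))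
  have hlogt : Tendsto (fun n : ℕ => Real.log n) atTop atTop :=
    Real.tendsto_log_atTop.comp tendsto_natCast_atTop_atTop
  refine ⟨C₃ + C₄ + 1, by positivity, ?_⟩
  filter_upwards [hsmall₁, hsmall₂, eventually_ge_atTop k, hnh.eventually_ge_atTop 1,
    hlogt.eventually_ge_atTop 1] with n hs₁ hs₂ hkn hnh1 hlog ω g₀ g₁ g₂ v hv
  have hh := hpos n
  have hnh0 : 0 < (n : ℝ) * h n := by linarith
  have hv01 : v ∈ Icc (0 : ℝ) 1 := ⟨by linarith [hv.1], by linarith [hv.2]⟩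
  obtain ⟨hmem, hθmin⟩ := hθhat n v hv01 ω
  set X : ℤ → Ω → ℝ := fun i ω => J n i (innovPast ε i ω) with hX
  set t := Real.sqrt (Real.log n / (n * h n)) with ht
  have ht0 : 0 ≤ t := Real.sqrt_nonneg _
  have hς0 : 0 ≤ h n ^ ς := by positivity
  have hdiv : Q * (Real.sqrt (n * h n) * Real.sqrt (Real.log n)) / (n * h n) = Q * t := by
    rw [mul_div_assoc, sqrt_mul_sqrt_log_div hnh0]
  have hone : 1 / ((n : ℝ) * h n) ≤ t := one_div_le_sqrt_log_div hnh1 hlog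
  have herr : ∀ q : ℝ, 0 ≤ q → q ≤ Q₀ + ∑ b, ∑ a, Q₂ b a →
      Q * (Real.sqrt (n * h n) * Real.sqrt (Real.log n)) / (n * h n) +
        q * (h n ^ ς + 1 / (n * h n)) ≤ E * (t + h n ^ ς) := by
    intro q hq0 hq
    rw [hdiv]
    calc Q * t + q * (h n ^ ς + 1 / (n * h n)) ≤
        Q * (t + h n ^ ς) + (Q₀ + ∑ b, ∑ a, Q₂ b a) * (h n ^ ς + t) := by
          gcongr
          linarith
      _ = E * (t + h n ^ ς) := by rw [hE]; ring
  -- consistency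
  have hcons : ‖θhat n v ω - θ₀ v‖ < r := by
    refine hident v hv01 _ hmem ?_
    have h1 : ∀ θ ∈ Θ, |locObjective K ℓ X n (h n) v ω θ - limitMean μ ε Jt ℓ v θ| ≤
        E * (t + h n ^ ς) := fun θ hθ => by
      rw [locObjective_eq]
      exact (happ₀ n (h n) v hh hnh1 hkn hv.1 hv.2 θ hθ ω _ (g₀ v hv01 θ hθ)).trans
        (herr Q₀ hQ₀.le (by linarith))
    have h2 := abs_le.1 (h1 _ hmem)
    have h3 := abs_le.1 (h1 _ (hθ₀Θ v hv01))
    have h4 : locObjective K ℓ X n (h n) v ω (θhat n v ω) ≤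
        locObjective K ℓ X n (h n) v ω (θ₀ v) := hθmin (hθ₀Θ v hv01)
    linarith [h2.1, h3.2]
  have hexp := norm_sub_add_inv_mulVec_gradient_le hdiff hθmin (hball v hv01)
    (hcons.le.trans (min_le_left _ _)) (hApos v hv01) (hinv v hv01) hL0.le
    (Φ := fun b a θ =>
      limitMean μ ε Jt (fun θ z => nablaTensor 2 (fun ϑ => ℓ ϑ z) θ ![b, a]) v θ)
    (fun b a ϑ hϑ => by
      rw [hA]
      exact abs_limitMean_sub_le_norm hε hloc (hP₂ b a) hv01 hϑ (hθ₀ v hv01))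
    (fun b a ϑ hϑ => (happ₂ b a n (h n) v hh hnh1 hkn hv.1 hv.2 ϑ hϑ ω _
      (g₂ b a v hv01 ϑ hϑ)).trans (herr _ (hQ₂ b a).le ((hQ₂s b a).trans (by linarith))))
  set x := θhat n v ω - θ₀ v with hx
  set β := (locBias μ K ℓ X θ₀ n (h n)).toReal with hβ
  have hβ0 : 0 ≤ β := ENNReal.toReal_nonneg
  have hβle : β ≤ CB * h n ^ ς :=
    ENNReal.toReal_le_of_le_ofReal (by positivity) (hbias n (h n) hh hnh1)
  have hfin : locBias μ K ℓ X θ₀ n (h n) ≠ ⊤ :=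
    ((hbias n (h n) hh hnh1).trans_lt ENNReal.ofReal_lt_top).ne
  -- the gradient at the true parameter is of the order `t + β`
  have hgrad : ∀ a, |gradient (locObjective K ℓ X n (h n) v ω) (θ₀ v) a| ≤ (Q + 1) * (t + β) := by
    intro a
    have h1 := g₁ a v hv01 (θ₀ v) (hθ₀ v hv01)
    rw [kernelSum_sub] at h1
    have h2 : |(∫ ω, gradient (locObjective K ℓ X n (h n) v ω) (θ₀ v) ∂μ) a| ≤ β := by
      rw [← Real.norm_eq_abs]
      refine (PiLp.norm_apply_le _ a).trans ?_
      rw [← toReal_enorm]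
      exact ENNReal.toReal_mono hfin (le_iSup₂_of_le v hv01 le_rfl)
    rw [integral_gradient_locObjective hε hloc hdiff hP₁ n (h n) v (hθ₀ v hv01)] at h2
    rw [gradient_locObjective hdiff (hθ₀ v hv01)]
    have h3 : |1 / (n * h n) * (kernelSum K k n (h n) v fun i => nablaTensor 1
          (fun ϑ => ℓ ϑ (lagWindow k X i ω)) (θ₀ v) ![a]) -
        1 / (n * h n) * (kernelSum K k n (h n) v fun i => ∫ ω', nablaTensor 1
          (fun ϑ => ℓ ϑ (lagWindow k X i ω')) (θ₀ v) ![a] ∂μ)| ≤ Q * t := by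
      rw [← mul_sub, one_div_mul_eq_div, abs_div, abs_of_pos hnh0, ← hdiv]
      gcongr
    have h4 := abs_sub_abs_le_abs_sub
      (1 / (n * h n) * (kernelSum K k n (h n) v fun i => nablaTensor 1
          (fun ϑ => ℓ ϑ (lagWindow k X i ω)) (θ₀ v) ![a]))
      (1 / (n * h n) * (kernelSum K k n (h n) v fun i => ∫ ω', nablaTensor 1
          (fun ϑ => ℓ ϑ (lagWindow k X i ω')) (θ₀ v) ![a] ∂μ))
    have h5 : 0 ≤ Q * β := by positivity
    linarith
  have hmul := norm_toLp_mulVec_le (hinv v hv01) hgrad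
  set y := WithLp.toLp 2 ((A v)⁻¹.mulVec
    (gradient (locObjective K ℓ X n (h n) v ω) (θ₀ v)).ofLp) with hy
  have hexp' : ‖x + y‖ ≤ D * (E * (t + h n ^ ς) + L * ‖x‖) * ‖x‖ :=
    hexp.trans (le_of_eq (by rw [hD]; ring))
  have hx0 := norm_nonneg x
  -- by consistency, half of `‖x‖` absorbs the remainder
  have hhalf : D * (E * (t + h n ^ ς) + L * ‖x‖) ≤ 1 / 2 := by
    have h1 : D * L * ‖x‖ ≤ 1 / 4 := by
      have h2 : ‖x‖ ≤ 1 / (4 * (D * L + 1)) := hcons.le.trans (min_le_right _ _)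
      have h3 : 0 ≤ D * L := by positivity
      calc D * L * ‖x‖ ≤ D * L * (1 / (4 * (D * L + 1))) := by gcongr
        _ ≤ 1 / 4 := by
          rw [mul_one_div, div_le_div_iff₀ (by positivity) (by norm_num)]
          linarith
    linarith
  have hrate : ‖x‖ ≤ C₃ * (t + β) := by
    have h1 : ‖x‖ ≤ ‖x + y‖ + ‖y‖ := by
      simpa using norm_sub_le (x + y) y
    have h2 := mul_le_mul_of_nonneg_right hhalf hx0
    have h3 : C₃ * (t + β) = 2 * (d * (d * (Λ * ((Q + 1) * (t + β))))) := by rw [hC₃]; ring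
    linarith
  have htβ : 0 ≤ t + β := by linarith
  refine ⟨hrate.trans (mul_le_mul_of_nonneg_right (by linarith) htβ), hexp'.trans ?_⟩
  calc D * (E * (t + h n ^ ς) + L * ‖x‖) * ‖x‖ ≤
      D * (E * (t + h n ^ ς) + L * (C₃ * ((1 + CB) * (t + h n ^ ς)))) * (C₃ * (t + β)) := by
        have h1 : t + β ≤ (1 + CB) * (t + h n ^ ς) := by
          have : 0 ≤ CB * t := by positivity
          nlinarith
        gcongr
        exact hrate.trans (mul_le_mul_of_nonneg_left h1 hC₃0)
    _ = C₄ * ((t + h n ^ ς) * (t + β)) := by rw [hC₄]; ring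
    _ ≤ _ := mul_le_mul_of_nonneg_right (by linarith) (by positivity)

end MEstimation

/-! ### The rates of the minimizer -/

lemma tendsto_sqrt_log_div {h : ℕ → ℝ} {ν Cm : ℝ} (hν : 0 < ν)
    (hpos : ∀ n, 0 < h n)
    (hm : ∀ᶠ n : ℕ in atTop,
      Real.sqrt (Real.log n) * (n : ℝ) ^ (1 / ν) ≤ Cm * Real.sqrt (n * h n)) :
    Tendsto (fun n : ℕ => Real.sqrt (Real.log n / (n * h n))) atTop (𝓝 0) := by
  have h1 : Tendsto (fun n : ℕ => Cm * (n : ℝ) ^ (-(1 / ν))) atTop (𝓝 (Cm * 0)) :=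
    ((tendsto_rpow_neg_atTop (by positivity)).comp tendsto_natCast_atTop_atTop).const_mul Cm
  rw [mul_zero] at h1
  refine squeeze_zero' (Eventually.of_forall fun n => Real.sqrt_nonneg _) ?_ h1
  filter_upwards [hm, eventually_gt_atTop 0] with n hn hn0
  have hn' : (0 : ℝ) < n := by exact_mod_cast hn0
  have h2 : 0 < (n : ℝ) * h n := mul_pos hn' (hpos n)
  rw [Real.sqrt_div' _ h2.le, div_le_iff₀ (Real.sqrt_pos.2 h2), Real.rpow_neg hn'.le,
    mul_assoc, inv_mul_eq_div, mul_div_assoc', le_div_iff₀ (by positivity)]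
  exact hn

section Rates

variable {Ω : Type*} [MeasurableSpace Ω] {μ : Measure Ω}

/-- A stochastic order bound from a bound outside of events of small probability. -/
lemma isBigOp_of_forall_norm_le {E : Type*} [NormedAddCommGroup E] {Y : ℕ → ℝ → Ω → E}
    {I : ℕ → Set ℝ} {a : ℕ → ℝ≥0∞} {r : ℕ → ℝ} (hr : ∀ᶠ n in atTop, ENNReal.ofReal (r n) = a n)
    (H : ∀ η : ℝ, 0 < η → ∃ C : ℝ, 0 < C ∧ ∀ᶠ n in atTop, ∃ N : Set Ω,
      μ N ≤ ENNReal.ofReal η ∧ ∀ ω, ω ∉ N → ∀ v ∈ I n, ‖Y n v ω‖ ≤ C * r n) :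
    IsBigOp μ (fun n ω => ⨆ v ∈ I n, ‖Y n v ω‖ₑ) a := by
  intro η hη
  obtain ⟨C, hC, hN⟩ := H η hη
  refine ⟨C.toNNReal, ?_⟩
  filter_upwards [hN, hr] with n ⟨N, hμ, hN⟩ hrn
  refine (measure_mono fun ω hω => ?_).trans hμ
  by_contra hnot
  have hlt : (C.toNNReal : ℝ≥0∞) * a n < ⨆ v ∈ I n, ‖Y n v ω‖ₑ := hω
  refine absurd hlt (not_lt.2 (iSup₂_le fun v hv => ?_))
  rw [← ofReal_norm, ← hrn]
  refine (ENNReal.ofReal_le_ofReal (hN ω hnot v hv)).trans (le_of_eq ?_)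
  rw [ENNReal.ofReal_mul hC.le]
  rfl

end Rates

theorem mainTheorem12
    {Ω : Type*} [MeasurableSpace Ω] (μ : Measure Ω) [IsProbabilityMeasure μ]
    -- the process: innovations in `ℝ^dε`, the array `X_{i,n} = J_{i,n}(𝒢_i)`, and `X̃_i(u)`
    {dε : ℕ} (ε : ℤ → Ω → (Fin dε → ℝ)) (hε : IsIIDInnovation μ ε)
    (J : ℕ → ℤ → (ℕ → (Fin dε → ℝ)) → ℝ) (Jt : (ℕ → (Fin dε → ℝ)) → ℝ → ℝ)
    (X : ℕ → ℤ → Ω → ℝ) (hX : X = fun n i ω => J n i (innovPast ε i ω))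
    (Xt : ℝ → ℤ → Ω → ℝ) (hXt : Xt = fun u i ω => Jt (innovPast ε i ω) u)
    (M CX ς : ℝ) (hM : 1 ≤ M) (hloc : IsLocallyStationary μ ε J Jt M CX ς)
    (ν : ℝ) (hν : 2 < ν)
    (hmoment : ∀ (n : ℕ) (i : ℤ), 1 ≤ i → i ≤ n →
      eLpNorm (X n i) (ENNReal.ofReal (ν * M)) μ ≤ ENNReal.ofReal CX)
    -- kernel and bandwidth
    (K : ℝ → ℝ) (hK : IsLocKernel K)
    (h : ℕ → ℝ) (hpos : ∀ n, 0 < h n) (hzero : Tendsto h atTop (𝓝 0))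
    (hnh : Tendsto (fun n : ℕ => (n : ℝ) * h n) atTop atTop)
    -- parameters and objective functions
    {d k : ℕ} (hk : 1 ≤ k)
    (Θ : Set (EuclideanSpace ℝ (Fin d))) (hΘ : IsCompact Θ)
    (θ₀ : ℝ → EuclideanSpace ℝ (Fin d)) (hθ₀ : ∀ v ∈ Icc (0 : ℝ) 1, θ₀ v ∈ interior Θ)
    (ℓ : EuclideanSpace ℝ (Fin d) → (Fin k → ℝ) → ℝ)
    (hmeas : ∀ θ ∈ Θ, Measurable (ℓ θ))
    (hdiff : ∀ z, ContDiffOn ℝ 2 (fun θ => ℓ θ z) (interior Θ))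
    -- the estimator: an arbitrary minimizer
    (θhat : ℕ → ℝ → Ω → EuclideanSpace ℝ (Fin d))
    (hθhat : ∀ n : ℕ, ∀ v ∈ Icc (0 : ℝ) 1, ∀ ω,
      θhat n v ω ∈ Θ ∧ IsMinOn (locObjective K ℓ (X n) n (h n) v ω) Θ (θhat n v ω))
    -- (A1)
    (LF : Fin k → ℝ) (CR Cf : ℝ)
    (hA1 : ∀ j ≤ 2, IsLRCClass
      {f | ∃ θ ∈ nablaDomain Θ j, f = fun z => nablaTensor j (fun θ' => ℓ θ' z) θ}
      LF 1 (fun z => 1 + l1norm z ^ (M - 1)) CR Cf)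
    -- (A2)
    (CΘ : ℝ) (hCΘ : 0 < CΘ)
    (hA2 : ∀ j ≤ 2, ∀ z : Fin k → ℝ, ∀ θ ∈ nablaDomain Θ j, ∀ θ' ∈ nablaDomain Θ j,
      ‖nablaTensor j (fun ϑ => ℓ ϑ z) θ - nablaTensor j (fun ϑ => ℓ ϑ z) θ'‖
        ≤ CΘ * (1 + l1norm z ^ M) * ‖θ - θ'‖)
    -- (A3)
    (I : ℝ → Matrix (Fin d) (Fin d) ℝ)
    (hI : I = fun v => expectedHessian μ ℓ (lagWindow k (Xt v) 0) (θ₀ v))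
    (hA3min : ∀ v ∈ Icc (0 : ℝ) 1, ∀ θ ∈ Θ, θ ≠ θ₀ v →
      ∫ ω, ℓ (θ₀ v) (lagWindow k (Xt v) 0 ω) ∂μ < ∫ ω, ℓ θ (lagWindow k (Xt v) 0 ω) ∂μ)
    (hA3pos : ∀ v ∈ Icc (0 : ℝ) 1, (I v).PosDef)
    -- decay of dependence and size of the bandwidth
    (hdecay :
      (∃ κ : ℝ, 0 < κ ∧ ∃ α : ℝ, 1 < α ∧
        (∀ n j : ℕ, 1 ≤ j →
          depMeasure μ ε (J n) n (2 * M) j ≤ ENNReal.ofReal (κ * (j : ℝ) ^ (-α))) ∧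
        ∃ c : ℝ, 0 < c ∧ ∀ n : ℕ, 1 ≤ n →
          c * (Real.log n / (n : ℝ) ^ (1 - 2 / ν)) ^ ((α - 1) / α) ≤ h n) ∨
      (∃ κ : ℝ, 0 < κ ∧ ∃ ρ : ℝ, 0 < ρ ∧ ρ < 1 ∧
        (∀ n j : ℕ, 1 ≤ j →
          depMeasure μ ε (J n) n (2 * M) j ≤ ENNReal.ofReal (κ * ρ ^ j)) ∧
        ∃ c : ℝ, 0 < c ∧ ∀ n : ℕ, 1 ≤ n →
          c * (Real.log n ^ 3 / (n : ℝ) ^ (1 - 2 / ν)) ≤ h n))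
    -- the rates `τ_n` and `B_h`
    (τ : ℕ → ℝ) (hτ : τ = fun n : ℕ => Real.sqrt (Real.log n / ((n : ℝ) * h n)))
    (B : ℕ → ℝ≥0∞) (hB : B = fun n => locBias μ K ℓ (X n) θ₀ n (h n)) :
    (∃ C : ℝ, ∀ᶠ n in atTop, B n ≤ ENNReal.ofReal (C * h n ^ ς)) ∧
    IsBigOp μ
      (fun n ω => ⨆ v ∈ Icc (h n / 2) (1 - h n / 2), ‖θhat n v ω - θ₀ v‖ₑ)
      (fun n => ENNReal.ofReal (τ n) + B n) ∧
    IsBigOp μ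
      (fun n ω => ⨆ v ∈ Icc (h n / 2) (1 - h n / 2),
        ‖(θhat n v ω - θ₀ v) + WithLp.toLp 2
          ((I v)⁻¹.mulVec (gradient (locObjective K ℓ (X n) n (h n) v ω) (θ₀ v)).ofLp)‖ₑ)
      (fun n => ENNReal.ofReal (τ n + h n ^ ς) * (ENNReal.ofReal (τ n) + B n)) := by
  subst hX hXt hI hτ hB
  have hCX := hloc.CX_pos
  have hν0 : 0 < ν := by linarith
  obtain ⟨Δ, hΔ0, ⟨D₀, hD₀⟩, hΔ, Cm, Ct, hCm, hblock⟩ := exists_blockLength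
    (dep := fun n j => depMeasure μ ε (J n) n (2 * M) j) (ν := ν) (c₀ := 2 * CX) (by positivity)
    (fun n => depMeasure_le_two_mul hε (hloc.meas_J n) (by linarith) hCX.le (hloc.moment n) 0)
    hpos hzero hnh hdecay
  have hτ : Tendsto (fun n : ℕ => Real.sqrt (Real.log n / (n * h n))) atTop (𝓝 0) := by
    refine tendsto_sqrt_log_div (Cm := Cm) hν0 hpos ?_
    filter_upwards [hblock] with n ⟨m, hm, _⟩
    refine le_trans (le_mul_of_one_le_left (by positivity) ?_) hm
    linarith [Nat.cast_nonneg (α := ℝ) m]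
  -- all entries of the derivatives belong to classes of polynomial growth
  set C₀ := ∑ i, LF i + Cf + CΘ with hC₀
  have hP : ∀ x : Σ j : Fin 3, (Fin (j : ℕ) → Fin d), IsPolyClass (nablaDomain Θ (x.1 : ℕ))
      (fun θ z => nablaTensor (x.1 : ℕ) (fun ϑ => ℓ ϑ z) θ x.2) M C₀ := fun x =>
    isPolyClass_nablaTensor hM hCΘ (hA1 _ (by omega)) (hA2 _ (by omega)) x.2
  have hP₀ : IsPolyClass Θ ℓ M C₀ := by
    have := hP ⟨0, ![]⟩
    simpa [nablaDomain, nablaTensor_zero_apply] using this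
  have hP₁ : ∀ a : Fin d, IsPolyClass (interior Θ)
      (fun θ z => nablaTensor 1 (fun ϑ => ℓ ϑ z) θ ![a]) M C₀ := fun a => hP ⟨1, ![a]⟩
  have hP₂ : ∀ b a : Fin d, IsPolyClass (interior Θ)
      (fun θ z => nablaTensor 2 (fun ϑ => ℓ ϑ z) θ ![b, a]) M C₀ := fun b a => hP ⟨2, ![b, a]⟩
  have hmin : ∀ v ∈ Icc (0 : ℝ) 1, ∀ θ ∈ Θ, θ ≠ θ₀ v →
      limitMean μ ε Jt ℓ v (θ₀ v) < limitMean μ ε Jt ℓ v θ := hA3min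
  obtain ⟨CB, hCB, hbias⟩ := exists_locBias_le hε hloc hK hdiff hP₀ hP₁ hθ₀
    fun v hv => isMinOn_iff.2 fun θ hθ => by
      rcases eq_or_ne θ (θ₀ v) with h' | h'
      · rw [h']
      · exact (hmin v hv θ hθ h').le
  have hB : ∀ᶠ n : ℕ in atTop, locBias μ K ℓ (fun i ω => J n i (innovPast ε i ω)) θ₀ n (h n) ≤
      ENNReal.ofReal (CB * h n ^ ς) := by
    filter_upwards [hnh.eventually_ge_atTop 1] with n hn
    exact hbias n (h n) (hpos n) hn
  have hlogt : Tendsto (fun n : ℕ => Real.log n) atTop atTop :=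
    Real.tendsto_log_atTop.comp tendsto_natCast_atTop_atTop
  have hexp : ∀ η : ℝ, 0 < η → ∃ C : ℝ, 0 < C ∧ ∀ᶠ n in atTop, ∃ N : Set Ω,
      μ N ≤ ENNReal.ofReal η ∧ ∀ ω, ω ∉ N → ∀ v ∈ Icc (h n / 2) (1 - h n / 2),
        ‖θhat n v ω - θ₀ v‖ ≤ C * (Real.sqrt (Real.log n / (n * h n)) +
          (locBias μ K ℓ (fun i ω => J n i (innovPast ε i ω)) θ₀ n (h n)).toReal) ∧
        ‖(θhat n v ω - θ₀ v) + WithLp.toLp 2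
            ((expectedHessian μ ℓ (lagWindow k (fun i ω => Jt (innovPast ε i ω) v) 0)
              (θ₀ v))⁻¹.mulVec (gradient (locObjective K ℓ
                (fun i ω => J n i (innovPast ε i ω)) n (h n) v ω) (θ₀ v)).ofLp)‖ ≤
          C * ((Real.sqrt (Real.log n / (n * h n)) + h n ^ ς) *
            (Real.sqrt (Real.log n / (n * h n)) +
              (locBias μ K ℓ (fun i ω => J n i (innovPast ε i ω)) θ₀ n (h n)).toReal)) := by
    intro η hη
    have : Nonempty (Σ j : Fin 3, (Fin (j : ℕ) → Fin d)) := ⟨⟨0, ![]⟩⟩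
    have hbdd : ∀ x : Σ j : Fin 3, (Fin (j : ℕ) → Fin d),
        Bornology.IsBounded (nablaDomain Θ (x.1 : ℕ)) := fun x => by
      refine hΘ.isBounded.subset ?_
      unfold nablaDomain
      split_ifs
      · exact subset_rfl
      · exact interior_subset
    obtain ⟨Q, hQ, hconc⟩ := exists_measure_kernelSum_gt_le_of_fintype hε hbdd hP hν hCX.le hK hΔ0
      hD₀ hCm Ct hk hη
    obtain ⟨C, hC, hmain⟩ := exists_minimizer_expansion hε hloc hK hpos hzero hnh hτ hk hΘ hθ₀ hdiff
      hθhat hP₀ hP₁ hP₂ hmin (A := fun v => expectedHessian μ ℓ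
        (lagWindow k (fun i ω => Jt (innovPast ε i ω) v) 0) (θ₀ v)) (fun v b a => rfl) hA3pos hQ
    refine ⟨C, hC, ?_⟩
    filter_upwards [hmain, hblock, eventually_ge_atTop k, hnh.eventually_ge_atTop 1,
      hlogt.eventually_ge_atTop 1, hzero.eventually (ge_mem_nhds one_pos)]
      with n hn ⟨m, hm, hmt⟩ hkn hnh1 hlog hh1
    refine ⟨_, hconc n (J n) (h n) m (hloc.meas_J n) (hmoment n) (hΔ n) hkn (hpos n) hh1 hnh1 hlog
      hm hmt, fun ω hω => ?_⟩
    have hgood : ∀ x : Σ j : Fin 3, (Fin (j : ℕ) → Fin d), ∀ v ∈ Icc (0 : ℝ) 1,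
        ∀ θ ∈ nablaDomain Θ (x.1 : ℕ), |kernelSum K k n (h n) v fun i =>
          nablaTensor (x.1 : ℕ)
              (fun ϑ => ℓ ϑ (lagWindow k (fun i ω => J n i (innovPast ε i ω)) i ω)) θ x.2 -
            ∫ ω', nablaTensor (x.1 : ℕ)
              (fun ϑ => ℓ ϑ (lagWindow k (fun i ω => J n i (innovPast ε i ω)) i ω')) θ x.2 ∂μ| ≤
          Q * (Real.sqrt (n * h n) * Real.sqrt (Real.log n)) := by
      intro x v hv θ hθ
      by_contra hlt
      exact hω ⟨x, v, hv, θ, hθ, not_le.1 hlt⟩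
    refine hn ω (fun v hv θ hθ => ?_) (fun a v hv θ hθ => hgood ⟨1, ![a]⟩ v hv θ hθ)
      (fun b a v hv θ hθ => hgood ⟨2, ![b, a]⟩ v hv θ hθ)
    have := hgood ⟨0, ![]⟩ v hv θ (by simpa [nablaDomain] using hθ)
    simpa [nablaTensor_zero_apply] using this
  -- the bias is finite for large `n`, so that passing to `ℝ` loses nothing
  have hfin : ∀ᶠ n : ℕ in atTop, ENNReal.ofReal (Real.sqrt (Real.log n / (n * h n)) +
      (locBias μ K ℓ (fun i ω => J n i (innovPast ε i ω)) θ₀ n (h n)).toReal) =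
        ENNReal.ofReal (Real.sqrt (Real.log n / (n * h n))) +
          locBias μ K ℓ (fun i ω => J n i (innovPast ε i ω)) θ₀ n (h n) := by
    filter_upwards [hB] with n hn
    rw [ENNReal.ofReal_add (Real.sqrt_nonneg _) ENNReal.toReal_nonneg,
      ENNReal.ofReal_toReal (hn.trans_lt ENNReal.ofReal_lt_top).ne]
  refine ⟨⟨CB, hB⟩, isBigOp_of_forall_norm_le hfin fun η hη => ?_,
    isBigOp_of_forall_norm_le (r := fun n => (Real.sqrt (Real.log n / (n * h n)) + h n ^ ς) *
      (Real.sqrt (Real.log n / (n * h n)) +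
        (locBias μ K ℓ (fun i ω => J n i (innovPast ε i ω)) θ₀ n (h n)).toReal)) ?_
      fun η hη => ?_⟩
  · obtain ⟨C, hC, hn⟩ := hexp η hη
    exact ⟨C, hC, hn.mono fun n ⟨N, hN, hω⟩ => ⟨N, hN, fun ω h' v hv => (hω ω h' v hv).1⟩⟩
  · filter_upwards [hfin] with n hn
    have := Real.rpow_nonneg (hpos n).le ς
    rw [ENNReal.ofReal_mul (add_nonneg (Real.sqrt_nonneg _) this), hn]
  · obtain ⟨C, hC, hn⟩ := hexp η hη
    exact ⟨C, hC, hn.mono fun n ⟨N, hN, hω⟩ => ⟨N, hN, fun ω h' v hv => (hω ω h' v hv).2⟩⟩
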